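/- Let $n\ge 1$ be an integer and let $(\mathcal C,\mathbb E,\mathfrak s)$ be an $n$-exangulated category in the sense of Herschend--Liu--Nakaoka: $\mathcal C$ is an additive category, $\mathbb E\colon\mathcal C^{\mathrm{op}}\times\mathcal C\to\mathsf{Ab}$ is a biadditive functor, and $\mathfrak s$ is an exact realisation of $\mathbb E$ (it assigns to each $\delta\in\mathbb E(C,A)$ a homotopy class $\mathfrak s(\delta)=[X_\bullet]$ of complexes $X_0\to X_1\to\cdots\to X_{n+1}$ with $X_0=A$ and $X_{n+1}=C$, homotopy equivalences being the identity on $A$ and $C$) satisfying the axioms (EA1), (EA2) and (EA2)$^{\mathrm{op}}$. Let $\widetilde{\mathcal C}$ be the idempotent completion of $\mathcal C$: its objects are pairs $(X,e)$ with $e=e^2\in\operatorname{End}_{\mathcal C}(X)$, and its morphisms $(X,e)\to(Y,e')$ are the morphisms $r\colon X\to Y$ in $\mathcal C$ with $re=r=e'r$. Let $\mathbb F\colon\widetilde{\mathcal C}^{\mathrm{op}}\times\widetilde{\mathcal C}\to\mathsf{Ab}$ be the functor $$\mathbb F((Z,e'),(X,e))=\{\delta\in\mathbb E(Z,X)\mid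 \mathbb E(Z,e)(\delta)=\delta=\mathbb E(e',X)(\delta)\},$$ acting on morphisms by restriction of $\mathbb E$. For $\delta\in\mathbb F((Z,e'),(X,e))$ put $\mathfrak t(\delta)=[(X_\bullet,e_\bullet)]$, where $\mathfrak s(\delta)=[X_\bullet]$, where $e_\bullet\colon X_\bullet\to X_\bullet$ is an idempotent morphism of complexes with $e_0=e$ and $e_{n+1}=e'$, and where $(X_\bullet,e_\bullet)$ is the complex in $\widetilde{\mathcal C}$ with terms $(X_i,e_i)$ and differentials $e_{i+1}d_i^Xe_i$. Suppose that the endomorphism ring $R=\operatorname{End}_{\mathcal C}(X)$ of every object $X$ of $\mathcal C$ is semi-perfect, i.e. $R/J(R)$ is semisimple and idempotents lift modulo the Jacobson radical $J(R)$. Then $(\widetilde{\mathcal C},\mathbb F,\mathfrak t)$ is a Krull--Schmidt $n$-exangulated category. That is, $\mathfrak t$ is well defined (each $\mathfrak t(\delta)$ is a single homotopy class, independent of the choice of $X_\bullet$ and $e_\bullet$, and such a choice exists), $(\widetilde{\mathcal C},\mathbb F,\mathfrak t)$ is an $n$-exangulated category, and every object of $\widetilde{\mathcal C}$ is a finite direct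 sum of objects with local endomorphism rings. -/

import Mathlib

open CategoryTheory CategoryTheory.Limits Opposite
open scoped ZeroObject

universe w v u

noncomputable section

namespace NExangulated

/-! ## Rings and Krull-Schmidt categories -/

/-- A (not necessarily commutative, possibly zero) ring `R` is *semi-perfect* if `R / J(R)` is
semisimple, where `J(R)` is the Jacobson radical, and idempotents lift modulo `J(R)`. -/
structure IsSemiperfectRing (R : Type*) [Ring R] : Prop where
  isSemisimpleRing : IsSemisimpleRing (R ⧸ Ring.jacobson R)
  lift_idempotent : ∀ x : R ⧸ Ring.jacobson R, IsIdempotentElem x →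
    ∃ r : R, IsIdempotentElem r ∧ Ideal.Quotient.mk (Ring.jacobson R) r = x

/-- An additive category is *Krull-Schmidt* if every object is a finite direct sum of objects with
local endomorphism rings (the zero object being the empty direct sum). -/
def IsKrullSchmidt (C : Type u) [Category.{v} C] [Preadditive C] [HasFiniteBiproducts C] : Prop :=
  ∀ X : C, ∃ (m : ℕ) (Y : Fin m → C), (∀ i, IsLocalRing (End (Y i))) ∧ Nonempty (X ≅ ⨁ Y)

variable {C : Type u} [Category.{v} C]

/-! ## Extensions -/

section Extensions

/-- `Ext E B A` is the abelian group `E(B, A)` of `E`-extensions, for a bifunctor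
`E : Cᵒᵖ × C → Ab`, written in curried form. -/
abbrev Ext (E : Cᵒᵖ ⥤ C ⥤ AddCommGrpCat.{w}) (B A : C) : Type w :=
  (E.obj (op B)).obj A

variable (E : Cᵒᵖ ⥤ C ⥤ AddCommGrpCat.{w})

/-- `push E a δ = E(B, a)(δ)`. -/
def push {A A' B : C} (a : A ⟶ A') : Ext E B A →+ Ext E B A' :=
  ((E.obj (op B)).map a).hom

/-- `pull E b δ = E(b, A)(δ)`. -/
def pull {A B B' : C} (b : B' ⟶ B) : Ext E B A →+ Ext E B' A :=
  ((E.map b.op).app A).hom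

lemma push_id {A B : C} (δ : Ext E B A) : push E (𝟙 A) δ = δ := by
  simp [push]

lemma pull_id {A B : C} (δ : Ext E B A) : pull E (𝟙 B) δ = δ := by
  simp [pull]

lemma push_comp {A A' A'' B : C} (a : A ⟶ A') (a' : A' ⟶ A'') (δ : Ext E B A) :
    push E (a ≫ a') δ = push E a' (push E a δ) := by
  simp [push]

lemma pull_comp {A B B' B'' : C} (b' : B'' ⟶ B') (b : B' ⟶ B) (δ : Ext E B A) :
    pull E (b' ≫ b) δ = pull E b' (pull E b δ) := by
  simp [pull]

lemma push_pull {A A' B B' : C} (a : A ⟶ A') (b : B' ⟶ B) (δ : Ext E B A) :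
    push E a (pull E b δ) = pull E b (push E a δ) := by
  simp only [push, pull]
  exact (ConcreteCategory.congr_hom ((E.map b.op).naturality a) δ).symm

/-- The bifunctor `E` is biadditive. -/
structure IsBiadditive [Preadditive C] : Prop where
  additive_left : E.Additive
  additive_right : ∀ B : C, (E.obj (op B)).Additive

end Extensions

/-! ## Complexes concentrated in degrees `0, ..., n + 1` with prescribed end terms -/

section Complexes

variable [Preadditive C]

/-- A complex `X₀ ⟶ X₁ ⟶ ⋯ ⟶ Xₙ ⟶ Xₙ₊₁` concentrated in degrees `0, ..., n + 1`, with `X₀ = A` and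
`Xₙ₊₁ = B`. -/
structure ComplexBetween (n : ℕ) (A B : C) where
  /-- the underlying complex -/
  K : CochainComplex C ℕ
  isZero : ∀ i, n + 1 < i → IsZero (K.X i)
  left : K.X 0 = A
  right : K.X (n + 1) = B

namespace ComplexBetween

variable {n : ℕ} {A B A' B' : C}

/-- The first differential, as a morphism `A ⟶ X₁`. -/
def dFirst (X : ComplexBetween n A B) : A ⟶ X.K.X 1 :=
  eqToHom X.left.symm ≫ X.K.d 0 1

/-- The last differential, as a morphism `Xₙ ⟶ B`. -/
def dLast (X : ComplexBetween n A B) : X.K.X n ⟶ B :=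
  X.K.d n (n + 1) ≫ eqToHom X.right

/-- The morphism of complexes `f` satisfies `f₀ = a` and `fₙ₊₁ = b`. -/
def HasEnds {X : ComplexBetween n A B} {Y : ComplexBetween n A' B'} (f : X.K ⟶ Y.K)
    (a : A ⟶ A') (b : B ⟶ B') : Prop :=
  f.f 0 ≫ eqToHom Y.left = eqToHom X.left ≫ a ∧
    f.f (n + 1) ≫ eqToHom Y.right = eqToHom X.right ≫ b

/-- Homotopy equivalence of complexes with the same end terms `A` and `B`: there are mutually
inverse, up to homotopy, morphisms of complexes that are the identity on `A` and on `B`. -/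
def HomotopyEquivalent (X Y : ComplexBetween n A B) : Prop :=
  ∃ (f : X.K ⟶ Y.K) (g : Y.K ⟶ X.K),
    HasEnds f (𝟙 A) (𝟙 B) ∧ HasEnds g (𝟙 A) (𝟙 B) ∧
      Nonempty (Homotopy (f ≫ g) (𝟙 X.K)) ∧ Nonempty (Homotopy (g ≫ f) (𝟙 Y.K))

/-- The class `[X]` of all complexes homotopy equivalent to `X`, relative to the end terms. -/
def homotopyClass (X : ComplexBetween n A B) : Set (ComplexBetween n A B) :=
  {Y | HomotopyEquivalent X Y}

section Trivial

variable [HasZeroObject C] (n) [NeZero n] (A)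

/-- The complex `A = A ⟶ 0 ⟶ ⋯ ⟶ 0`, concentrated in degrees `0` and `1`. -/
def trivFirst : ComplexBetween n A (0 : C) where
  K := HomologicalComplex.double (𝟙 A) (show (ComplexShape.up ℕ).Rel 0 1 from rfl)
  isZero i hi := HomologicalComplex.isZero_double_X _ _ _ (by omega) (by omega)
  left := if_pos rfl
  right := by
    have := NeZero.ne n
    exact (if_neg (by omega)).trans (if_neg (by omega))

/-- The complex `0 ⟶ ⋯ ⟶ 0 ⟶ A = A`, concentrated in degrees `n` and `n + 1`. -/
def trivLast : ComplexBetween n (0 : C) A where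
  K := HomologicalComplex.double (𝟙 A) (show (ComplexShape.up ℕ).Rel n (n + 1) from rfl)
  isZero i hi := HomologicalComplex.isZero_double_X _ _ _ (by omega) (by omega)
  left := (if_neg (NeZero.ne n).symm).trans (if_neg (by omega))
  right := (if_neg (by omega)).trans (if_pos rfl)

end Trivial

end ComplexBetween

end Complexes

/-! ## Mapping cones and mapping cocones -/

section Cones

variable [Preadditive C] [HasFiniteBiproducts C]

attribute [local instance] hasBinaryBiproducts_of_finite_biproducts

/-- Which of the two summands `P` and `Q` occur in a term of a (truncated) mapping cone. -/
inductive Part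
  | fst
  | both
  | snd

namespace Part

/-- `P`, `P ⊕ Q` or `Q`. -/
def obj : Part → C → C → C
  | .fst, P, _ => P
  | .both, P, Q => P ⊞ Q
  | .snd, _, Q => Q

variable {P Q W W' : C}

/-- The morphism with components `a` and `b` (a component is dropped if the corresponding summand
does not occur). -/
def lift : (p : Part) → (W ⟶ P) → (W ⟶ Q) → (W ⟶ p.obj P Q)
  | .fst, a, _ => a
  | .both, a, b => biprod.lift a b
  | .snd, _, b => b

/-- The morphism with components `a` and `b` (a component is dropped if the corresponding summand
does not occur). -/
def desc : (p : Part) → (P ⟶ W) → (Q ⟶ W) → (p.obj P Q ⟶ W)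
  | .fst, a, _ => a
  | .both, a, b => biprod.desc a b
  | .snd, _, b => b

/-- Composites of lower triangular matrices vanish if their entries do. -/
lemma matrix_comp {P P' P'' Q Q' Q'' : C} (p q r : Part) (hq : q = .both)
    (a : P ⟶ P') (f : P ⟶ Q') (b : Q ⟶ Q') (a' : P' ⟶ P'') (f' : P' ⟶ Q'') (b' : Q' ⟶ Q'')
    (haa : a ≫ a' = 0) (hf : a ≫ f' + f ≫ b' = 0) (hbb : b ≫ b' = 0) :
    p.desc (q.lift a f) (q.lift 0 b) ≫ q.desc (r.lift a' f') (r.lift 0 b') = 0 := by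
  subst hq
  have h₁ : biprod.lift a f ≫ biprod.desc (r.lift a' f') (r.lift 0 b') = 0 := by
    rw [biprod.lift_desc]
    cases r
    · have h : a ≫ a' + f ≫ (0 : Q' ⟶ P'') = 0 := by simp [haa]
      exact h
    · have h : a ≫ biprod.lift a' f' + f ≫ biprod.lift (0 : Q' ⟶ P'') b' = 0 := by
        apply biprod.hom_ext <;> simp [haa, hf]
      exact h
    · exact hf
  have h₂ : biprod.lift 0 b ≫ biprod.desc (r.lift a' f') (r.lift 0 b') = 0 := by
    rw [biprod.lift_desc]
    cases r
    · have h : (0 : Q ⟶ P') ≫ a' + b ≫ (0 : Q' ⟶ P'') = 0 := by simp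
      exact h
    · have h : (0 : Q ⟶ P') ≫ biprod.lift a' f' + b ≫ biprod.lift (0 : Q' ⟶ P'') b' = 0 := by
        apply biprod.hom_ext <;> simp [hbb]
      exact h
    · have h : (0 : Q ⟶ P') ≫ f' + b ≫ b' = 0 := by simp [hbb]
      exact h
  cases p
  · exact h₁
  · change biprod.desc (biprod.lift a f) (biprod.lift 0 b) ≫
      biprod.desc (r.lift a' f') (r.lift 0 b') = 0
    apply biprod.hom_ext'
    · rw [biprod.inl_desc_assoc, h₁, comp_zero]
    · rw [biprod.inr_desc_assoc, h₂, comp_zero]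
  · exact h₂

end Part

namespace ComplexBetween

variable {n : ℕ} {A B A' B' : C} {X : ComplexBetween n A B} {Y : ComplexBetween n A' B'}

/-- The shape of the mapping cone: only the first summand in degree `0`, both summands in degrees
`1, ..., n`, and only the second summand in degrees `≥ n + 1`. -/
def conePart (n : ℕ) : ℕ → Part
  | 0 => .fst
  | i + 1 => if i < n then .both else .snd

/-- The terms `X₁`, `Xᵢ₊₁ ⊕ Yᵢ` for `1 ≤ i ≤ n`, and `Yₙ₊₁`. -/
def coneX (X : ComplexBetween n A B) (Y : ComplexBetween n A' B') (i : ℕ) : C :=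
  (conePart n i).obj (X.K.X (i + 1)) (Y.K.X i)

/-- The differential with components `-d : Xᵢ₊₁ ⟶ Xᵢ₊₂`, `f : Xᵢ₊₁ ⟶ Yᵢ₊₁`, `d : Yᵢ ⟶ Yᵢ₊₁`. -/
def coneD (f : X.K ⟶ Y.K) (i : ℕ) : coneX X Y i ⟶ coneX X Y (i + 1) :=
  (conePart n i).desc ((conePart n (i + 1)).lift (-X.K.d (i + 1) (i + 2)) (f.f (i + 1)))
    ((conePart n (i + 1)).lift 0 (Y.K.d i (i + 1)))

lemma isZero_coneX (X : ComplexBetween n A B) (Y : ComplexBetween n A' B') (i : ℕ)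
    (hi : n + 1 < i) : IsZero (coneX X Y i) := by
  obtain ⟨i, rfl⟩ : ∃ j, i = j + 1 := ⟨i - 1, by omega⟩
  have h : conePart n (i + 1) = .snd := if_neg (by omega)
  simp only [coneX, h]
  exact Y.isZero _ hi

lemma coneD_comp (f : X.K ⟶ Y.K) (i : ℕ) : coneD f i ≫ coneD f (i + 1) = 0 := by
  by_cases hi : n + 1 < i + 2
  · exact (isZero_coneX X Y (i + 2) hi).eq_of_tgt _ _
  · have h : conePart n (i + 1) = .both := if_pos (by omega)
    exact Part.matrix_comp _ _ _ h _ _ _ _ _ _ (by simp) (by simp) (by simp)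

/-- The mapping cone
`X₁ ⟶ X₂ ⊕ Y₁ ⟶ ⋯ ⟶ Xₙ₊₁ ⊕ Yₙ ⟶ Yₙ₊₁` of a morphism `f : X ⟶ Y` (used when `f₀` is an identity). -/
def cone (f : X.K ⟶ Y.K) : ComplexBetween n (X.K.X 1) B' where
  K := CochainComplex.of (coneX X Y) (coneD f) (coneD_comp f)
  isZero i hi := isZero_coneX X Y i hi
  left := rfl
  right := by
    have h : conePart n (n + 1) = .snd := if_neg (by omega)
    change coneX X Y (n + 1) = B'
    simp only [coneX, h]
    exact Y.right

/-- The shape of the mapping cocone: only the first summand in degree `0`, both summands in degrees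
`1, ..., n`, and only the second summand in degree `n + 1` (in larger degrees everything is
zero). -/
def coconePart (n : ℕ) (i : ℕ) : Part :=
  if i = 0 ∨ n + 1 < i then .fst else if i < n + 1 then .both else .snd

/-- The terms `X₀`, `Xᵢ ⊕ Yᵢ₋₁` for `1 ≤ i ≤ n`, and `Yₙ`. -/
def coconeX (X : ComplexBetween n A B) (Y : ComplexBetween n A' B') (i : ℕ) : C :=
  (coconePart n i).obj (X.K.X i) (Y.K.X (i - 1))

/-- The differential with components `d : Xᵢ ⟶ Xᵢ₊₁`, `f : Xᵢ ⟶ Yᵢ`, `-d : Yᵢ₋₁ ⟶ Yᵢ`. This is the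
differential of the mapping cone formed in the opposite category. -/
def coconeD (f : X.K ⟶ Y.K) (i : ℕ) : coconeX X Y i ⟶ coconeX X Y (i + 1) :=
  (coconePart n i).desc ((coconePart n (i + 1)).lift (X.K.d i (i + 1)) (f.f i))
    ((coconePart n (i + 1)).lift 0 (-Y.K.d (i - 1) i))

lemma isZero_coconeX (X : ComplexBetween n A B) (Y : ComplexBetween n A' B') (i : ℕ)
    (hi : n + 1 < i) : IsZero (coconeX X Y i) := by
  have h : coconePart n i = .fst := if_pos (Or.inr hi)
  simp only [coconeX, h]
  exact X.isZero _ hi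

lemma coconeD_comp (f : X.K ⟶ Y.K) (i : ℕ) : coconeD f i ≫ coconeD f (i + 1) = 0 := by
  by_cases hi : n + 1 < i + 2
  · exact (isZero_coconeX X Y (i + 2) hi).eq_of_tgt _ _
  · have h : coconePart n (i + 1) = .both := by
      rw [coconePart, if_neg (by omega), if_pos (by omega)]
    exact Part.matrix_comp _ _ _ h _ _ _ _ _ _ (by simp) (by simp) (by simp)

/-- The mapping cocone `X₀ ⟶ X₁ ⊕ Y₀ ⟶ ⋯ ⟶ Xₙ ⊕ Yₙ₋₁ ⟶ Yₙ` of a morphism `f : X ⟶ Y` (used when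
`fₙ₊₁` is an identity); it is the dual of the mapping cone. -/
def cocone (f : X.K ⟶ Y.K) : ComplexBetween n A (Y.K.X n) where
  K := CochainComplex.of (coconeX X Y) (coconeD f) (coconeD_comp f)
  isZero i hi := isZero_coconeX X Y i hi
  left := X.left
  right := by
    have h : coconePart n (n + 1) = .snd := by
      rw [coconePart, if_neg (by omega), if_neg (by omega)]
    change coconeX X Y (n + 1) = Y.K.X n
    simp only [coconeX, h]
    rfl

end ComplexBetween

end Cones

/-! ## `n`-exangulated categories -/

section Exangulated

variable [Preadditive C]

/-- The pair `⟨X, δ⟩` is an `n`-exangle: it is an `E`-attached complex and the sequences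
`C(-, X₀) ⟶ ⋯ ⟶ C(-, Xₙ₊₁) ⟶ E(-, X₀)` and `C(Xₙ₊₁, -) ⟶ ⋯ ⟶ C(X₀, -) ⟶ E(Xₙ₊₁, -)` are exact. -/
structure IsNExangle (E : Cᵒᵖ ⥤ C ⥤ AddCommGrpCat.{w}) {n : ℕ} {A B : C}
    (X : ComplexBetween n A B) (δ : Ext E B A) : Prop where
  push_dFirst : push E X.dFirst δ = 0
  pull_dLast : pull E X.dLast δ = 0
  exact_mid : ∀ (W : C) (i : ℕ), i < n →
    Function.Exact (fun g : W ⟶ X.K.X i => g ≫ X.K.d i (i + 1))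
      (fun g : W ⟶ X.K.X (i + 1) => g ≫ X.K.d (i + 1) (i + 2))
  exact_last : ∀ W : C,
    Function.Exact (fun g : W ⟶ X.K.X n => g ≫ X.dLast) (fun g : W ⟶ B => pull E g δ)
  coexact_mid : ∀ (W : C) (i : ℕ), i < n →
    Function.Exact (fun g : X.K.X (i + 2) ⟶ W => X.K.d (i + 1) (i + 2) ≫ g)
      (fun g : X.K.X (i + 1) ⟶ W => X.K.d i (i + 1) ≫ g)
  coexact_first : ∀ W : C,
    Function.Exact (fun g : X.K.X 1 ⟶ W => X.dFirst ≫ g) (fun g : A ⟶ W => push E g δ)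

/-- An assignment of a collection `s(δ)` of complexes from `A` to `B` to each extension
`δ ∈ E(B, A)`; that `s(δ)` is a homotopy class is part of `IsExactRealisation`. -/
abbrev Assignment (n : ℕ) (E : Cᵒᵖ ⥤ C ⥤ AddCommGrpCat.{w}) :=
  ∀ ⦃A B : C⦄, Ext E B A → Set (ComplexBetween n A B)

section

variable {n : ℕ} {E : Cᵒᵖ ⥤ C ⥤ AddCommGrpCat.{w}} (s : Assignment n E)

/-- `s` is an exact realisation of `E`: every `s(δ)` is a homotopy class `[X]` of complexes
relative to the end terms, and the conditions (R0), (R1), (R2) hold. -/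
structure IsExactRealisation [NeZero n] [HasZeroObject C] : Prop where
  exists_eq_homotopyClass : ∀ {A B : C} (δ : Ext E B A),
    ∃ X : ComplexBetween n A B, s δ = X.homotopyClass
  exists_lift : ∀ {A B A' B' : C} (δ : Ext E B A) (ρ : Ext E B' A') (a : A ⟶ A') (b : B ⟶ B'),
    push E a δ = pull E b ρ → ∀ X ∈ s δ, ∀ Y ∈ s ρ,
      ∃ f : X.K ⟶ Y.K, ComplexBetween.HasEnds f a b
  isNExangle : ∀ {A B : C} (δ : Ext E B A), ∀ X ∈ s δ, IsNExangle E X δ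
  zero_first : ∀ A : C, s (0 : Ext E (0 : C) A) = (ComplexBetween.trivFirst n A).homotopyClass
  zero_last : ∀ A : C, s (0 : Ext E A (0 : C)) = (ComplexBetween.trivLast n A).homotopyClass

/-- `f` is the first differential of a complex realising some extension. -/
def IsInflation {A A' : C} (f : A ⟶ A') : Prop :=
  ∃ (B : C) (δ : Ext E B A), ∃ X ∈ s δ, ∃ h : X.K.X 1 = A', X.dFirst ≫ eqToHom h = f

/-- `f` is the last differential of a complex realising some extension. -/
def IsDeflation {B' B : C} (f : B' ⟶ B) : Prop :=
  ∃ (A : C) (δ : Ext E B A), ∃ X ∈ s δ, ∃ h : B' = X.K.X n, eqToHom h ≫ X.dLast = f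

end

/-- `(C, E, s)` is an `n`-exangulated category, for an additive category `C` and `n ≥ 1`. -/
structure IsNExangulated [HasFiniteBiproducts C] (n : ℕ) [NeZero n]
    (E : Cᵒᵖ ⥤ C ⥤ AddCommGrpCat.{w}) (s : Assignment n E) : Prop where
  isBiadditive : IsBiadditive E
  isExactRealisation : IsExactRealisation s
  inflation_comp : ∀ {A A' A'' : C} (f : A ⟶ A') (g : A' ⟶ A''),
    IsInflation s f → IsInflation s g → IsInflation s (f ≫ g)
  deflation_comp : ∀ {B B' B'' : C} (f : B'' ⟶ B') (g : B' ⟶ B),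
    IsDeflation s f → IsDeflation s g → IsDeflation s (f ≫ g)
  exists_good_lift : ∀ {A B D : C} (δ : Ext E D A) (c : B ⟶ D),
    ∀ Y ∈ s (pull E c δ), ∀ X ∈ s δ, ∃ f : Y.K ⟶ X.K,
      ComplexBetween.HasEnds f (𝟙 A) c ∧
        s (push E Y.dFirst δ) = (ComplexBetween.cone f).homotopyClass
  exists_good_lift_op : ∀ {A A' B : C} (δ : Ext E B A) (a : A ⟶ A'),
    ∀ X ∈ s δ, ∀ Y ∈ s (push E a δ), ∃ f : X.K ⟶ Y.K,
      ComplexBetween.HasEnds f a (𝟙 B) ∧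
        s (pull E Y.dLast δ) = (ComplexBetween.cocone f).homotopyClass

end Exangulated

/-! ## The idempotent completion

The idempotent completion of `C` is Mathlib's `Idempotents.Karoubi C`: an object `P` is an object
`P.X` of `C` with an idempotent `P.p`, and a morphism `P ⟶ Q` is a morphism `r : P.X ⟶ Q.X` with
`P.p ≫ r ≫ Q.p = r` (equivalently `P.p ≫ r = r = r ≫ Q.p`). -/

section Completion

open Idempotents

section Bifunctor

variable (E : Cᵒᵖ ⥤ C ⥤ AddCommGrpCat.{w})

/-- For `Q = (Z, e')` and `P = (X, e)`, the subgroup of those `δ ∈ E(Z, X)` with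
`E(Z, e)(δ) = δ = E(e', X)(δ)`. -/
def extSubgroup (Q P : Karoubi C) : AddSubgroup (Ext E Q.X P.X) where
  carrier := {δ | push E P.p δ = δ ∧ pull E Q.p δ = δ}
  zero_mem' := ⟨map_zero _, map_zero _⟩
  add_mem' {x y} hx hy := by
    refine ⟨?_, ?_⟩
    · rw [map_add, hx.1, hy.1]
    · rw [map_add, hx.2, hy.2]
  neg_mem' {x} hx := by
    refine ⟨?_, ?_⟩
    · rw [map_neg, hx.1]
    · rw [map_neg, hx.2]

/-- `E(Z, a)` maps the subgroup for `(Q, P)` to the one for `(Q, P')`. -/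
def extSubgroupPush (Q : Karoubi C) {P P' : Karoubi C} (a : P ⟶ P') :
    extSubgroup E Q P →+ extSubgroup E Q P' :=
  ((push E a.f).comp (extSubgroup E Q P).subtype).codRestrict _ fun δ => by
    refine ⟨?_, ?_⟩
    · change push E P'.p (push E a.f δ.1) = push E a.f δ.1
      rw [← push_comp, Karoubi.comp_p]
    · change pull E Q.p (push E a.f δ.1) = push E a.f δ.1
      rw [← push_pull, δ.2.2]

/-- `E(b, X)` maps the subgroup for `(Q, P)` to the one for `(Q', P)`. -/
def extSubgroupPull {Q Q' : Karoubi C} (b : Q' ⟶ Q) (P : Karoubi C) :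
    extSubgroup E Q P →+ extSubgroup E Q' P :=
  ((pull E b.f).comp (extSubgroup E Q P).subtype).codRestrict _ fun δ => by
    refine ⟨?_, ?_⟩
    · change push E P.p (pull E b.f δ.1) = pull E b.f δ.1
      rw [push_pull, δ.2.1]
    · change pull E Q'.p (pull E b.f δ.1) = pull E b.f δ.1
      rw [← pull_comp, Karoubi.p_comp]

/-- The bifunctor `F` on the idempotent completion, given by
`F((Z, e'), (X, e)) = {δ ∈ E(Z, X) | E(Z, e)(δ) = δ = E(e', X)(δ)}` and, on morphisms, by
restriction of `E`. -/
def karoubiExt : (Karoubi C)ᵒᵖ ⥤ Karoubi C ⥤ AddCommGrpCat.{w} where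
  obj Q :=
    { obj := fun P => AddCommGrpCat.of (extSubgroup E Q.unop P)
      map := fun a => AddCommGrpCat.ofHom (extSubgroupPush E Q.unop a)
      map_id := fun P => by
        ext δ
        exact δ.2.1
      map_comp := fun a a' => by
        ext δ
        exact push_comp E a.f a'.f δ.1 }
  map b :=
    { app := fun P => AddCommGrpCat.ofHom (extSubgroupPull E b.unop P)
      naturality := fun P P' a => by
        ext δ
        exact (push_pull E a.f b.unop.f δ.1).symm }
  map_id Q := by
    ext P δ
    exact δ.2.2
  map_comp b b' := by
    ext P δ
    exact pull_comp E b'.unop.f b.unop.f δ.1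

/-- The underlying `E`-extension of an `F`-extension. -/
def underlying {Q P : Karoubi C} (δ : Ext (karoubiExt E) Q P) : Ext E Q.X P.X :=
  (show extSubgroup E Q P from δ).1

end Bifunctor

variable [Preadditive C] {n : ℕ}

/-- For a complex `X` in `C` and an idempotent morphism of complexes `e : X ⟶ X` with `e₀ = P.p` and
`eₙ₊₁ = Q.p`, the complex `(X, e)` in the idempotent completion, with terms `(Xᵢ, eᵢ)` and
differentials with underlying morphism `dᵢ eᵢ = eᵢ₊₁ dᵢ = eᵢ₊₁ dᵢ eᵢ`. -/
def ComplexBetween.karoubi {P Q : Karoubi C} (X : ComplexBetween n P.X Q.X) (e : X.K ⟶ X.K)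
    (he : e ≫ e = e) (hends : HasEnds e P.p Q.p) : ComplexBetween n P Q where
  K := KaroubiHomologicalComplexEquivalence.Functor.obj ⟨X.K, e, he⟩
  isZero i hi := by
    rw [IsZero.iff_id_eq_zero]
    ext
    exact (X.isZero i hi).eq_of_src _ _
  left := Karoubi.ext X.left hends.1
  right := Karoubi.ext X.right hends.2

/-- The assignment `t` on the idempotent completion: if `s(δ) = [X]` and `e : X ⟶ X` is an
idempotent morphism lifting `(P.p, Q.p) : δ ⟶ δ`, then `t(δ) = [(X, e)]`. (All choices of `X` and
`e` are collected here; that the result is a single homotopy class is part of the claim that `t` is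
an exact realisation.) -/
def karoubiAssignment {E : Cᵒᵖ ⥤ C ⥤ AddCommGrpCat.{w}} (s : Assignment n E) :
    Assignment n (karoubiExt E) :=
  fun P Q δ => {Z | ∃ X ∈ s (underlying E δ), ∃ (e : X.K ⟶ X.K) (he : e ≫ e = e)
    (hends : ComplexBetween.HasEnds e P.p Q.p), Z ∈ (X.karoubi e he hends).homotopyClass}

end Completion

end NExangulated

end

/-! Complexes with fixed ends are rigid. If the inner Hom sequences of `X` are exact on one side, an
endomorphism `u` vanishing on both ends is homotopic to a map concentrated in a single end degree,
and that map squares to zero; so `u ≫ u` is null-homotopic (`HasNilpotentDefect`). It follows that a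
morphism and a backward morphism that are the identity on the ends already give a homotopy
equivalence (`homotopyEquivalent_of_hasEnds`), with no control over the composites. This makes
`karoubiAssignment` well defined and gives ways to recognise realisations (`mem_of_hasEnds_last`,
`mem_of_hasEnds_first`).

Let `δ` be fixed by idempotents `p` and `q`. Then `1 - p` and `1 - q` annihilate `δ`, so they factor
through the first and last differentials of a realisation. The factorisations give null-homotopic
idempotents, and the product of their complements is an idempotent morphism of complexes with ends
exactly `p` and `q` (`idempotentLift`). Direct summands inherit exactness, so the completion carries
an exact realisation.

For (EA2) and its dual, a good lift in `C` is altered by a null-homotopic map until it commutes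
strictly with such idempotents. Its cone in the completion is then a summand of its cone in `C`, and
goodness does not depend on the representatives.

For (EA1), (EA2) and idempotent completeness show that `f` is an inflation as soon as `f ≫ y` is the
first differential of a realisation for some `y`: the cocone of a good lift along `f` starts with
the column `(f ≫ y, f)`, from which a contractible summand splits off. Composites of inflations have
such factorisations by comparison with a composite in `C`. Deflations are dual.

The Krull-Schmidt property is ring theory: in a semi-perfect ring every idempotent is a finite
orthogonal sum of primitive ones, and the corner ring of a primitive idempotent is local. -/

noncomputable section

namespace NExangulated

variable {D : Type u} [Category.{v} D] [Preadditive D]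

/-! ### Null-homotopic morphisms of cochain complexes -/

section NullMap

variable {K L M : CochainComplex D ℕ}

/-- The null-homotopic morphism `d h + h d` attached to a family `hᵢ : Kᵢ₊₁ ⟶ Lᵢ`. -/
def nullMap (h : ∀ i, K.X (i + 1) ⟶ L.X i) : K ⟶ L :=
  Homotopy.nullHomotopicMap' fun i j (r : (ComplexShape.up ℕ).Rel j i) =>
    eqToHom (by rw [show j + 1 = i from r]) ≫ h j

lemma nullMap_f_zero (h : ∀ i, K.X (i + 1) ⟶ L.X i) : (nullMap h).f 0 = K.d 0 1 ≫ h 0 := by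
  rw [nullMap, Homotopy.nullHomotopicMap'_f_of_not_rel_right (k₁ := 0) (k₀ := 1) rfl (by simp)]
  simp

lemma nullMap_f_succ (h : ∀ i, K.X (i + 1) ⟶ L.X i) (i : ℕ) :
    (nullMap h).f (i + 1) = K.d (i + 1) (i + 1 + 1) ≫ h (i + 1) + h i ≫ L.d i (i + 1) := by
  rw [nullMap, Homotopy.nullHomotopicMap'_f (k₂ := i) (k₁ := i + 1) (k₀ := i + 1 + 1) rfl rfl]
  simp

def homotopyNullMap (h : ∀ i, K.X (i + 1) ⟶ L.X i) : Homotopy (nullMap h) 0 :=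
  Homotopy.nullHomotopy' _

lemma nullMap_comp (h : ∀ i, K.X (i + 1) ⟶ L.X i) (f : L ⟶ M) :
    nullMap h ≫ f = nullMap fun i => h i ≫ f.f i := by
  simp [nullMap, Homotopy.nullHomotopicMap'_comp]

lemma comp_nullMap (f : M ⟶ K) (h : ∀ i, K.X (i + 1) ⟶ L.X i) :
    f ≫ nullMap h = nullMap fun i => f.f (i + 1) ≫ h i := by
  rw [nullMap, Homotopy.comp_nullHomotopicMap', nullMap]
  congr 1
  funext i j r
  obtain rfl : j + 1 = i := r
  simp

lemma Homotopy.f_zero {f g : K ⟶ L} (h : Homotopy f g) :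
    f.f 0 = K.d 0 1 ≫ h.hom 1 0 + g.f 0 := by
  rw [h.comm 0, dNext_eq _ (show (ComplexShape.up ℕ).Rel 0 1 from rfl),
    prevD_eq_zero _ _ (by simp), add_zero]

lemma Homotopy.f_succ {f g : K ⟶ L} (h : Homotopy f g) (i : ℕ) :
    f.f (i + 1) = K.d (i + 1) (i + 1 + 1) ≫ h.hom (i + 1 + 1) (i + 1) +
      h.hom (i + 1) i ≫ L.d i (i + 1) + g.f (i + 1) := by
  rw [h.comm (i + 1), dNext_eq _ (show (ComplexShape.up ℕ).Rel (i + 1) (i + 1 + 1) from rfl),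
    prevD_eq _ (show (ComplexShape.up ℕ).Rel i (i + 1) from rfl)]

variable (K L) in
/-- The morphism `d h + h d` for a single `h : Kⱼ₊₁ ⟶ Lⱼ`. -/
def singleNull (j : ℕ) (h : K.X (j + 1) ⟶ L.X j) : K ⟶ L :=
  nullMap (Function.update (fun _ => 0) j h)

lemma singleNull_f_self (j : ℕ) (h : K.X (j + 1) ⟶ L.X j) :
    (singleNull K L j h).f j = K.d j (j + 1) ≫ h := by
  cases j with
  | zero => simp [singleNull, nullMap_f_zero]
  | succ j => simp [singleNull, nullMap_f_succ]

lemma singleNull_f_succ (j : ℕ) (h : K.X (j + 1) ⟶ L.X j) :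
    (singleNull K L j h).f (j + 1) = h ≫ L.d j (j + 1) := by
  simp [singleNull, nullMap_f_succ]

lemma singleNull_f_of_ne (j : ℕ) (h : K.X (j + 1) ⟶ L.X j) (i : ℕ) (hi : i ≠ j)
    (hi' : i ≠ j + 1) : (singleNull K L j h).f i = 0 := by
  cases i with
  | zero => simp [singleNull, nullMap_f_zero, Function.update_of_ne hi]
  | succ i =>
    simp [singleNull, nullMap_f_succ, Function.update_of_ne hi,
      Function.update_of_ne (show i ≠ j by omega)]

def homotopySingleNull (j : ℕ) (h : K.X (j + 1) ⟶ L.X j) : Homotopy (singleNull K L j h) 0 :=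
  homotopyNullMap _

end NullMap

/-! ### Morphisms with prescribed ends and homotopy equivalence relative to the ends -/

namespace ComplexBetween

variable {n : ℕ} {A B A' B' A'' B'' : D} {X : ComplexBetween n A B} {Y : ComplexBetween n A' B'}
  {Z : ComplexBetween n A'' B''}

/-- The identification of `A` with the term of degree `0`. -/
def isoLeft (X : ComplexBetween n A B) : A ≅ X.K.X 0 := eqToIso X.left.symm

/-- The identification of the term of degree `n + 1` with `B`. -/
def isoRight (X : ComplexBetween n A B) : X.K.X (n + 1) ≅ B := eqToIso X.right

lemma dFirst_eq (X : ComplexBetween n A B) : X.dFirst = X.isoLeft.hom ≫ X.K.d 0 1 := rfl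

lemma dLast_eq (X : ComplexBetween n A B) : X.dLast = X.K.d n (n + 1) ≫ X.isoRight.hom := rfl

lemma hasEnds_iff {f : X.K ⟶ Y.K} {a : A ⟶ A'} {b : B ⟶ B'} :
    HasEnds f a b ↔ X.isoLeft.hom ≫ f.f 0 = a ≫ Y.isoLeft.hom ∧
      f.f (n + 1) ≫ Y.isoRight.hom = X.isoRight.hom ≫ b := by
  rw [HasEnds]
  refine and_congr ?_ Iff.rfl
  change f.f 0 ≫ Y.isoLeft.inv = X.isoLeft.inv ≫ a ↔ _
  rw [Iso.comp_inv_eq, Category.assoc, Iso.eq_inv_comp]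

lemma HasEnds.f_zero {f : X.K ⟶ Y.K} {a : A ⟶ A'} {b : B ⟶ B'} (h : HasEnds f a b) :
    f.f 0 = X.isoLeft.inv ≫ a ≫ Y.isoLeft.hom := by
  rw [Iso.eq_inv_comp]; exact (hasEnds_iff.1 h).1

lemma HasEnds.f_last {f : X.K ⟶ Y.K} {a : A ⟶ A'} {b : B ⟶ B'} (h : HasEnds f a b) :
    f.f (n + 1) = X.isoRight.hom ≫ b ≫ Y.isoRight.inv := by
  rw [← Category.assoc, Iso.eq_comp_inv]; exact (hasEnds_iff.1 h).2

lemma hasEnds_of_eq {f : X.K ⟶ Y.K} {a : A ⟶ A'} {b : B ⟶ B'}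
    (h₀ : f.f 0 = X.isoLeft.inv ≫ a ≫ Y.isoLeft.hom)
    (h₁ : f.f (n + 1) = X.isoRight.hom ≫ b ≫ Y.isoRight.inv) : HasEnds f a b := by
  rw [hasEnds_iff]
  simp [h₀, h₁]

lemma HasEnds.id : HasEnds (X := X) (Y := X) (𝟙 X.K) (𝟙 A) (𝟙 B) := by
  simp [hasEnds_iff]

lemma HasEnds.comp {f : X.K ⟶ Y.K} {g : Y.K ⟶ Z.K} {a : A ⟶ A'} {b : B ⟶ B'} {a' : A' ⟶ A''}
    {b' : B' ⟶ B''} (hf : HasEnds f a b) (hg : HasEnds g a' b') :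
    HasEnds (X := X) (Y := Z) (f ≫ g) (a ≫ a') (b ≫ b') := by
  apply hasEnds_of_eq <;> simp [hf.f_zero, hg.f_zero, hf.f_last, hg.f_last]

lemma HasEnds.comp' {f : X.K ⟶ Y.K} {g : Y.K ⟶ Z.K} {a : A ⟶ A'} {b : B ⟶ B'} {a' : A' ⟶ A''}
    {b' : B' ⟶ B''} {a'' : A ⟶ A''} {b'' : B ⟶ B''} (hf : HasEnds f a b) (hg : HasEnds g a' b')
    (ha : a ≫ a' = a'') (hb : b ≫ b' = b'') : HasEnds (X := X) (Y := Z) (f ≫ g) a'' b'' := by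
  subst ha hb; exact hf.comp hg

lemma HasEnds.congr {f : X.K ⟶ Y.K} {a a' : A ⟶ A'} {b b' : B ⟶ B'} (hf : HasEnds f a b)
    (ha : a = a') (hb : b = b') : HasEnds f a' b' := by
  subst ha hb; exact hf

lemma HasEnds.add {f g : X.K ⟶ Y.K} {a a' : A ⟶ A'} {b b' : B ⟶ B'}
    (hf : HasEnds f a b) (hg : HasEnds g a' b') : HasEnds (f + g) (a + a') (b + b') := by
  apply hasEnds_of_eq <;> simp [hf.f_zero, hg.f_zero, hf.f_last, hg.f_last]

lemma HasEnds.sub {f g : X.K ⟶ Y.K} {a a' : A ⟶ A'} {b b' : B ⟶ B'}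
    (hf : HasEnds f a b) (hg : HasEnds g a' b') : HasEnds (f - g) (a - a') (b - b') := by
  apply hasEnds_of_eq <;> simp [hf.f_zero, hg.f_zero, hf.f_last, hg.f_last]

lemma HasEnds.dFirst {f : X.K ⟶ Y.K} {a : A ⟶ A'} {b : B ⟶ B'} (h : HasEnds f a b) :
    X.dFirst ≫ f.f 1 = a ≫ Y.dFirst := by
  simp [dFirst_eq, ← f.comm, h.f_zero]

lemma HasEnds.dLast {f : X.K ⟶ Y.K} {a : A ⟶ A'} {b : B ⟶ B'} (h : HasEnds f a b) :
    f.f n ≫ Y.dLast = X.dLast ≫ b := by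
  simp [dLast_eq, h.f_last]

lemma hasEnds_singleNull_first [NeZero n] (h : X.K.X 1 ⟶ Y.K.X 0) :
    HasEnds (singleNull X.K Y.K 0 h) (X.dFirst ≫ h ≫ Y.isoLeft.inv) 0 := by
  apply hasEnds_of_eq
  · simp [singleNull_f_self, dFirst_eq]
  · rw [singleNull_f_of_ne _ _ _ (by omega) (by have := NeZero.ne n; omega)]; simp

lemma hasEnds_singleNull_last [NeZero n] (h : X.K.X (n + 1) ⟶ Y.K.X n) :
    HasEnds (singleNull X.K Y.K n h) 0 (X.isoRight.inv ≫ h ≫ Y.dLast) := by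
  apply hasEnds_of_eq
  · rw [singleNull_f_of_ne _ _ _ (NeZero.ne n).symm (by omega)]; simp
  · simp [singleNull_f_succ, dLast_eq]

lemma HomotopyEquivalent.refl (X : ComplexBetween n A B) : HomotopyEquivalent X X :=
  ⟨𝟙 _, 𝟙 _, .id, .id, ⟨.ofEq (by simp)⟩, ⟨.ofEq (by simp)⟩⟩

lemma HomotopyEquivalent.symm {X Y : ComplexBetween n A B} (h : HomotopyEquivalent X Y) :
    HomotopyEquivalent Y X := by
  obtain ⟨f, g, hf, hg, h₁, h₂⟩ := h
  exact ⟨g, f, hg, hf, h₂, h₁⟩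

lemma nonempty_homotopy_iff {K L : CochainComplex D ℕ} {f g : K ⟶ L} :
    Nonempty (Homotopy f g) ↔ (HomotopyCategory.quotient D (.up ℕ)).map f =
      (HomotopyCategory.quotient D (.up ℕ)).map g :=
  ⟨fun ⟨h⟩ => HomotopyCategory.eq_of_homotopy _ _ h, fun h => ⟨HomotopyCategory.homotopyOfEq _ _ h⟩⟩

lemma HomotopyEquivalent.trans {X Y Z : ComplexBetween n A B} (h : HomotopyEquivalent X Y)
    (h' : HomotopyEquivalent Y Z) : HomotopyEquivalent X Z := by
  obtain ⟨f, g, hf, hg, h₁, h₂⟩ := h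
  obtain ⟨f', g', hf', hg', h₁', h₂'⟩ := h'
  refine ⟨f ≫ f', g' ≫ g, hf.comp' hf' (by simp) (by simp), hg'.comp' hg (by simp) (by simp),
    ?_, ?_⟩
  all_goals
    rw [nonempty_homotopy_iff] at *
    simp only [Functor.map_comp, CategoryTheory.Functor.map_id] at *
  · rw [Category.assoc, reassoc_of% h₁', h₁]
  · rw [Category.assoc, reassoc_of% h₂, h₂']

lemma homotopyClass_eq_iff {X Y : ComplexBetween n A B} :
    X.homotopyClass = Y.homotopyClass ↔ HomotopyEquivalent X Y := by
  refine ⟨fun h => ?_, fun h => ?_⟩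
  · have : Y ∈ X.homotopyClass := by rw [h]; exact HomotopyEquivalent.refl Y
    exact this
  · ext Z
    exact ⟨fun hZ => h.symm.trans hZ, fun hZ => h.trans hZ⟩

/-- Every endomorphism of `X` that vanishes on the end terms has a null-homotopic square. -/
def HasNilpotentDefect (X : ComplexBetween n A B) : Prop :=
  ∀ u : X.K ⟶ X.K, HasEnds (X := X) (Y := X) u 0 0 → Nonempty (Homotopy (u ≫ u) 0)

/-- With `u = 1 - f ≫ g` one has `(f ≫ g) ≫ (2 - f ≫ g) = 1 - u ≫ u`, which is homotopic to `1`. So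
`f` has a right inverse up to homotopy and, symmetrically, a left inverse; the two agree in the
homotopy category. The factor `2 - f ≫ g` is the identity on the ends, so the corrected inverse is
too. -/
lemma homotopyEquivalent_of_hasEnds {X Y : ComplexBetween n A B} (hX : HasNilpotentDefect X)
    (hY : HasNilpotentDefect Y) (f : X.K ⟶ Y.K) (hf : HasEnds f (𝟙 A) (𝟙 B)) (g : Y.K ⟶ X.K)
    (hg : HasEnds g (𝟙 A) (𝟙 B)) : HomotopyEquivalent X Y := by
  have hu := hX (𝟙 _ - f ≫ g) (by
    simpa using HasEnds.sub HasEnds.id (hf.comp' hg (Category.comp_id _) (Category.comp_id _)))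
  have hu' := hY (𝟙 _ - g ≫ f) (by
    simpa using HasEnds.sub HasEnds.id (hg.comp' hf (Category.comp_id _) (Category.comp_id _)))
  have e : f ≫ (𝟙 _ + 𝟙 _ - g ≫ f) ≫ g = (f ≫ g) ≫ (𝟙 _ + 𝟙 _ - f ≫ g) := by
    simp [Preadditive.comp_sub, Preadditive.sub_comp, Preadditive.comp_add, Preadditive.add_comp]
  rw [nonempty_homotopy_iff] at hu hu'
  set F := HomotopyCategory.quotient D (.up ℕ)
  have hr : F.map f ≫ F.map (g ≫ (𝟙 _ + 𝟙 _ - f ≫ g)) = 𝟙 _ := by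
    rw [← F.map_comp, ← F.map_id, ← sub_eq_zero, ← F.map_sub, ← neg_eq_zero,
      ← F.map_neg, ← F.map_zero, ← hu]
    congr 1
    simp [Preadditive.comp_sub, Preadditive.sub_comp, Preadditive.comp_add]
    abel
  have hl : F.map ((𝟙 _ + 𝟙 _ - g ≫ f) ≫ g) ≫ F.map f = 𝟙 _ := by
    rw [← F.map_comp, ← F.map_id, ← sub_eq_zero, ← F.map_sub, ← neg_eq_zero,
      ← F.map_neg, ← F.map_zero, ← hu']
    congr 1
    simp [Preadditive.comp_sub, Preadditive.sub_comp, Preadditive.add_comp]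
    abel
  have hlr : F.map ((𝟙 _ + 𝟙 _ - g ≫ f) ≫ g) = F.map (g ≫ (𝟙 _ + 𝟙 _ - f ≫ g)) := by
    rw [← Category.comp_id (F.map ((𝟙 _ + 𝟙 _ - g ≫ f) ≫ g)), ← hr, reassoc_of% hl]
  refine ⟨f, g ≫ (𝟙 _ + 𝟙 _ - f ≫ g), hf, hg.comp' (HasEnds.sub (HasEnds.add .id .id)
    (hf.comp hg)) (by simp) (by simp), ?_, ?_⟩
  · rw [nonempty_homotopy_iff, F.map_comp, hr, F.map_id]
  · rw [nonempty_homotopy_iff, F.map_comp, ← hlr, hl, F.map_id]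

/-- Exactness of `D(W, X₀) ⟶ ⋯ ⟶ D(W, Xₙ₊₁)` at the inner terms. -/
def IsExactMid (X : ComplexBetween n A B) : Prop :=
  ∀ (W : D) (i : ℕ), i < n → ∀ g : W ⟶ X.K.X (i + 1), g ≫ X.K.d (i + 1) (i + 1 + 1) = 0 →
    ∃ g' : W ⟶ X.K.X i, g' ≫ X.K.d i (i + 1) = g

/-- Exactness of `D(Xₙ₊₁, W) ⟶ ⋯ ⟶ D(X₀, W)` at the inner terms. -/
def IsCoexactMid (X : ComplexBetween n A B) : Prop :=
  ∀ (W : D) (i : ℕ), i < n → ∀ g : X.K.X (i + 1) ⟶ W, X.K.d i (i + 1) ≫ g = 0 →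
    ∃ g' : X.K.X (i + 1 + 1) ⟶ W, X.K.d (i + 1) (i + 1 + 1) ≫ g' = g

lemma HasNilpotentDefect.of_homotopy {X : ComplexBetween n A B} {u v : X.K ⟶ X.K}
    (h : Homotopy u v) (hv : v ≫ v = 0) : Nonempty (Homotopy (u ≫ u) 0) :=
  ⟨(h.comp h).trans (.ofEq hv)⟩

/-- The homotopy is built upwards from degree `0`: what remains of `u` in degree `m + 1` is killed
by precomposition with the differential, so it extends along the next one. -/
lemma IsCoexactMid.exists_family {X : ComplexBetween n A B} (hX : X.IsCoexactMid)
    {L : CochainComplex D ℕ} (u : X.K ⟶ L) (hu : u.f 0 = 0) (m : ℕ) (hm : m ≤ n) :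
    ∃ h : ∀ i, X.K.X (i + 1) ⟶ L.X i, h 0 = 0 ∧ ∀ i < m, u.f (i + 1) =
      X.K.d (i + 1) (i + 1 + 1) ≫ h (i + 1) + h i ≫ L.d i (i + 1) := by
  induction m with
  | zero => exact ⟨fun _ => 0, rfl, by simp⟩
  | succ m ih =>
    obtain ⟨h, h₀, hh⟩ := ih (by omega)
    obtain ⟨k, hk⟩ := hX _ m (by omega) (u.f (m + 1) - h m ≫ L.d m (m + 1)) (by
      rw [Preadditive.comp_sub, ← u.comm]
      cases m with
      | zero => simp [hu, h₀]
      | succ m => simp [hh m (by omega), Preadditive.add_comp])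
    refine ⟨Function.update h (m + 1) k, by simp [h₀], fun i hi => ?_⟩
    obtain hi | rfl := Nat.lt_succ_iff_lt_or_eq.1 hi
    · rw [Function.update_of_ne (by omega), Function.update_of_ne (by omega), hh i hi]
    · rw [Function.update_self, Function.update_of_ne (by omega), hk]; abel

/-- Dual construction, downwards from degree `n + 1`; `m` counts the degrees already treated. -/
lemma IsExactMid.exists_family {X : ComplexBetween n A B} (hX : X.IsExactMid)
    {L : CochainComplex D ℕ} (u : L ⟶ X.K) (hu : u.f (n + 1) = 0) (m : ℕ) (hm : m ≤ n) :
    ∃ h : ∀ i, L.X (i + 1) ⟶ X.K.X i, h n = 0 ∧ ∀ i < n, n ≤ i + m → u.f (i + 1) =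
      L.d (i + 1) (i + 1 + 1) ≫ h (i + 1) + h i ≫ X.K.d i (i + 1) := by
  induction m with
  | zero => exact ⟨fun _ => 0, rfl, by omega⟩
  | succ m ih =>
    obtain ⟨h, h₀, hh⟩ := ih (by omega)
    obtain ⟨j, rfl⟩ : ∃ j, n = j + (m + 1) := ⟨n - (m + 1), by omega⟩
    obtain ⟨k, hk⟩ := hX _ j (by omega) (u.f (j + 1) - L.d (j + 1) (j + 1 + 1) ≫ h (j + 1)) (by
      rw [Preadditive.sub_comp, u.comm]
      cases m with
      | zero =>
        have h₀' : h (j + 1) = 0 := h₀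
        have hu' : u.f (j + 1 + 1) = 0 := hu
        simp [hu', h₀']
      | succ m => simp [hh (j + 1) (by omega) (by omega), Preadditive.comp_add])
    refine ⟨Function.update h j k, by rw [Function.update_of_ne (by omega), h₀],
      fun i hi hi' => ?_⟩
    obtain hi'' | rfl := (show j ≤ i by omega).lt_or_eq
    · rw [Function.update_of_ne (by omega), Function.update_of_ne (by omega), hh i hi (by omega)]
    · rw [Function.update_self, Function.update_of_ne (by omega), hk]; abel

/-- Subtracting the homotopy leaves a map `v` that vanishes in degrees `≤ n` and equals `-(h n ≫ d)`
in degree `n + 1`. Since `v` is a morphism of complexes vanishing in degree `n`, `d ≫ h n ≫ d = 0`,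
whence `v ≫ v = 0`. -/
lemma IsCoexactMid.hasNilpotentDefect {X : ComplexBetween n A B} (hX : X.IsCoexactMid) :
    X.HasNilpotentDefect := by
  intro u hu
  have hu₀ : u.f 0 = 0 := by simp [hu.f_zero]
  have hu₁ : u.f (n + 1) = 0 := by simp [hu.f_last]
  obtain ⟨h, h₀, hh⟩ := hX.exists_family u hu₀ n le_rfl
  refine HasNilpotentDefect.of_homotopy (v := u - nullMap h)
    ((Homotopy.equivSubZero (f := u) (g := u - nullMap h)).symm
      ((Homotopy.ofEq (by abel)).trans (homotopyNullMap h))) ?_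
  ext i
  have hv : ∀ i, i ≤ n → (u - nullMap h).f i = 0 := by
    intro i hi
    cases i with
    | zero => simp [nullMap_f_zero, hu₀, h₀]
    | succ i => simp [nullMap_f_succ, hh i (by omega)]
  rcases lt_trichotomy i (n + 1) with hi | rfl | hi
  · simp only [HomologicalComplex.comp_f, hv i (by omega), zero_comp, HomologicalComplex.zero_f]
  · have hz : (u - nullMap h).f (n + 1) = - (h n ≫ X.K.d n (n + 1)) := by
      simp [nullMap_f_succ, hu₁, (X.isZero (n + 2) (by omega)).eq_of_tgt (X.K.d (n + 1) (n + 2)) 0]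
    have h₁ : X.K.d n (n + 1) ≫ h n ≫ X.K.d n (n + 1) = 0 := by
      have := (u - nullMap h).comm n (n + 1)
      rw [hv n le_rfl, hz] at this
      simpa using this.symm
    simp only [HomologicalComplex.comp_f, hz]
    simp [h₁]
  · exact (X.isZero i hi).eq_of_src _ _

/-- Here the remaining map is concentrated in degree `0`, where it equals `-(d ≫ h 0)`, and again it
squares to zero. -/
lemma IsExactMid.hasNilpotentDefect {X : ComplexBetween n A B} (hX : X.IsExactMid) :
    X.HasNilpotentDefect := by
  intro u hu
  have hu₀ : u.f 0 = 0 := by simp [hu.f_zero]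
  have hu₁ : u.f (n + 1) = 0 := by simp [hu.f_last]
  obtain ⟨h, h₀, hh⟩ := hX.exists_family u hu₁ n le_rfl
  refine HasNilpotentDefect.of_homotopy (v := u - nullMap h)
    ((Homotopy.equivSubZero (f := u) (g := u - nullMap h)).symm
      ((Homotopy.ofEq (by abel)).trans (homotopyNullMap h))) ?_
  ext i
  have hv : ∀ i, i ≤ n → (u - nullMap h).f (i + 1) = 0 := by
    intro i hi
    obtain hi | rfl := hi.lt_or_eq
    · simp [nullMap_f_succ, hh i hi (by omega)]
    · simp [nullMap_f_succ, hu₁, h₀,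
        (X.isZero (i + 1 + 1) (by omega)).eq_of_tgt (X.K.d (i + 1) (i + 1 + 1)) 0]
  rcases i with _ | i
  · have hz : (u - nullMap h).f 0 = - (X.K.d 0 1 ≫ h 0) := by
      simp [nullMap_f_zero, hu₀]
    have h₁ : X.K.d 0 1 ≫ h 0 ≫ X.K.d 0 1 = 0 := by
      have := (u - nullMap h).comm 0 1
      rw [hv 0 (by omega), hz] at this
      simpa using this
    simp only [HomologicalComplex.comp_f, hz]
    simp [reassoc_of% h₁]
  · by_cases hi : i ≤ n
    · simp only [HomologicalComplex.comp_f, hv i hi, zero_comp, HomologicalComplex.zero_f]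
    · exact (X.isZero (i + 1) (by omega)).eq_of_src _ _

end ComplexBetween

end NExangulated

/-! ### Exangles, exact realisations and recognition of realisations -/

namespace NExangulated

variable {D : Type u} [Category.{v} D] [Preadditive D] {E : Dᵒᵖ ⥤ D ⥤ AddCommGrpCat.{w}} {n : ℕ}

open ComplexBetween

lemma IsBiadditive.push_add (hE : IsBiadditive E) {A A' B : D} (a b : A ⟶ A') (δ : Ext E B A) :
    push E (a + b) δ = push E a δ + push E b δ := by
  have := hE.additive_right B
  simp [push, Functor.map_add]

lemma IsBiadditive.pull_add (hE : IsBiadditive E) {A B B' : D} (a b : B' ⟶ B) (δ : Ext E B A) :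
    pull E (a + b) δ = pull E a δ + pull E b δ := by
  have := hE.additive_left
  simp [pull, Functor.map_add]

lemma IsBiadditive.push_zero (hE : IsBiadditive E) {A A' B : D} (δ : Ext E B A) :
    push E (0 : A ⟶ A') δ = 0 := by
  have := hE.push_add (0 : A ⟶ A') 0 δ
  simpa using this

lemma IsBiadditive.pull_zero (hE : IsBiadditive E) {A B B' : D} (δ : Ext E B A) :
    pull E (0 : B' ⟶ B) δ = 0 := by
  have := hE.pull_add (0 : B' ⟶ B) 0 δ
  simpa using this

lemma IsBiadditive.push_sub (hE : IsBiadditive E) {A A' B : D} (a b : A ⟶ A') (δ : Ext E B A) :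
    push E (a - b) δ = push E a δ - push E b δ := by
  rw [eq_sub_iff_add_eq, ← hE.push_add, sub_add_cancel]

lemma IsBiadditive.pull_sub (hE : IsBiadditive E) {A B B' : D} (a b : B' ⟶ B) (δ : Ext E B A) :
    pull E (a - b) δ = pull E a δ - pull E b δ := by
  rw [eq_sub_iff_add_eq, ← hE.pull_add, sub_add_cancel]

namespace IsNExangle

variable {A B : D} {X Z : ComplexBetween n A B} {δ : Ext E B A}

lemma isExactMid (h : IsNExangle E X δ) : X.IsExactMid :=
  fun W i hi g hg => (h.exact_mid W i hi g).1 hg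

lemma isCoexactMid (h : IsNExangle E X δ) : X.IsCoexactMid :=
  fun W i hi g hg => (h.coexact_mid W i hi g).1 hg

lemma exists_lift_dLast (h : IsNExangle E X δ) {W : D} (g : W ⟶ B) (hg : pull E g δ = 0) :
    ∃ g' : W ⟶ X.K.X n, g' ≫ X.dLast = g :=
  (h.exact_last W g).1 hg

lemma exists_desc_dFirst (h : IsNExangle E X δ) {W : D} (g : A ⟶ W) (hg : push E g δ = 0) :
    ∃ g' : X.K.X 1 ⟶ W, X.dFirst ≫ g' = g :=
  (h.coexact_first W g).1 hg

lemma of_exists (h₁ : push E X.dFirst δ = 0) (h₂ : pull E X.dLast δ = 0) (h₃ : X.IsExactMid)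
    (h₄ : X.IsCoexactMid)
    (h₅ : ∀ (W : D) (g : W ⟶ B), pull E g δ = 0 → ∃ g' : W ⟶ X.K.X n, g' ≫ X.dLast = g)
    (h₆ : ∀ (W : D) (g : A ⟶ W), push E g δ = 0 → ∃ g' : X.K.X 1 ⟶ W, X.dFirst ≫ g' = g) :
    IsNExangle E X δ where
  push_dFirst := h₁
  pull_dLast := h₂
  exact_mid W i hi g := by
    refine ⟨h₃ W i hi g, ?_⟩
    rintro ⟨g', rfl⟩
    simp
  exact_last W g := by
    refine ⟨h₅ W g, ?_⟩
    rintro ⟨g', rfl⟩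
    change pull E (g' ≫ X.dLast) δ = 0
    rw [pull_comp, h₂, map_zero]
  coexact_mid W i hi g := by
    refine ⟨h₄ W i hi g, ?_⟩
    rintro ⟨g', rfl⟩
    simp
  coexact_first W g := by
    refine ⟨h₆ W g, ?_⟩
    rintro ⟨g', rfl⟩
    change push E (X.dFirst ≫ g') δ = 0
    rw [push_comp, h₁, map_zero]

/-- One homotopy suffices: `Z` is a retract of `X` up to homotopy. Preimages are computed in `X`,
transported back to `Z` and corrected by a component of the homotopy. -/
lemma of_homotopyEquivalent (h : IsNExangle E X δ) (e : HomotopyEquivalent X Z) :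
    IsNExangle E Z δ := by
  obtain ⟨f, g, hf, hg, -, ⟨H⟩⟩ := e
  have hfd := hf.dFirst
  have hfl := hf.dLast
  have hgd := hg.dFirst
  have hgl := hg.dLast
  rw [Category.id_comp] at hfd hgd
  rw [Category.comp_id] at hfl hgl
  refine of_exists ?_ ?_ ?_ ?_ ?_ ?_
  · rw [← hfd, push_comp, h.push_dFirst, map_zero]
  · rw [← hgl, pull_comp, h.pull_dLast, map_zero]
  · intro W i hi k hk
    obtain ⟨k', hk'⟩ := h.isExactMid W i hi (k ≫ g.f (i + 1)) (by
      rw [Category.assoc, g.comm, reassoc_of% hk, zero_comp])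
    have e₁ := Homotopy.f_succ H i
    have e₂ := k ≫= e₁
    simp only [HomologicalComplex.comp_f, HomologicalComplex.id_f, Preadditive.comp_add,
      reassoc_of% hk, zero_comp, zero_add, Category.comp_id] at e₂
    refine ⟨k' ≫ f.f i - k ≫ H.hom (i + 1) i, ?_⟩
    rw [Preadditive.sub_comp, Category.assoc, Category.assoc, f.comm, reassoc_of% hk', e₂]
    abel
  · intro W i hi k hk
    obtain ⟨k', hk'⟩ := h.isCoexactMid W i hi (f.f (i + 1) ≫ k) (by
      rw [← f.comm_assoc, hk, comp_zero])
    have e₁ := Homotopy.f_succ H i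
    have e₂ := e₁ =≫ k
    simp only [HomologicalComplex.comp_f, HomologicalComplex.id_f, Preadditive.add_comp,
      Category.assoc, hk, comp_zero, add_zero, Category.id_comp] at e₂
    refine ⟨g.f (i + 1 + 1) ≫ k' - H.hom (i + 1 + 1) (i + 1) ≫ k, ?_⟩
    rw [Preadditive.comp_sub, ← g.comm_assoc, hk', e₂]
    abel
  · intro W k hk
    obtain ⟨k', hk'⟩ := h.exists_lift_dLast k hk
    exact ⟨k' ≫ f.f n, by rw [Category.assoc, hfl, hk']⟩
  · intro W k hk
    obtain ⟨k', hk'⟩ := h.exists_desc_dFirst k hk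
    exact ⟨g.f 1 ≫ k', by rw [reassoc_of% hgd, hk']⟩

end IsNExangle

section Realisation

variable [NeZero n] {A A' B B' : D}

/-- Correct the last component of a morphism of complexes by a null-homotopic morphism. -/
lemma exists_hasEnds_of_sub_eq_last {U : ComplexBetween n A B} {W : ComplexBetween n A' B'}
    (f : U.K ⟶ W.K)
    {a : A ⟶ A'} {b b' : B ⟶ B'} (hf : HasEnds f a b) (w : B ⟶ W.K.X n)
    (hw : w ≫ W.dLast = b' - b) : ∃ f' : U.K ⟶ W.K, HasEnds f' a b' := by
  exact ⟨_, (hf.add (hasEnds_singleNull_last (X := U) (Y := W) (U.isoRight.hom ≫ w))).congr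
    (by simp) (by simp [hw])⟩

/-- Correct the first component of a morphism of complexes by a null-homotopic morphism. -/
lemma exists_hasEnds_of_sub_eq_first {U : ComplexBetween n A B} {W : ComplexBetween n A' B'}
    (f : U.K ⟶ W.K)
    {a a' : A ⟶ A'} {b : B ⟶ B'} (hf : HasEnds f a b) (w : U.K.X 1 ⟶ A')
    (hw : U.dFirst ≫ w = a' - a) : ∃ f' : U.K ⟶ W.K, HasEnds f' a' b := by
  exact ⟨_, (hf.add (hasEnds_singleNull_first (X := U) (Y := W) (w ≫ W.isoLeft.hom))).congr
    (by simp [hw]) (by simp)⟩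

variable {s : Assignment n E} [HasZeroObject D]

namespace IsExactRealisation

lemma mem_iff (hs : IsExactRealisation s) {δ : Ext E B A} {X Y : ComplexBetween n A B}
    (hX : X ∈ s δ) : Y ∈ s δ ↔ HomotopyEquivalent X Y := by
  obtain ⟨Z, hZ⟩ := hs.exists_eq_homotopyClass δ
  rw [hZ] at hX ⊢
  exact ⟨fun h => hX.symm.trans h, fun h => hX.trans h⟩

lemma eq_homotopyClass (hs : IsExactRealisation s) {δ : Ext E B A} {X : ComplexBetween n A B}
    (hX : X ∈ s δ) : s δ = X.homotopyClass := by
  ext Y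
  exact hs.mem_iff hX

lemma nonempty (hs : IsExactRealisation s) (δ : Ext E B A) : ∃ X, X ∈ s δ := by
  obtain ⟨Z, hZ⟩ := hs.exists_eq_homotopyClass δ
  exact ⟨Z, hZ ▸ HomotopyEquivalent.refl Z⟩

/-- Recognition of a realisation by comparison with another one, with the same first term. -/
lemma mem_of_hasEnds_last (hs : IsExactRealisation s) (hE : IsBiadditive E)
    {ρ : Ext E B A} {ρ' : Ext E B' A} {V : ComplexBetween n A B} {V' : ComplexBetween n A B'}
    (hV : V ∈ s ρ) (hV' : V'.HasNilpotentDefect) {c : B ⟶ B'} {c' : B' ⟶ B}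
    (f : V.K ⟶ V'.K) (hf : HasEnds f (𝟙 A) c) (g : V'.K ⟶ V.K) (hg : HasEnds g (𝟙 A) c')
    (hc : pull E c ρ' = ρ) (hc' : pull E c' ρ = ρ') (w : B' ⟶ V'.K.X n)
    (hw : w ≫ V'.dLast = 𝟙 B' - c' ≫ c) : V' ∈ s ρ' := by
  obtain ⟨W, hW⟩ := hs.nonempty ρ'
  obtain ⟨p, hp⟩ := hs.exists_lift ρ' ρ (𝟙 A) c' (by rw [push_id, hc']) W hW V hV
  obtain ⟨q, hq⟩ := hs.exists_lift ρ ρ' (𝟙 A) c (by rw [push_id, hc]) V hV W hW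
  -- Both round trips through `V` have last end `c' ≫ c` rather than `1`. The difference factors
  -- through the last differential: for `V'` this is the hypothesis on `w`, for `W` it holds because
  -- `1 - c' ≫ c` annihilates `ρ'`.
  obtain ⟨f', hf'⟩ := exists_hasEnds_of_sub_eq_last (p ≫ f) (hp.comp hf) w hw
  obtain ⟨w', hw'⟩ := (hs.isNExangle ρ' W hW).exists_lift_dLast (𝟙 B' - c' ≫ c) (by
    rw [hE.pull_sub, pull_id, pull_comp, hc, hc', sub_self])
  obtain ⟨g', hg'⟩ := exists_hasEnds_of_sub_eq_last (g ≫ q) (hg.comp hq) w' hw'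
  rw [hs.mem_iff hW]
  rw [Category.comp_id] at hf' hg'
  exact homotopyEquivalent_of_hasEnds (hs.isNExangle ρ' W hW).isCoexactMid.hasNilpotentDefect hV'
    f' hf' g' hg'

/-- Recognition of a realisation by comparison with another one, with the same last term. -/
lemma mem_of_hasEnds_first (hs : IsExactRealisation s) (hE : IsBiadditive E)
    {ρ : Ext E B A} {ρ' : Ext E B A'} {V : ComplexBetween n A B} {V' : ComplexBetween n A' B}
    (hV : V ∈ s ρ) (hV' : V'.HasNilpotentDefect) {a : A ⟶ A'} {a' : A' ⟶ A}
    (f : V.K ⟶ V'.K) (hf : HasEnds f a (𝟙 B)) (g : V'.K ⟶ V.K) (hg : HasEnds g a' (𝟙 B))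
    (ha : push E a ρ = ρ') (ha' : push E a' ρ' = ρ) (w : V'.K.X 1 ⟶ A')
    (hw : V'.dFirst ≫ w = 𝟙 A' - a' ≫ a) : V' ∈ s ρ' := by
  obtain ⟨W, hW⟩ := hs.nonempty ρ'
  obtain ⟨p, hp⟩ := hs.exists_lift ρ' ρ a' (𝟙 B) (by rw [pull_id, ha']) W hW V hV
  obtain ⟨q, hq⟩ := hs.exists_lift ρ ρ' a (𝟙 B) (by rw [pull_id, ha]) V hV W hW
  obtain ⟨g', hg'⟩ := exists_hasEnds_of_sub_eq_first (g ≫ q) (hg.comp hq) w hw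
  obtain ⟨w', hw'⟩ := (hs.isNExangle ρ' W hW).exists_desc_dFirst (𝟙 A' - a' ≫ a) (by
    rw [hE.push_sub, push_id, push_comp, ha', ha, sub_self])
  obtain ⟨f', hf'⟩ := exists_hasEnds_of_sub_eq_first (p ≫ f) (hp.comp hf) w' hw'
  rw [hs.mem_iff hW]
  rw [Category.comp_id] at hf' hg'
  exact homotopyEquivalent_of_hasEnds (hs.isNExangle ρ' W hW).isCoexactMid.hasNilpotentDefect hV'
    f' hf' g' hg'

end IsExactRealisation

section Triv

lemma trivFirst_isIso_d (A : D) : IsIso ((trivFirst n A).K.d 0 1) := by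
  change IsIso ((HomologicalComplex.double (𝟙 A)
    (show (ComplexShape.up ℕ).Rel 0 1 from rfl)).d 0 1)
  rw [HomologicalComplex.double_d _ _ (by omega)]
  infer_instance

lemma trivLast_isIso_d (A : D) : IsIso ((trivLast n A).K.d n (n + 1)) := by
  change IsIso ((HomologicalComplex.double (𝟙 A)
    (show (ComplexShape.up ℕ).Rel n (n + 1) from rfl)).d n (n + 1))
  rw [HomologicalComplex.double_d _ _ (by omega)]
  infer_instance

lemma trivFirst_isCoexactMid (A : D) : (trivFirst n A).IsCoexactMid := by
  intro W i hi g hg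
  have := trivFirst_isIso_d (n := n) A
  refine ⟨0, ?_⟩
  rw [comp_zero]
  rcases i with _ | i
  · rw [← cancel_epi ((trivFirst n A).K.d 0 1), hg, comp_zero]
  · exact (HomologicalComplex.isZero_double_X (𝟙 A)
      (show (ComplexShape.up ℕ).Rel 0 1 from rfl) (i + 1 + 1) (by omega) (by omega)).eq_of_src _ _

lemma trivLast_isCoexactMid (A : D) : (trivLast n A).IsCoexactMid := by
  intro W i hi g hg
  have := trivLast_isIso_d (n := n) A
  by_cases h : i + 1 = n
  · subst h
    exact ⟨inv ((trivLast (i + 1) A).K.d (i + 1) (i + 1 + 1)) ≫ g, by simp⟩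
  · refine ⟨0, ?_⟩
    exact (HomologicalComplex.isZero_double_X (𝟙 A)
      (show (ComplexShape.up ℕ).Rel n (n + 1) from rfl) (i + 1) (by omega) (by omega)).eq_of_src _ _

/-- Since the extension is zero, the first differential of `X` has a retraction. It yields
null-homotopic morphisms in both directions with first end `1`; the last end is a map of zero
objects, hence also the identity. -/
lemma homotopyEquivalent_trivFirst {A : D} {X : ComplexBetween n A (0 : D)}
    (hX : IsNExangle E X (0 : Ext E (0 : D) A)) : HomotopyEquivalent X (trivFirst n A) := by
  have := trivFirst_isIso_d (n := n) A
  obtain ⟨r, hr⟩ := hX.exists_desc_dFirst (𝟙 A) (map_zero _)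
  have h₁ := hasEnds_singleNull_first (X := X) (Y := trivFirst n A)
    (r ≫ (trivFirst n A).isoLeft.hom)
  have h₂ := hasEnds_singleNull_first (X := trivFirst n A) (Y := X)
    (inv ((trivFirst n A).K.d 0 1) ≫ (trivFirst n A).isoLeft.inv ≫ X.isoLeft.hom)
  exact homotopyEquivalent_of_hasEnds hX.isCoexactMid.hasNilpotentDefect
    (trivFirst_isCoexactMid A).hasNilpotentDefect
    _ (h₁.congr (by simp [hr]) ((isZero_zero D).eq_of_src _ _))
    _ (h₂.congr (by simp [dFirst_eq]) ((isZero_zero D).eq_of_src _ _))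

lemma homotopyEquivalent_trivLast {A : D} {X : ComplexBetween n (0 : D) A}
    (hX : IsNExangle E X (0 : Ext E A (0 : D))) : HomotopyEquivalent X (trivLast n A) := by
  have := trivLast_isIso_d (n := n) A
  obtain ⟨r, hr⟩ := hX.exists_lift_dLast (𝟙 A) (map_zero _)
  have h₁ := hasEnds_singleNull_last (X := trivLast n A) (Y := X)
    ((trivLast n A).isoRight.hom ≫ r)
  have h₂ := hasEnds_singleNull_last (X := X) (Y := trivLast n A)
    (X.isoRight.hom ≫ (trivLast n A).isoRight.inv ≫ inv ((trivLast n A).K.d n (n + 1)))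
  exact homotopyEquivalent_of_hasEnds hX.isCoexactMid.hasNilpotentDefect
    (trivLast_isCoexactMid A).hasNilpotentDefect
    _ (h₂.congr ((isZero_zero D).eq_of_src _ _) (by simp [dLast_eq]))
    _ (h₁.congr ((isZero_zero D).eq_of_src _ _) (by simp [hr]))

end Triv

end Realisation

end NExangulated

/-! ### Inclusions, projections and morphisms for mapping cocones -/

namespace NExangulated

section ConeCalculus

variable {D : Type u} [Category.{v} D] [Preadditive D] [HasFiniteBiproducts D]

attribute [local instance] hasBinaryBiproducts_of_finite_biproducts

namespace Part

variable {P Q W : D}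

/-- The inclusion of the first summand (zero if it does not occur). -/
def inl (p : Part) (P Q : D) : P ⟶ p.obj P Q := p.lift (𝟙 P) 0

/-- The inclusion of the second summand (zero if it does not occur). -/
def inr (p : Part) (P Q : D) : Q ⟶ p.obj P Q := p.lift 0 (𝟙 Q)

/-- The projection to the first summand (zero if it does not occur). -/
def projL (p : Part) (P Q : D) : p.obj P Q ⟶ P := p.desc (𝟙 P) 0

/-- The projection to the second summand (zero if it does not occur). -/
def projR (p : Part) (P Q : D) : p.obj P Q ⟶ Q := p.desc 0 (𝟙 Q)

lemma lift_eq (p : Part) (a : W ⟶ P) (b : W ⟶ Q) :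
    p.lift a b = a ≫ p.inl P Q + b ≫ p.inr P Q := by
  cases p
  · exact show a = a ≫ 𝟙 P + b ≫ (0 : Q ⟶ P) by simp
  · have h : biprod.lift a b = a ≫ biprod.lift (𝟙 P) 0 + b ≫ biprod.lift 0 (𝟙 Q) := by
      apply biprod.hom_ext <;> simp
    exact h
  · exact show b = a ≫ (0 : P ⟶ Q) + b ≫ 𝟙 Q by simp

lemma desc_eq (p : Part) (a : P ⟶ W) (b : Q ⟶ W) :
    p.desc a b = p.projL P Q ≫ a + p.projR P Q ≫ b := by
  cases p
  · exact show a = 𝟙 P ≫ a + (0 : P ⟶ Q) ≫ b by simp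
  · have h : biprod.desc a b = biprod.desc (𝟙 P) 0 ≫ a + biprod.desc 0 (𝟙 Q) ≫ b := by
      apply biprod.hom_ext' <;> simp
    exact h
  · exact show b = (0 : Q ⟶ P) ≫ a + 𝟙 Q ≫ b by simp

lemma total (p : Part) : p.projL P Q ≫ p.inl P Q + p.projR P Q ≫ p.inr P Q = 𝟙 _ := by
  cases p
  · exact show 𝟙 P ≫ 𝟙 P + (0 : P ⟶ Q) ≫ (0 : Q ⟶ P) = 𝟙 P by simp
  · have h : biprod.desc (𝟙 P) 0 ≫ biprod.lift (𝟙 P) 0 +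
        biprod.desc 0 (𝟙 Q) ≫ biprod.lift 0 (𝟙 Q) = 𝟙 (P ⊞ Q) := by
      apply biprod.hom_ext <;> apply biprod.hom_ext' <;> simp
    exact h
  · exact show (0 : Q ⟶ P) ≫ (0 : P ⟶ Q) + 𝟙 Q ≫ 𝟙 Q = 𝟙 Q by simp

lemma inl_projL (p : Part) (hp : p ≠ .snd) : p.inl P Q ≫ p.projL P Q = 𝟙 P := by
  cases p
  · change 𝟙 P ≫ 𝟙 P = 𝟙 P; simp
  · change biprod.lift (𝟙 P) 0 ≫ biprod.desc (𝟙 P) 0 = 𝟙 P; simp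
  · exact absurd rfl hp

lemma inr_projR (p : Part) (hp : p ≠ .fst) : p.inr P Q ≫ p.projR P Q = 𝟙 Q := by
  cases p
  · exact absurd rfl hp
  · change biprod.lift 0 (𝟙 Q) ≫ biprod.desc 0 (𝟙 Q) = 𝟙 Q; simp
  · change 𝟙 Q ≫ 𝟙 Q = 𝟙 Q; simp

lemma inl_projR (p : Part) : p.inl P Q ≫ p.projR P Q = 0 := by
  cases p
  · exact show 𝟙 P ≫ (0 : P ⟶ Q) = 0 by simp
  · change biprod.lift (𝟙 P) 0 ≫ biprod.desc 0 (𝟙 Q) = 0; simp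
  · exact show (0 : P ⟶ Q) ≫ 𝟙 Q = 0 by simp

lemma inr_projL (p : Part) : p.inr P Q ≫ p.projL P Q = 0 := by
  cases p
  · exact show (0 : Q ⟶ P) ≫ 𝟙 P = 0 by simp
  · change biprod.lift 0 (𝟙 Q) ≫ biprod.desc (𝟙 P) 0 = 0; simp
  · exact show 𝟙 Q ≫ (0 : Q ⟶ P) = 0 by simp

lemma inl_eq_zero (p : Part) (hp : p = .snd) : p.inl P Q = 0 := by subst hp; rfl

lemma inr_eq_zero (p : Part) (hp : p = .fst) : p.inr P Q = 0 := by subst hp; rfl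

lemma projL_eq_zero (p : Part) (hp : p = .snd) : p.projL P Q = 0 := by subst hp; rfl

lemma projR_eq_eqToHom (p : Part) (hp : p = .snd) :
    p.projR P Q = eqToHom (by subst hp; rfl) := by subst hp; rfl

end Part

namespace ComplexBetween

variable {n : ℕ} {A B A' B' : D} {X : ComplexBetween n A B} {Y : ComplexBetween n A' B'}

section Cocone

lemma coconePart_zero : coconePart n 0 = .fst := if_pos (Or.inl rfl)

lemma coconePart_last : coconePart n (n + 1) = .snd := by
  rw [coconePart, if_neg (by omega), if_neg (by omega)]

lemma coconePart_ne_snd {i : ℕ} (hi : i ≠ n + 1) : coconePart n i ≠ .snd := by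
  rw [coconePart]
  split_ifs <;> simp
  omega

lemma coconePart_ne_fst {i : ℕ} (hi : i ≤ n) : coconePart n (i + 1) ≠ .fst := by
  rw [coconePart, if_neg (by omega)]
  split_ifs <;> simp

variable (f : X.K ⟶ Y.K)

def coconeInl (i : ℕ) : X.K.X i ⟶ (cocone f).K.X i := (coconePart n i).inl _ _

def coconeFst (i : ℕ) : (cocone f).K.X i ⟶ X.K.X i := (coconePart n i).projL _ _

def coconeInr (i : ℕ) : Y.K.X i ⟶ (cocone f).K.X (i + 1) :=
  (coconePart n (i + 1)).inr (X.K.X (i + 1)) (Y.K.X i)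

/-- The projection of a term of the cocone to the preceding term of `Y`. -/
def coconePred (i : ℕ) : (cocone f).K.X i ⟶ Y.K.X (i - 1) := (coconePart n i).projR _ _

def coconeSnd (i : ℕ) : (cocone f).K.X (i + 1) ⟶ Y.K.X i :=
  (coconePart n (i + 1)).projR (X.K.X (i + 1)) (Y.K.X i)

lemma cocone_total (i : ℕ) : coconeFst f (i + 1) ≫ coconeInl f (i + 1) +
    coconeSnd f i ≫ coconeInr f i = 𝟙 _ := (coconePart n (i + 1)).total

lemma coconeInl_fst_zero : coconeInl f 0 ≫ coconeFst f 0 = 𝟙 _ :=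
  Part.inl_projL _ (by simp [coconePart_zero])

lemma coconeFst_inl_zero : coconeFst f 0 ≫ coconeInl f 0 = 𝟙 _ := by
  have := (coconePart n 0).total (P := X.K.X 0) (Q := Y.K.X 0)
  rw [Part.inr_eq_zero _ coconePart_zero, comp_zero, add_zero] at this
  exact this

lemma coconeInl_fst {i : ℕ} (hi : i ≠ n + 1) : coconeInl f i ≫ coconeFst f i = 𝟙 _ :=
  Part.inl_projL _ (coconePart_ne_snd hi)

lemma coconeInr_snd {i : ℕ} (hi : i ≤ n) : coconeInr f i ≫ coconeSnd f i = 𝟙 _ :=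
  Part.inr_projR _ (coconePart_ne_fst hi)

lemma coconeInl_pred (i : ℕ) : coconeInl f i ≫ coconePred f i = 0 := Part.inl_projR _

lemma coconeInl_snd (i : ℕ) : coconeInl f (i + 1) ≫ coconeSnd f i = 0 := Part.inl_projR _

lemma coconeInr_fst (i : ℕ) : coconeInr f i ≫ coconeFst f (i + 1) = 0 := Part.inr_projL _

@[simp]
lemma coconeInl_last : coconeInl f (n + 1) = 0 := Part.inl_eq_zero _ coconePart_last

@[simp]
lemma coconeFst_last : coconeFst f (n + 1) = 0 := Part.projL_eq_zero _ coconePart_last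

lemma cocone_d (i : ℕ) : (cocone f).K.d i (i + 1) =
    coconeFst f i ≫ (X.K.d i (i + 1) ≫ coconeInl f (i + 1) + f.f i ≫ coconeInr f i) +
      coconePred f i ≫ (-(Y.K.d (i - 1) i ≫ coconeInr f i)) := by
  have h₁ : (coconePart n (i + 1)).lift (X.K.d i (i + 1)) (f.f i) =
      X.K.d i (i + 1) ≫ coconeInl f (i + 1) + f.f i ≫ coconeInr f i := Part.lift_eq _ _ _
  have h₂ : (coconePart n (i + 1)).lift (0 : Y.K.X (i - 1) ⟶ X.K.X (i + 1)) (-Y.K.d (i - 1) i) =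
      -(Y.K.d (i - 1) i ≫ coconeInr f i) := by
    refine (Part.lift_eq _ _ _).trans ?_
    rw [zero_comp, zero_add, Preadditive.neg_comp]
    rfl
  refine ((CochainComplex.of_d _ _ i).trans (Part.desc_eq _ _ _)).trans ?_
  exact congrArg₂ (fun u v => coconeFst f i ≫ u + coconePred f i ≫ v) h₁ h₂

lemma coconeInl_d (i : ℕ) : coconeInl f i ≫ (cocone f).K.d i (i + 1) =
    X.K.d i (i + 1) ≫ coconeInl f (i + 1) + f.f i ≫ coconeInr f i := by
  by_cases hi : i = n + 1
  · exact ((cocone f).isZero (i + 1) (by omega)).eq_of_tgt _ _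
  · rw [cocone_d, Preadditive.comp_add, reassoc_of% (coconeInl_fst f hi),
      reassoc_of% coconeInl_pred, zero_comp,
      add_zero]

lemma coconeInr_d (i : ℕ) : coconeInr f i ≫ (cocone f).K.d (i + 1) (i + 1 + 1) =
    -(Y.K.d i (i + 1) ≫ coconeInr f (i + 1)) := by
  by_cases hi : n ≤ i
  · exact ((cocone f).isZero (i + 1 + 1) (by omega)).eq_of_tgt _ _
  · rw [cocone_d, Preadditive.comp_add, reassoc_of% coconeInr_fst, zero_comp, zero_add]
    have := coconeInr_snd f (show i ≤ n by omega)
    exact (reassoc_of% this) _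

lemma cocone_isoLeft_hom : (cocone f).isoLeft.hom = X.isoLeft.hom ≫ coconeInl f 0 := by
  change _ = X.isoLeft.hom ≫ 𝟙 (X.K.X 0)
  rw [Category.comp_id]
  rfl

lemma cocone_isoRight_hom : (cocone f).isoRight.hom = coconeSnd f n := by
  rw [coconeSnd, Part.projR_eq_eqToHom _ coconePart_last]
  rfl

lemma cocone_dFirst : (cocone f).dFirst = X.dFirst ≫ coconeInl f 1 +
    X.isoLeft.hom ≫ f.f 0 ≫ coconeInr f 0 := by
  rw [dFirst_eq, cocone_isoLeft_hom, Category.assoc, coconeInl_d, Preadditive.comp_add, dFirst_eq,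
    Category.assoc]

lemma cocone_hom_ext {f : X.K ⟶ Y.K} {W : D} (i : ℕ) {u v : (cocone f).K.X (i + 1) ⟶ W}
    (h₁ : coconeInl f (i + 1) ≫ u = coconeInl f (i + 1) ≫ v)
    (h₂ : coconeInr f i ≫ u = coconeInr f i ≫ v) : u = v := by
  rw [← Category.id_comp u, ← Category.id_comp v, ← cocone_total, Preadditive.add_comp,
    Preadditive.add_comp, Category.assoc, Category.assoc, h₁, h₂, Category.assoc, Category.assoc]

section Map

variable {f} {A₁ B₁ A₁' B₁' : D} {X' : ComplexBetween n A₁ B₁} {Y' : ComplexBetween n A₁' B₁'}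
  (f' : X'.K ⟶ Y'.K)

/-- The components of a morphism between mapping cocones. -/
def coconeMapF (f : X.K ⟶ Y.K) (f' : X'.K ⟶ Y'.K) (α : X.K ⟶ X'.K)
    (b : ∀ i, Y.K.X i ⟶ Y'.K.X i) (H : ∀ i, X.K.X (i + 1) ⟶ Y'.K.X i) :
    ∀ i, (cocone f).K.X i ⟶ (cocone f').K.X i
  | 0 => coconeFst f 0 ≫ α.f 0 ≫ coconeInl f' 0
  | i + 1 => coconeFst f (i + 1) ≫ (α.f (i + 1) ≫ coconeInl f' (i + 1) + H i ≫ coconeInr f' i) +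
      coconeSnd f i ≫ b i ≫ coconeInr f' i

variable {f'} {α : X.K ⟶ X'.K} {b : ∀ i, Y.K.X i ⟶ Y'.K.X i} {H : ∀ i, X.K.X (i + 1) ⟶ Y'.K.X i}

lemma coconeInl_mapF_zero :
    coconeInl f 0 ≫ coconeMapF f f' α b H 0 = α.f 0 ≫ coconeInl f' 0 :=
  (reassoc_of% (coconeInl_fst_zero f)) _

/-- In degree `n + 1` the summand of `X` is absent and the left side vanishes; this forces the
condition `H n = 0`. -/
lemma coconeInl_mapF_succ (hH : H n = 0) (i : ℕ) :
    coconeInl f (i + 1) ≫ coconeMapF f f' α b H (i + 1) =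
      α.f (i + 1) ≫ coconeInl f' (i + 1) + H i ≫ coconeInr f' i := by
  by_cases hi : i = n
  · subst hi; simp [hH]
  · simp [coconeMapF, reassoc_of% (coconeInl_fst f (show i + 1 ≠ n + 1 by omega)),
      reassoc_of% coconeInl_snd]

lemma coconeInr_mapF (i : ℕ) :
    coconeInr f i ≫ coconeMapF f f' α b H (i + 1) = b i ≫ coconeInr f' i := by
  by_cases hi : i ≤ n
  · simp [coconeMapF, reassoc_of% (coconeInr_snd f hi), reassoc_of% coconeInr_fst]
  · exact ((cocone f').isZero (i + 1) (by omega)).eq_of_tgt _ _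

/-- Morphisms of mapping cocones induced by squares that commute up to homotopy. -/
lemma exists_coconeMap [NeZero n] {f : X.K ⟶ Y.K} {f' : X'.K ⟶ Y'.K} (α : X.K ⟶ X'.K)
    (b : ∀ i, Y.K.X i ⟶ Y'.K.X i)
    (H : ∀ i, X.K.X (i + 1) ⟶ Y'.K.X i) (hH : H n = 0)
    (h₀ : α.f 0 ≫ f'.f 0 = f.f 0 ≫ b 0 + X.K.d 0 1 ≫ H 0)
    (h₁ : ∀ i < n, α.f (i + 1) ≫ f'.f (i + 1) = f.f (i + 1) ≫ b (i + 1) +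
      X.K.d (i + 1) (i + 1 + 1) ≫ H (i + 1) + H i ≫ Y'.K.d i (i + 1))
    (h₂ : ∀ i < n, Y.K.d i (i + 1) ≫ b (i + 1) = b i ≫ Y'.K.d i (i + 1))
    {a : A ⟶ A₁} {c : B ⟶ B₁} (hα : HasEnds α a c) :
    ∃ φ : (cocone f).K ⟶ (cocone f').K, (∀ i, φ.f i = coconeMapF f f' α b H i) ∧
      HasEnds φ a (b n) := by
  refine ⟨⟨coconeMapF f f' α b H, ?_⟩, fun _ => rfl, ?_⟩
  · rintro i j rfl
    cases i with
    | zero =>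
      have : IsIso (coconeInl f 0) := ⟨_, coconeInl_fst_zero f, coconeFst_inl_zero f⟩
      rw [← cancel_epi (coconeInl f 0), ← Category.assoc, coconeInl_mapF_zero,
        reassoc_of% coconeInl_d,
        Category.assoc, coconeInl_d, Preadditive.add_comp, Category.assoc, Category.assoc,
        coconeInr_mapF, coconeInl_mapF_succ hH, Preadditive.comp_add, Preadditive.comp_add,
        ← α.comm_assoc, reassoc_of% h₀, Preadditive.add_comp]
      simp only [Category.assoc]; abel
    | succ i =>
      by_cases hi : i < n
      · apply cocone_hom_ext
        · rw [← Category.assoc, coconeInl_mapF_succ hH, Preadditive.add_comp, Category.assoc,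
            coconeInl_d, Category.assoc, coconeInr_d, reassoc_of% coconeInl_d, Preadditive.add_comp,
            Category.assoc, coconeInl_mapF_succ hH, Category.assoc, coconeInr_mapF]
          have := h₁ i hi =≫ coconeInr f' (i + 1)
          simp only [Preadditive.add_comp, Category.assoc, Preadditive.comp_add,
            Preadditive.comp_neg, α.comm_assoc] at this ⊢
          rw [this]; abel
        · have := h₂ i hi =≫ coconeInr f' (i + 1)
          rw [← Category.assoc, coconeInr_mapF, Category.assoc, coconeInr_d,
            reassoc_of% coconeInr_d,
            Preadditive.neg_comp, Category.assoc, coconeInr_mapF, Preadditive.comp_neg]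
          simp only [Category.assoc] at this ⊢
          rw [this]
      · exact ((cocone f').isZero (i + 1 + 1) (by omega)).eq_of_tgt _ _
  · rw [hasEnds_iff, cocone_isoLeft_hom, cocone_isoLeft_hom, cocone_isoRight_hom,
      cocone_isoRight_hom]
    constructor
    · rw [Category.assoc]
      erw [coconeInl_mapF_zero (b := b) (H := H)]
      rw [← Category.assoc, (hasEnds_iff.1 hα).1, Category.assoc]
    · change coconeMapF f f' α b H (n + 1) ≫ _ = _
      simp [coconeMapF, coconeInr_snd f' le_rfl]

end Map

/-- The mapping cocone of a lift of `(a, 1)` is coexact at its inner terms. -/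
lemma cocone_isCoexactMid {E : Dᵒᵖ ⥤ D ⥤ AddCommGrpCat.{w}} {A A' B : D}
    {X : ComplexBetween n A B} {Y : ComplexBetween n A' B} {δ : Ext E B A} {a : A ⟶ A'}
    (hX : IsNExangle E X δ) (hY : IsNExangle E Y (push E a δ)) (f : X.K ⟶ Y.K)
    (hf : HasEnds f a (𝟙 B)) : (cocone f).IsCoexactMid := by
  intro W i hi g hg
  have hx : X.K.d i (i + 1) ≫ coconeInl f (i + 1) ≫ g + f.f i ≫ coconeInr f i ≫ g = 0 := by
    have := coconeInl f i ≫= hg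
    rw [reassoc_of% coconeInl_d, comp_zero] at this
    simpa using this
  -- The `Y`-component of `g` is extended along the differential of `Y`. In degree `0`, composing it
  -- with `a` gives a map that factors through `X.dFirst`, so it annihilates `push E a δ` and
  -- coexactness of `Y` at its first term applies.
  obtain ⟨y, hy⟩ : ∃ y, Y.K.d i (i + 1) ≫ y = -(coconeInr f i ≫ g) := by
    cases i with
    | zero =>
      obtain ⟨y, hy⟩ := hY.exists_desc_dFirst (Y.isoLeft.hom ≫ coconeInr f 0 ≫ g) (by
        rw [← push_comp, ← Category.assoc, ← (hasEnds_iff.1 hf).1, Category.assoc]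
        have := X.isoLeft.hom ≫= hx
        rw [Preadditive.comp_add, comp_zero, ← Category.assoc, ← dFirst_eq] at this
        rw [← neg_eq_iff_add_eq_zero.2 this, ← Preadditive.comp_neg, push_comp, hX.push_dFirst,
          map_zero])
      refine ⟨-y, ?_⟩
      rw [dFirst_eq, Category.assoc, cancel_epi] at hy
      rw [Preadditive.comp_neg, hy]
    | succ i =>
      obtain ⟨y, hy⟩ := hY.isCoexactMid W i (by omega) (coconeInr f (i + 1) ≫ g) (by
        have := coconeInr f i ≫= hg
        rw [reassoc_of% coconeInr_d, comp_zero] at this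
        simpa using this)
      exact ⟨-y, by rw [Preadditive.comp_neg, hy]⟩
  obtain ⟨x, hx'⟩ := hX.isCoexactMid W i hi (coconeInl f (i + 1) ≫ g - f.f (i + 1) ≫ y) (by
    rw [Preadditive.comp_sub, ← f.comm_assoc, hy, Preadditive.comp_neg, sub_neg_eq_add, hx])
  -- In the top degree the cocone has no summand of `X` to carry `x`. As `f` is an isomorphism in
  -- degree `n + 1`, `x` can be moved to `Y` and absorbed into the second component.
  by_cases hi' : i + 1 = n
  · subst hi'
    refine ⟨coconeSnd f _ ≫ (y + Y.K.d (i + 1) (i + 1 + 1) ≫ Y.isoRight.hom ≫ X.isoRight.inv ≫ x),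
      ?_⟩
    have hfl : f.f (i + 1 + 1) ≫ Y.isoRight.hom ≫ X.isoRight.inv = 𝟙 _ := by simp [hf.f_last]
    apply cocone_hom_ext
    · rw [reassoc_of% coconeInl_d, Preadditive.add_comp, Category.assoc, Category.assoc,
        reassoc_of% coconeInl_snd, reassoc_of% (coconeInr_snd f le_rfl), zero_comp, comp_zero,
        zero_add,
        Preadditive.comp_add, f.comm_assoc, reassoc_of% hfl, hx']
      simp
    · rw [reassoc_of% coconeInr_d, Preadditive.neg_comp, Category.assoc,
        reassoc_of% (coconeInr_snd f le_rfl),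
        Preadditive.comp_add, hy]
      simp
  · refine ⟨coconeFst f _ ≫ x + coconeSnd f _ ≫ y, ?_⟩
    apply cocone_hom_ext
    · rw [reassoc_of% coconeInl_d, Preadditive.add_comp, Category.assoc, Category.assoc,
        Preadditive.comp_add, Preadditive.comp_add,
        reassoc_of% coconeInl_snd, Preadditive.comp_add, reassoc_of% (coconeInr_snd f (by omega)),
        reassoc_of% coconeInr_fst, reassoc_of% (coconeInl_fst f (by omega)), hx']
      simp
    · rw [reassoc_of% coconeInr_d, Preadditive.neg_comp, Category.assoc, Preadditive.comp_add,
        reassoc_of% (coconeInr_snd f (by omega)), reassoc_of% coconeInr_fst, zero_comp, zero_add,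
        hy]
      simp

end Cocone

end ComplexBetween

end ConeCalculus

end NExangulated

/-! ### Inclusions, projections and morphisms for mapping cones -/

namespace NExangulated

namespace ComplexBetween

section Cone

variable {D : Type u} [Category.{v} D] [Preadditive D] [HasFiniteBiproducts D]

attribute [local instance] hasBinaryBiproducts_of_finite_biproducts

variable {n : ℕ} {A B A' B' : D} {X : ComplexBetween n A B} {Y : ComplexBetween n A' B'}

lemma conePart_both {i : ℕ} (hi : i < n) : conePart n (i + 1) = .both := if_pos hi

lemma conePart_last {i : ℕ} (hi : n ≤ i) : conePart n (i + 1) = .snd := if_neg (by omega)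

lemma conePart_ne_snd {i : ℕ} (hi : i ≤ n) : conePart n i ≠ .snd := by
  cases i with
  | zero => simp [conePart]
  | succ i => rw [conePart_both (by omega)]; simp

lemma conePart_ne_fst (i : ℕ) : conePart n (i + 1) ≠ .fst := by
  rw [conePart]
  split_ifs <;> simp

variable (f : X.K ⟶ Y.K)

def coneInl (i : ℕ) : X.K.X (i + 1) ⟶ (cone f).K.X i := (conePart n i).inl _ _

def coneFst (i : ℕ) : (cone f).K.X i ⟶ X.K.X (i + 1) := (conePart n i).projL _ _

def coneInr (i : ℕ) : Y.K.X i ⟶ (cone f).K.X i := (conePart n i).inr _ _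

def coneSnd (i : ℕ) : (cone f).K.X i ⟶ Y.K.X i := (conePart n i).projR _ _

lemma cone_total (i : ℕ) :
    coneFst f i ≫ coneInl f i + coneSnd f i ≫ coneInr f i = 𝟙 _ := (conePart n i).total

lemma coneInl_fst {i : ℕ} (hi : i ≤ n) : coneInl f i ≫ coneFst f i = 𝟙 _ :=
  Part.inl_projL _ (conePart_ne_snd hi)

lemma coneInr_snd (i : ℕ) : coneInr f (i + 1) ≫ coneSnd f (i + 1) = 𝟙 _ :=
  Part.inr_projR _ (conePart_ne_fst i)

lemma coneInl_snd (i : ℕ) : coneInl f i ≫ coneSnd f i = 0 := Part.inl_projR _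

lemma coneInr_fst (i : ℕ) : coneInr f i ≫ coneFst f i = 0 := Part.inr_projL _

lemma coneInl_last {i : ℕ} (hi : n ≤ i) : coneInl f (i + 1) = 0 :=
  Part.inl_eq_zero _ (conePart_last hi)

lemma coneFst_last {i : ℕ} (hi : n ≤ i) : coneFst f (i + 1) = 0 :=
  Part.projL_eq_zero _ (conePart_last hi)

lemma coneInr_zero : coneInr f 0 = 0 := rfl

lemma cone_d (i : ℕ) : (cone f).K.d i (i + 1) =
    coneFst f i ≫ (-(X.K.d (i + 1) (i + 1 + 1) ≫ coneInl f (i + 1)) +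
      f.f (i + 1) ≫ coneInr f (i + 1)) + coneSnd f i ≫ Y.K.d i (i + 1) ≫ coneInr f (i + 1) := by
  have h₁ : (conePart n (i + 1)).lift (-X.K.d (i + 1) (i + 1 + 1)) (f.f (i + 1)) =
      -(X.K.d (i + 1) (i + 1 + 1) ≫ coneInl f (i + 1)) + f.f (i + 1) ≫ coneInr f (i + 1) := by
    refine (Part.lift_eq _ _ _).trans ?_
    rw [Preadditive.neg_comp]
    rfl
  have h₂ : (conePart n (i + 1)).lift (0 : Y.K.X i ⟶ X.K.X (i + 1 + 1)) (Y.K.d i (i + 1)) =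
      Y.K.d i (i + 1) ≫ coneInr f (i + 1) := by
    refine (Part.lift_eq _ _ _).trans ?_
    rw [zero_comp, zero_add]
    rfl
  refine ((CochainComplex.of_d _ _ i).trans (Part.desc_eq _ _ _)).trans ?_
  exact congrArg₂ (fun u v => coneFst f i ≫ u + coneSnd f i ≫ v) h₁ h₂

lemma coneInl_d (i : ℕ) : coneInl f i ≫ (cone f).K.d i (i + 1) =
    -(X.K.d (i + 1) (i + 1 + 1) ≫ coneInl f (i + 1)) + f.f (i + 1) ≫ coneInr f (i + 1) := by
  by_cases hi : i ≤ n
  · rw [cone_d, Preadditive.comp_add, reassoc_of% (coneInl_fst f hi), reassoc_of% coneInl_snd,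
      zero_comp, add_zero]
  · exact ((cone f).isZero (i + 1) (by omega)).eq_of_tgt _ _

lemma coneInr_d (i : ℕ) : coneInr f (i + 1) ≫ (cone f).K.d (i + 1) (i + 1 + 1) =
    Y.K.d (i + 1) (i + 1 + 1) ≫ coneInr f (i + 1 + 1) := by
  rw [cone_d, Preadditive.comp_add, reassoc_of% coneInr_fst, zero_comp, zero_add,
    reassoc_of% coneInr_snd]

lemma cone_isoLeft_hom : (cone f).isoLeft.hom = coneInl f 0 := rfl

lemma cone_isoRight_hom : (cone f).isoRight.hom = coneSnd f (n + 1) ≫ Y.isoRight.hom := by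
  rw [coneSnd, Part.projR_eq_eqToHom _ (conePart_last le_rfl)]
  exact (eqToHom_trans _ Y.right).symm

lemma cone_dFirst : (cone f).dFirst =
    -(X.K.d 1 2 ≫ coneInl f 1) + f.f 1 ≫ coneInr f 1 := by
  rw [dFirst_eq, cone_isoLeft_hom, coneInl_d]

lemma coneInl_dLast : coneInl f n ≫ (cone f).dLast = f.f (n + 1) ≫ Y.isoRight.hom := by
  rw [dLast_eq, cone_isoRight_hom, reassoc_of% coneInl_d, coneInl_last f le_rfl, comp_zero,
    neg_zero, zero_add, Category.assoc, reassoc_of% coneInr_snd]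

lemma coneInr_dLast [NeZero n] : coneInr f n ≫ (cone f).dLast = Y.dLast := by
  obtain ⟨m, rfl⟩ := Nat.exists_eq_succ_of_ne_zero (NeZero.ne n)
  rw [dLast_eq, cone_isoRight_hom, reassoc_of% coneInr_d, reassoc_of% coneInr_snd, dLast_eq]

lemma cone_hom_ext {f : X.K ⟶ Y.K} {W : D} (i : ℕ) {u v : (cone f).K.X i ⟶ W}
    (h₁ : coneInl f i ≫ u = coneInl f i ≫ v)
    (h₂ : coneInr f i ≫ u = coneInr f i ≫ v) : u = v := by
  rw [← Category.id_comp u, ← Category.id_comp v, ← cone_total, Preadditive.add_comp,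
    Preadditive.add_comp, Category.assoc, Category.assoc, h₁, h₂, Category.assoc, Category.assoc]

section Map

variable {f} {A₁ B₁ A₁' B₁' : D} {X' : ComplexBetween n A₁ B₁} {Y' : ComplexBetween n A₁' B₁'}

/-- The components of a morphism between mapping cones. -/
def coneMapF (f : X.K ⟶ Y.K) (f' : X'.K ⟶ Y'.K) (a : ∀ i, X.K.X (i + 1) ⟶ X'.K.X (i + 1))
    (β : Y.K ⟶ Y'.K) (H : ∀ i, X.K.X (i + 1) ⟶ Y'.K.X i) (i : ℕ) :
    (cone f).K.X i ⟶ (cone f').K.X i :=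
  coneFst f i ≫ (a i ≫ coneInl f' i + H i ≫ coneInr f' i) + coneSnd f i ≫ β.f i ≫ coneInr f' i

variable {f' : X'.K ⟶ Y'.K} {a : ∀ i, X.K.X (i + 1) ⟶ X'.K.X (i + 1)} {β : Y.K ⟶ Y'.K}
  {H : ∀ i, X.K.X (i + 1) ⟶ Y'.K.X i}

lemma coneInl_mapF {i : ℕ} (hi : i ≤ n) :
    coneInl f i ≫ coneMapF f f' a β H i = a i ≫ coneInl f' i + H i ≫ coneInr f' i := by
  rw [coneMapF, Preadditive.comp_add, reassoc_of% (coneInl_fst f hi), reassoc_of% coneInl_snd,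
    zero_comp, add_zero]

lemma coneInr_mapF (i : ℕ) :
    coneInr f (i + 1) ≫ coneMapF f f' a β H (i + 1) = β.f (i + 1) ≫ coneInr f' (i + 1) := by
  rw [coneMapF, Preadditive.comp_add, reassoc_of% coneInr_fst, zero_comp, zero_add,
    reassoc_of% coneInr_snd]

/-- Morphisms of mapping cones induced by squares that commute up to homotopy. -/
lemma exists_coneMap [NeZero n] {f : X.K ⟶ Y.K} {f' : X'.K ⟶ Y'.K}
    (a : ∀ i, X.K.X (i + 1) ⟶ X'.K.X (i + 1)) (β : Y.K ⟶ Y'.K)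
    (H : ∀ i, X.K.X (i + 1) ⟶ Y'.K.X i) (hH : H 0 = 0)
    (h₀ : ∀ i < n, X.K.d (i + 1) (i + 1 + 1) ≫ a (i + 1) = a i ≫ X'.K.d (i + 1) (i + 1 + 1))
    (h₁ : ∀ i ≤ n, f.f (i + 1) ≫ β.f (i + 1) = a i ≫ f'.f (i + 1) +
      X.K.d (i + 1) (i + 1 + 1) ≫ H (i + 1) + H i ≫ Y'.K.d i (i + 1))
    {a' : A' ⟶ A₁'} {c : B' ⟶ B₁'} (hβ : HasEnds β a' c) :
    ∃ φ : (cone f).K ⟶ (cone f').K, (∀ i, φ.f i = coneMapF f f' a β H i) ∧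
      HasEnds φ (a 0) c := by
  refine ⟨⟨coneMapF f f' a β H, ?_⟩, fun _ => rfl, ?_⟩
  · rintro i j rfl
    by_cases hi : i ≤ n
    swap
    · exact ((cone f').isZero (i + 1) (by omega)).eq_of_tgt _ _
    apply cone_hom_ext
    · have e₁ : coneInl f i ≫ coneMapF f f' a β H i ≫ (cone f').K.d i (i + 1) =
          -(a i ≫ X'.K.d (i + 1) (i + 1 + 1) ≫ coneInl f' (i + 1)) +
            a i ≫ f'.f (i + 1) ≫ coneInr f' (i + 1) +
            H i ≫ Y'.K.d i (i + 1) ≫ coneInr f' (i + 1) := by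
        rw [← Category.assoc, coneInl_mapF hi, Preadditive.add_comp, Category.assoc, coneInl_d,
          Preadditive.comp_add, Preadditive.comp_neg]
        congr 1
        cases i with
        | zero => simp [hH]
        | succ i => rw [Category.assoc, coneInr_d]
      have e₂ : X.K.d (i + 1) (i + 1 + 1) ≫ a (i + 1) ≫ coneInl f' (i + 1) =
          a i ≫ X'.K.d (i + 1) (i + 1 + 1) ≫ coneInl f' (i + 1) := by
        obtain hi | rfl := hi.lt_or_eq
        · have := h₀ i hi =≫ coneInl f' (i + 1)
          simpa using this
        · simp [coneInl_last]
      have e₃ : X.K.d (i + 1) (i + 1 + 1) ≫ coneInl f (i + 1) ≫ coneMapF f f' a β H (i + 1) =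
          X.K.d (i + 1) (i + 1 + 1) ≫ (a (i + 1) ≫ coneInl f' (i + 1) +
            H (i + 1) ≫ coneInr f' (i + 1)) := by
        obtain hi | rfl := hi.lt_or_eq
        · rw [coneInl_mapF hi]
        · rw [(X.isZero (i + 1 + 1) (by omega)).eq_of_tgt (X.K.d (i + 1) (i + 1 + 1)) 0, zero_comp,
            zero_comp]
      have e₄ := h₁ i hi =≫ coneInr f' (i + 1)
      rw [e₁, reassoc_of% coneInl_d, Preadditive.add_comp, Preadditive.neg_comp, Category.assoc,
        Category.assoc, coneInr_mapF, e₃, Preadditive.comp_add, e₂]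
      simp only [Preadditive.add_comp, Category.assoc] at e₄ ⊢
      rw [e₄]; abel
    · cases i with
      | zero => rw [coneInr_zero, zero_comp, zero_comp]
      | succ i =>
        rw [← Category.assoc, coneInr_mapF, Category.assoc, coneInr_d, reassoc_of% coneInr_d,
          coneInr_mapF, ← β.comm_assoc]
  · rw [hasEnds_iff, cone_isoLeft_hom, cone_isoLeft_hom, cone_isoRight_hom, cone_isoRight_hom]
    constructor
    · refine (coneInl_mapF (Nat.zero_le n)).trans ?_
      rw [hH, zero_comp, add_zero]
    · change coneMapF f f' a β H (n + 1) ≫ _ = _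
      rw [Category.assoc, ← (hasEnds_iff.1 hβ).2, coneMapF, coneFst_last f le_rfl, zero_comp,
        zero_add, Category.assoc, Category.assoc, reassoc_of% coneInr_snd]

end Map

/-- The mapping cone of a lift of `(1, c)` is exact at its inner terms. -/
lemma cone_isExactMid {E : Dᵒᵖ ⥤ D ⥤ AddCommGrpCat.{w}} {A B B' : D}
    {X : ComplexBetween n A B'} {Y : ComplexBetween n A B} {δ : Ext E B A} {c : B' ⟶ B}
    (hX : IsNExangle E X (pull E c δ)) (hY : IsNExangle E Y δ) (f : X.K ⟶ Y.K)
    (hf : HasEnds f (𝟙 A) c) : (cone f).IsExactMid := by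
  intro W i hi g hg
  have hx : (g ≫ coneFst f (i + 1)) ≫ f.f (i + 1 + 1) +
      (g ≫ coneSnd f (i + 1)) ≫ Y.K.d (i + 1) (i + 1 + 1) = 0 := by
    have := hg =≫ coneSnd f (i + 1 + 1)
    rw [zero_comp, Category.assoc, cone_d, Preadditive.add_comp] at this
    simp only [Category.assoc, Preadditive.add_comp, Preadditive.neg_comp, coneInl_snd,
      coneInr_snd, comp_zero, neg_zero, zero_add, Category.comp_id, Preadditive.comp_add] at this
    simpa using this
  -- In the top degree the `X`-component of `g` lies in `Xₙ₊₁`. By `hx` its image under `c` factors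
  -- through `Y.dLast`, so it annihilates `pull E c δ` and lifts along `X.dLast`.
  obtain ⟨x, hx'⟩ : ∃ x, x ≫ X.K.d (i + 1) (i + 1 + 1) = g ≫ coneFst f (i + 1) := by
    by_cases hi' : i + 1 = n
    · subst hi'
      obtain ⟨x, hx'⟩ := hX.exists_lift_dLast ((g ≫ coneFst f (i + 1)) ≫ X.isoRight.hom) (by
        rw [← pull_comp, Category.assoc, ← (hasEnds_iff.1 hf).2, ← Category.assoc,
          eq_neg_of_add_eq_zero_left hx, Preadditive.neg_comp, Category.assoc, ← dLast_eq,
          ← Preadditive.neg_comp, pull_comp, hY.pull_dLast, map_zero])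
      refine ⟨x, ?_⟩
      rwa [dLast_eq, ← Category.assoc, cancel_mono] at hx'
    · refine hX.isExactMid W (i + 1) (by omega) _ ?_
      have := hg =≫ coneFst f (i + 1 + 1)
      rw [zero_comp, Category.assoc, cone_d, Preadditive.add_comp] at this
      simp only [Category.assoc, Preadditive.add_comp, Preadditive.neg_comp, coneInr_fst,
        coneInl_fst f (show i + 1 + 1 ≤ n by omega), comp_zero, add_zero,
        Category.comp_id, Preadditive.comp_neg, neg_eq_zero] at this
      simpa using this
  obtain ⟨y, hy⟩ := hY.isExactMid W i hi (g ≫ coneSnd f (i + 1) + x ≫ f.f (i + 1)) (by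
    rw [Preadditive.add_comp, Category.assoc x, f.comm, reassoc_of% hx', ← Category.assoc]
    exact (add_comm _ _).trans hx)
  have hg' : g = (g ≫ coneFst f (i + 1)) ≫ coneInl f (i + 1) +
      (g ≫ coneSnd f (i + 1)) ≫ coneInr f (i + 1) := by
    rw [Category.assoc, Category.assoc, ← Preadditive.comp_add, cone_total, Category.comp_id]
  cases i with
  | zero =>
    -- The cone has no summand `Y₀` in degree `0`; the map `y` is carried to `X₀`, where `f` is an
    -- isomorphism, and then into `X₁` by the differential.
    have hfl : (Y.isoLeft.inv ≫ X.isoLeft.hom) ≫ f.f 0 = 𝟙 _ := by simp [hf.f_zero]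
    refine ⟨-((x - y ≫ (Y.isoLeft.inv ≫ X.isoLeft.hom) ≫ X.K.d 0 1) ≫ coneInl f 0), ?_⟩
    rw [Preadditive.neg_comp, Category.assoc, coneInl_d, hg', ← hx', eq_sub_of_add_eq hy.symm]
    simp only [Preadditive.sub_comp, Preadditive.comp_add, Preadditive.comp_neg, Category.assoc,
      HomologicalComplex.d_comp_d_assoc, zero_comp, comp_zero, sub_zero, ← f.comm_assoc]
    have := y ≫= hfl =≫ (Y.K.d 0 1 ≫ coneInr f 1)
    simp only [Category.assoc, Category.id_comp] at this
    rw [this]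
    abel
  | succ i =>
    refine ⟨-(x ≫ coneInl f (i + 1)) + y ≫ coneInr f (i + 1), ?_⟩
    rw [Preadditive.add_comp, Preadditive.neg_comp, Category.assoc, Category.assoc, coneInl_d,
      coneInr_d, reassoc_of% hy]
    conv_rhs => rw [hg', ← hx']
    simp only [Preadditive.comp_add, Preadditive.comp_neg, Category.assoc, Preadditive.add_comp]
    abel

end Cone

end ComplexBetween

end NExangulated

/-! ### Independence of good lifts from the chosen representatives -/

namespace NExangulated

open ComplexBetween

section GoodLift

variable {D : Type u} [Category.{v} D] [Preadditive D] [HasFiniteBiproducts D] {n : ℕ} [NeZero n]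
  {E : Dᵒᵖ ⥤ D ⥤ AddCommGrpCat.{w}} {s : Assignment n E}

attribute [local instance] hasBinaryBiproducts_of_finite_biproducts

namespace ComplexBetween

lemma coconeInr_dLast {A B A' B' : D} {X : ComplexBetween n A B} {Y : ComplexBetween n A' B'}
    (f : X.K ⟶ Y.K) {W : D} (i : ℕ) (hi : i + 1 = n) (w : W ⟶ Y.K.X i) :
    ∃ w' : W ⟶ (cocone f).K.X n, w' ≫ (cocone f).dLast = w ≫ Y.K.d i n := by
  subst hi
  refine ⟨-(w ≫ coconeInr f i), ?_⟩
  rw [dLast_eq, cocone_isoRight_hom, Preadditive.neg_comp, Category.assoc,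
    reassoc_of% coconeInr_d, Preadditive.neg_comp, Category.assoc, coconeInr_snd f le_rfl]
  simp

/-- A square commuting up to homotopy induces a map of cocones, except that the top homotopy
component has no place there. Since `f` is invertible in degree `n + 1`, that component is absorbed
into the degree `n` part of `β`. The last differential is unaffected because the two composites
agree on the right end. -/
lemma coconeSnd_ends {A A' B : D} {X : ComplexBetween n A B} {Y : ComplexBetween n A' B}
    {A₁ A₁' : D} {X' : ComplexBetween n A₁ B} {Y' : ComplexBetween n A₁' B}
    {f : X.K ⟶ Y.K} {f' : X'.K ⟶ Y'.K} {α : X.K ⟶ X'.K} {β : Y.K ⟶ Y'.K} {a : A ⟶ A₁}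
    {a' : A' ⟶ A₁'} {p : A ⟶ A'} {p' : A₁ ⟶ A₁'}
    (hf : HasEnds f p (𝟙 B)) (hf' : HasEnds f' p' (𝟙 B)) (hα : HasEnds α a (𝟙 B))
    (hβ : HasEnds β a' (𝟙 B)) (h : Homotopy (α ≫ f') (f ≫ β)) :
    ∃ (φ : (cocone f).K ⟶ (cocone f').K) (c : Y.K.X n ⟶ Y'.K.X n),
      HasEnds φ a c ∧ c ≫ Y'.dLast = Y.dLast := by
  -- In degree `n + 1` the composites `α ≫ f'` and `f ≫ β` coincide, and the other homotopy term
  -- vanishes there.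
  have hd : h.hom (n + 1) n ≫ Y'.K.d n (n + 1) = 0 := by
    have e := Homotopy.f_succ h n
    rw [(hα.comp hf').f_last, (hf.comp hβ).f_last,
      (X.isZero (n + 1 + 1) (by omega)).eq_of_tgt (X.K.d (n + 1) (n + 1 + 1)) 0] at e
    simpa using e
  have hκ : f.f (n + 1) ≫ Y.isoRight.hom ≫ X.isoRight.inv = 𝟙 _ := by simp [hf.f_last]
  obtain ⟨m, hm⟩ : ∃ m, n = m + 1 := ⟨n - 1, by have := NeZero.ne n; omega⟩
  let b : ∀ i, Y.K.X i ⟶ Y'.K.X i := Function.update (fun i => β.f i) n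
    (β.f n + Y.K.d n (n + 1) ≫ (Y.isoRight.hom ≫ X.isoRight.inv) ≫ h.hom (n + 1) n)
  have hb : ∀ i, i ≠ n → b i = β.f i := fun i hi => Function.update_of_ne hi _ _
  have hbn : b n = β.f n +
      Y.K.d n (n + 1) ≫ (Y.isoRight.hom ≫ X.isoRight.inv) ≫ h.hom (n + 1) n :=
    Function.update_self _ _ _
  let H : ∀ i, X.K.X (i + 1) ⟶ Y'.K.X i := Function.update (fun i => h.hom (i + 1) i) n 0
  have hH : ∀ i, i ≠ n → H i = h.hom (i + 1) i := fun i hi => Function.update_of_ne hi _ _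
  have hHn : H n = 0 := Function.update_self _ _ _
  obtain ⟨φ, -, hφ⟩ := exists_coconeMap (f := f) (f' := f') α b H hHn (by
    rw [hb 0 (by omega), hH 0 (by omega)]
    have e := Homotopy.f_zero h
    simp only [HomologicalComplex.comp_f] at e
    rw [e, add_comm]) (by
    intro i hi
    have e := Homotopy.f_succ h i
    simp only [HomologicalComplex.comp_f] at e
    rw [e, hH i (by omega)]
    by_cases hi' : i + 1 = n
    · subst hi'
      rw [hbn, hHn, Preadditive.comp_add, f.comm_assoc, Category.assoc, reassoc_of% hκ]
      simp only [comp_zero, add_zero]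
      abel
    · rw [hb _ hi', hH _ hi']
      abel) (by
    intro i hi
    rw [hb i (by omega)]
    by_cases hi' : i + 1 = n
    · subst hi'
      rw [hbn]
      simp
    · rw [hb _ hi', β.comm]) hα
  refine ⟨φ, b n, hφ, ?_⟩
  rw [hbn, Preadditive.add_comp, hβ.dLast, dLast_eq Y', Category.assoc, Category.assoc,
    reassoc_of% hd]
  simp

/-- Dual absorption: the lowest homotopy component, which must be zero in a map of cones, is moved
into the degree `1` part of `α` through the isomorphism `f'` in degree `0`. -/
lemma coneFst_ends {A B B' : D} {X : ComplexBetween n A B} {Y : ComplexBetween n A B'}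
    {B₁ B₁' : D} {X' : ComplexBetween n A B₁} {Y' : ComplexBetween n A B₁'}
    {f : X.K ⟶ Y.K} {f' : X'.K ⟶ Y'.K} {α : X.K ⟶ X'.K} {β : Y.K ⟶ Y'.K} {c : B ⟶ B₁}
    {c' : B' ⟶ B₁'} {p : B ⟶ B'} {p' : B₁ ⟶ B₁'}
    (hf : HasEnds f (𝟙 A) p) (hf' : HasEnds f' (𝟙 A) p') (hα : HasEnds α (𝟙 A) c)
    (hβ : HasEnds β (𝟙 A) c') (h : Homotopy (f ≫ β) (α ≫ f')) :
    ∃ (φ : (cone f).K ⟶ (cone f').K) (a : X.K.X 1 ⟶ X'.K.X 1),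
      HasEnds φ a c' ∧ X.dFirst ≫ a = X'.dFirst := by
  have hd : X.K.d 0 1 ≫ h.hom 1 0 = 0 := by
    have e := Homotopy.f_zero h
    rw [(hα.comp hf').f_zero, (hf.comp hβ).f_zero] at e
    simpa using e
  have hκ : (Y'.isoLeft.inv ≫ X'.isoLeft.hom) ≫ f'.f 0 = 𝟙 _ := by simp [hf'.f_zero]
  let a : ∀ i, X.K.X (i + 1) ⟶ X'.K.X (i + 1) := Function.update (fun i => α.f (i + 1)) 0
    (α.f 1 + h.hom 1 0 ≫ (Y'.isoLeft.inv ≫ X'.isoLeft.hom) ≫ X'.K.d 0 1)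
  have ha : ∀ i, a (i + 1) = α.f (i + 1 + 1) := fun i => Function.update_of_ne (by omega) _ _
  have ha₀ : a 0 = α.f 1 + h.hom 1 0 ≫ (Y'.isoLeft.inv ≫ X'.isoLeft.hom) ≫ X'.K.d 0 1 :=
    Function.update_self _ _ _
  let H : ∀ i, X.K.X (i + 1) ⟶ Y'.K.X i := Function.update (fun i => h.hom (i + 1) i) 0 0
  have hH : ∀ i, H (i + 1) = h.hom (i + 1 + 1) (i + 1) :=
    fun i => Function.update_of_ne (by omega) _ _
  have hH₀ : H 0 = 0 := Function.update_self _ _ _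
  obtain ⟨φ, -, hφ⟩ := exists_coneMap (f := f) (f' := f') a β H hH₀ (by
    intro i hi
    rw [ha i]
    cases i with
    | zero =>
      rw [ha₀]
      simp
    | succ i => rw [ha i, α.comm]) (by
    intro i hi
    have e := Homotopy.f_succ h i
    simp only [HomologicalComplex.comp_f] at e
    rw [e, hH]
    cases i with
    | zero =>
      rw [ha₀, hH₀, Preadditive.add_comp, Category.assoc, Category.assoc, ← f'.comm,
        Category.assoc, reassoc_of% hκ]
      simp only [zero_comp, add_zero]
      abel
    | succ i =>
      rw [ha, hH]
      abel) hβ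
  refine ⟨φ, a 0, hφ, ?_⟩
  rw [ha₀, Preadditive.comp_add, hα.dFirst, dFirst_eq X, Category.assoc, reassoc_of% hd]
  simp

end ComplexBetween

namespace IsExactRealisation

variable {A A' B B' : D}

/-- If a lift of `(a, 1)` is good, then so is every lift of `(a, 1)` homotopy equivalent to it. -/
lemma cocone_mem_of_homotopy (hs : IsExactRealisation s) (hE : IsBiadditive E) {δ : Ext E B A}
    {a : A ⟶ A'} {X X' : ComplexBetween n A B} {Y Y' : ComplexBetween n A' B}
    (hX' : X' ∈ s δ) (hY' : Y' ∈ s (push E a δ)) {f : X.K ⟶ Y.K} (hf : HasEnds f a (𝟙 B))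
    (hg : cocone f ∈ s (pull E Y.dLast δ)) {f' : X'.K ⟶ Y'.K} (hf' : HasEnds f' a (𝟙 B))
    {α : X.K ⟶ X'.K} {α' : X'.K ⟶ X.K} {β : Y.K ⟶ Y'.K} {β' : Y'.K ⟶ Y.K}
    (hα : HasEnds α (𝟙 A) (𝟙 B)) (hα' : HasEnds α' (𝟙 A) (𝟙 B)) (hβ : HasEnds β (𝟙 A') (𝟙 B))
    (hβ' : HasEnds β' (𝟙 A') (𝟙 B)) (h : Homotopy (α ≫ f') (f ≫ β))
    (h' : Homotopy (α' ≫ f) (f' ≫ β')) : cocone f' ∈ s (pull E Y'.dLast δ) := by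
  obtain ⟨φ, c, hφ, hc⟩ := coconeSnd_ends hf hf' hα hβ h
  obtain ⟨φ', c', hφ', hc'⟩ := coconeSnd_ends hf' hf hα' hβ' h'
  have hYe := hs.isNExangle _ Y' hY'
  -- The new end maps `c`, `c'` need not be mutually inverse. Their defect is killed by the last
  -- differential of `Y'`, hence factors through the preceding one, which up to sign is a component
  -- of the last differential of the cocone.
  have hz : (𝟙 _ - c' ≫ c) ≫ Y'.K.d n (n + 1) = 0 := by
    rw [← cancel_mono Y'.isoRight.hom, Category.assoc, ← dLast_eq, zero_comp,
      Preadditive.sub_comp, Category.assoc, hc, hc', Category.id_comp, sub_self]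
  obtain ⟨m, hm⟩ : ∃ m, m + 1 = n := ⟨n - 1, by have := NeZero.ne n; omega⟩
  obtain ⟨w, hw⟩ : ∃ w : Y'.K.X n ⟶ Y'.K.X m, w ≫ Y'.K.d m n = 𝟙 _ - c' ≫ c := by
    subst hm
    exact hYe.isExactMid _ m (by omega) _ hz
  obtain ⟨w', hw'⟩ := coconeInr_dLast f' m hm w
  refine hs.mem_of_hasEnds_last hE hg (cocone_isCoexactMid (hs.isNExangle _ X' hX')
    hYe f' hf').hasNilpotentDefect φ hφ φ' hφ' ?_ ?_ w' (hw'.trans hw)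
  · rw [← pull_comp, hc]
  · rw [← pull_comp, hc']

/-- If a lift of `(1, c)` is good, then so is every lift of `(1, c)` homotopy equivalent to it. -/
lemma cone_mem_of_homotopy (hs : IsExactRealisation s) (hE : IsBiadditive E) {δ : Ext E B A}
    {c : B' ⟶ B} {X X' : ComplexBetween n A B'} {Y Y' : ComplexBetween n A B}
    (hX' : X' ∈ s (pull E c δ)) (hY' : Y' ∈ s δ) {f : X.K ⟶ Y.K} (hf : HasEnds f (𝟙 A) c)
    (hg : cone f ∈ s (push E X.dFirst δ)) {f' : X'.K ⟶ Y'.K} (hf' : HasEnds f' (𝟙 A) c)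
    {α : X.K ⟶ X'.K} {α' : X'.K ⟶ X.K} {β : Y.K ⟶ Y'.K} {β' : Y'.K ⟶ Y.K}
    (hα : HasEnds α (𝟙 A) (𝟙 B')) (hα' : HasEnds α' (𝟙 A) (𝟙 B')) (hβ : HasEnds β (𝟙 A) (𝟙 B))
    (hβ' : HasEnds β' (𝟙 A) (𝟙 B)) (h : Homotopy (f ≫ β) (α ≫ f'))
    (h' : Homotopy (f' ≫ β') (α' ≫ f)) : cone f' ∈ s (push E X'.dFirst δ) := by
  obtain ⟨φ, a, hφ, ha⟩ := coneFst_ends hf hf' hα hβ h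
  obtain ⟨φ', a', hφ', ha'⟩ := coneFst_ends hf' hf hα' hβ' h'
  have hXe := hs.isNExangle _ X' hX'
  have hz : X'.K.d 0 1 ≫ (𝟙 _ - a' ≫ a) = 0 := by
    rw [← cancel_epi X'.isoLeft.hom, ← Category.assoc, ← dFirst_eq, comp_zero,
      Preadditive.comp_sub, reassoc_of% ha', ha, Category.comp_id, sub_self]
  obtain ⟨w, hw⟩ := hXe.isCoexactMid _ 0 (NeZero.pos n) _ hz
  -- The sign in the witness cancels the sign of `-d` in the first differential of the cone.
  refine hs.mem_of_hasEnds_first hE hg (cone_isExactMid hXe (hs.isNExangle _ Y' hY')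
    f' hf').hasNilpotentDefect φ hφ φ' hφ' ?_ ?_ (-(coneFst f' 1 ≫ w)) ?_
  · rw [← push_comp, ha]
  · rw [← push_comp, ha']
  · rw [cone_dFirst, ← hw]
    simp only [Preadditive.add_comp, Preadditive.neg_comp, Preadditive.comp_neg, Category.assoc,
      reassoc_of% coneInr_fst, reassoc_of% (coneInl_fst f' (NeZero.pos n)), zero_comp, comp_zero,
      add_zero, neg_neg]

/-- The existence of a good lift of `(a, 1)` does not depend on the representatives. -/
lemma exists_good_lift_op_of_mem (hs : IsExactRealisation s) (hE : IsBiadditive E) {δ : Ext E B A}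
    {a : A ⟶ A'} {X X' : ComplexBetween n A B} {Y Y' : ComplexBetween n A' B}
    (hX : X ∈ s δ) (hX' : X' ∈ s δ) (hY : Y ∈ s (push E a δ)) (hY' : Y' ∈ s (push E a δ))
    {f : X.K ⟶ Y.K} (hf : HasEnds f a (𝟙 B)) (hg : cocone f ∈ s (pull E Y.dLast δ)) :
    ∃ f' : X'.K ⟶ Y'.K, HasEnds f' a (𝟙 B) ∧
      s (pull E Y'.dLast δ) = (cocone f').homotopyClass := by
  obtain ⟨α, α', hα, hα', ⟨h₁⟩, -⟩ := (hs.mem_iff hX).1 hX'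
  obtain ⟨β, β', hβ, hβ', ⟨h₂⟩, -⟩ := (hs.mem_iff hY).1 hY'
  have hf' : HasEnds (X := X') (Y := Y') (α' ≫ f ≫ β) a (𝟙 B) :=
    hα'.comp' (hf.comp hβ) (by simp) (by simp)
  refine ⟨_, hf', hs.eq_homotopyClass (hs.cocone_mem_of_homotopy hE hX' hY' hf hg hf' hα hα'
    hβ hβ' ?_ ?_)⟩
  · exact (Homotopy.ofEq (by simp)).trans ((h₁.compRight (f ≫ β)).trans (.ofEq (by simp)))
  · exact (Homotopy.ofEq (by simp)).trans
      ((h₂.symm.compLeft (α' ≫ f)).trans (.ofEq (by simp)))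

/-- The existence of a good lift of `(1, c)` does not depend on the representatives. -/
lemma exists_good_lift_of_mem (hs : IsExactRealisation s) (hE : IsBiadditive E) {δ : Ext E B A}
    {c : B' ⟶ B} {X X' : ComplexBetween n A B'} {Y Y' : ComplexBetween n A B}
    (hX : X ∈ s (pull E c δ)) (hX' : X' ∈ s (pull E c δ)) (hY : Y ∈ s δ) (hY' : Y' ∈ s δ)
    {f : X.K ⟶ Y.K} (hf : HasEnds f (𝟙 A) c) (hg : cone f ∈ s (push E X.dFirst δ)) :
    ∃ f' : X'.K ⟶ Y'.K, HasEnds f' (𝟙 A) c ∧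
      s (push E X'.dFirst δ) = (cone f').homotopyClass := by
  obtain ⟨α, α', hα, hα', ⟨h₁⟩, -⟩ := (hs.mem_iff hX).1 hX'
  obtain ⟨β, β', hβ, hβ', ⟨h₂⟩, -⟩ := (hs.mem_iff hY).1 hY'
  have hf' : HasEnds (X := X') (Y := Y') (α' ≫ f ≫ β) (𝟙 A) c :=
    hα'.comp' (hf.comp hβ) (by simp) (by simp)
  refine ⟨_, hf', hs.eq_homotopyClass (hs.cone_mem_of_homotopy hE hX' hY' hf hg hf' hα hα'
    hβ hβ' ?_ ?_)⟩
  · exact (Homotopy.ofEq (by simp)).trans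
      ((h₁.symm.compRight (f ≫ β)).trans (.ofEq (by simp)))
  · exact (Homotopy.ofEq (by simp)).trans
      ((h₂.compLeft (α' ≫ f)).trans (.ofEq (by simp)))

end IsExactRealisation

end GoodLift

end NExangulated

/-! ### Lifting idempotents on the ends to idempotents of complexes -/

namespace NExangulated

open ComplexBetween Idempotents

section SingleNull

variable {D : Type u} [Category.{v} D] [Preadditive D]

lemma comp_singleNull {K L M : CochainComplex D ℕ} (f : M ⟶ K) (j : ℕ)
    (h : K.X (j + 1) ⟶ L.X j) :
    f ≫ singleNull K L j h = singleNull M L j (f.f (j + 1) ≫ h) := by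
  rw [singleNull, comp_nullMap, singleNull]
  congr 1
  funext i
  by_cases hi : i = j
  · subst hi; simp
  · simp [Function.update_of_ne hi]

lemma singleNull_comp {K L M : CochainComplex D ℕ} (j : ℕ) (h : K.X (j + 1) ⟶ L.X j)
    (f : L ⟶ M) : singleNull K L j h ≫ f = singleNull K M j (h ≫ f.f j) := by
  rw [singleNull, nullMap_comp, singleNull]
  congr 1
  funext i
  by_cases hi : i = j
  · subst hi; simp
  · simp [Function.update_of_ne hi]

lemma singleNull_zero {K L : CochainComplex D ℕ} (j : ℕ) : singleNull K L j 0 = 0 := by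
  have := singleNull_comp (K := K) (L := L) j 0 (0 : L ⟶ L)
  rw [comp_zero, zero_comp] at this
  exact this.symm

/-- Only one of the two products of `p` and `q` has to vanish, provided the complements are
multiplied in the opposite order. -/
lemma idempotent_sub_comp_sub {X : D} (p q : X ⟶ X) (hp : p ≫ p = p) (hq : q ≫ q = q)
    (hpq : p ≫ q = 0) :
    ((𝟙 X - q) ≫ (𝟙 X - p)) ≫ (𝟙 X - q) ≫ (𝟙 X - p) = (𝟙 X - q) ≫ (𝟙 X - p) := by
  simp [Preadditive.comp_sub, Preadditive.sub_comp, hp, hq, hpq, reassoc_of% hpq,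
    reassoc_of% hq]

variable {n : ℕ} [NeZero n] {A B A' B' : D}

/-- The idempotent morphism of complexes with ends `1 - p` and `0` attached to a factorisation of
`1 - p` through the first differential. -/
def leftNull (X : ComplexBetween n A B) (p : A ⟶ A) (k : X.K.X 1 ⟶ A) : X.K ⟶ X.K :=
  singleNull X.K X.K 0 (k ≫ (𝟙 A - p) ≫ X.isoLeft.hom)

/-- The idempotent morphism of complexes with ends `0` and `1 - q` attached to a factorisation of
`1 - q` through the last differential. -/
def rightNull (X : ComplexBetween n A B) (q : B ⟶ B) (l : B ⟶ X.K.X n) : X.K ⟶ X.K :=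
  singleNull X.K X.K n (X.isoRight.hom ≫ (𝟙 B - q) ≫ l)

variable {X : ComplexBetween n A B} {p : A ⟶ A} {q : B ⟶ B} {k : X.K.X 1 ⟶ A} {l : B ⟶ X.K.X n}

lemma hasEnds_leftNull (hp : p ≫ p = p) (hk : X.dFirst ≫ k = 𝟙 A - p) :
    HasEnds (leftNull X p k) (𝟙 A - p) 0 := by
  refine (hasEnds_singleNull_first (X := X) (Y := X) _).congr ?_ rfl
  simp [reassoc_of% hk, Preadditive.comp_sub, Preadditive.sub_comp, hp, hk]

lemma hasEnds_rightNull (hq : q ≫ q = q) (hl : l ≫ X.dLast = 𝟙 B - q) :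
    HasEnds (rightNull X q l) 0 (𝟙 B - q) := by
  refine (hasEnds_singleNull_last (X := X) (Y := X) _).congr rfl ?_
  simp [hl, Preadditive.comp_sub, Preadditive.sub_comp, hq]

omit [NeZero n] in
lemma leftNull_comp_self (hp : p ≫ p = p) (hk : X.dFirst ≫ k = 𝟙 A - p) :
    leftNull X p k ≫ leftNull X p k = leftNull X p k := by
  have hk' : X.isoLeft.hom ≫ X.K.d 0 1 ≫ k = 𝟙 A - p := by
    rw [← hk, dFirst_eq, Category.assoc]
  have hp' : (𝟙 A - p) ≫ (𝟙 A - p) = 𝟙 A - p := by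
    simp [Preadditive.comp_sub, Preadditive.sub_comp, hp]
  conv_lhs => rw [leftNull]
  rw [comp_singleNull, singleNull_f_succ]
  simp only [Category.assoc, reassoc_of% hk', reassoc_of% hp']
  rfl

omit [NeZero n] in
lemma rightNull_comp_self (hq : q ≫ q = q) (hl : l ≫ X.dLast = 𝟙 B - q) :
    rightNull X q l ≫ rightNull X q l = rightNull X q l := by
  have hq' : (𝟙 B - q) ≫ (𝟙 B - q) = 𝟙 B - q := by
    simp [Preadditive.comp_sub, Preadditive.sub_comp, hq]
  have hl' : l ≫ X.K.d n (n + 1) ≫ X.isoRight.hom = 𝟙 B - q := by rw [← hl, dLast_eq]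
  conv_lhs => rw [rightNull]
  rw [singleNull_comp, singleNull_f_self]
  simp only [Category.assoc, reassoc_of% hl', reassoc_of% hq']
  rfl

/-- The homotopy of `rightNull` starts in degree `n + 1`, whereas `leftNull` lives in degrees `0`
and `1`. The opposite composite has no such reason to vanish when `n = 1`, where both maps meet in
degree `1`; this dictates the order in `idempotentLift`. -/
lemma leftNull_comp_rightNull : leftNull X p k ≫ rightNull X q l = 0 := by
  rw [rightNull, comp_singleNull, leftNull,
    singleNull_f_of_ne _ _ _ (by omega) (by have := NeZero.ne n; omega), zero_comp,
    singleNull_zero]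

/-- The idempotent morphism of complexes with ends `p` and `q`. -/
def idempotentLift (X : ComplexBetween n A B) (p : A ⟶ A) (q : B ⟶ B) (k : X.K.X 1 ⟶ A)
    (l : B ⟶ X.K.X n) : X.K ⟶ X.K :=
  (𝟙 _ - rightNull X q l) ≫ (𝟙 _ - leftNull X p k)

lemma idempotentLift_comp_self (hp : p ≫ p = p) (hq : q ≫ q = q) (hk : X.dFirst ≫ k = 𝟙 A - p)
    (hl : l ≫ X.dLast = 𝟙 B - q) :
    idempotentLift X p q k l ≫ idempotentLift X p q k l = idempotentLift X p q k l :=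
  idempotent_sub_comp_sub _ _ (leftNull_comp_self hp hk) (rightNull_comp_self hq hl)
    leftNull_comp_rightNull

lemma hasEnds_idempotentLift (hp : p ≫ p = p) (hq : q ≫ q = q) (hk : X.dFirst ≫ k = 𝟙 A - p)
    (hl : l ≫ X.dLast = 𝟙 B - q) : HasEnds (idempotentLift X p q k l) p q :=
  (HasEnds.id.sub (hasEnds_rightNull hq hl)).comp' (HasEnds.id.sub (hasEnds_leftNull hp hk))
    (by simp) (by simp)

end SingleNull

/-! ### Exangles and the exact realisation in the idempotent completion -/

section Karoubi

variable {C : Type u} [Category.{v} C] {E : Cᵒᵖ ⥤ C ⥤ AddCommGrpCat.{w}}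

lemma underlying_push {Q P P' : Karoubi C} (a : P ⟶ P') (δ : Ext (karoubiExt E) Q P) :
    underlying E (push (karoubiExt E) a δ) = push E a.f (underlying E δ) := rfl

lemma underlying_pull {Q Q' P : Karoubi C} (b : Q' ⟶ Q) (δ : Ext (karoubiExt E) Q P) :
    underlying E (pull (karoubiExt E) b δ) = pull E b.f (underlying E δ) := rfl

lemma underlying_injective {Q P : Karoubi C} {δ δ' : Ext (karoubiExt E) Q P}
    (h : underlying E δ = underlying E δ') : δ = δ' := Subtype.ext h

lemma push_p_underlying {Q P : Karoubi C} (δ : Ext (karoubiExt E) Q P) :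
    push E P.p (underlying E δ) = underlying E δ :=
  (show extSubgroup E Q P from δ).2.1

lemma pull_p_underlying {Q P : Karoubi C} (δ : Ext (karoubiExt E) Q P) :
    pull E Q.p (underlying E δ) = underlying E δ :=
  (show extSubgroup E Q P from δ).2.2

/-- An extension in the idempotent completion from an extension fixed by the idempotents. -/
def karoubiExtMk {Q P : Karoubi C} (δ : Ext E Q.X P.X) (h₁ : push E P.p δ = δ)
    (h₂ : pull E Q.p δ = δ) : Ext (karoubiExt E) Q P :=
  show extSubgroup E Q P from ⟨δ, h₁, h₂⟩

variable [Preadditive C]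

lemma IsBiadditive.karoubiExt (hE : IsBiadditive E) : IsBiadditive (karoubiExt E) where
  additive_left :=
    { map_add := by
        intro Q Q' f g
        ext P δ
        refine underlying_injective ?_
        exact hE.pull_add f.unop.f g.unop.f δ.1 }
  additive_right Q :=
    { map_add := by
        intro P P' f g
        ext δ
        refine underlying_injective ?_
        exact hE.push_add f.f g.f δ.1 }

namespace ComplexBetween

variable {n : ℕ} {P Q P' Q' : Karoubi C} {X : ComplexBetween n P.X Q.X} {e : X.K ⟶ X.K}
  {he : e ≫ e = e} {hends : HasEnds e P.p Q.p} {Y : ComplexBetween n P'.X Q'.X} {e' : Y.K ⟶ Y.K}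
  {he' : e' ≫ e' = e'} {hends' : HasEnds e' P'.p Q'.p}

lemma karoubi_isoLeft_hom_f : (X.karoubi e he hends).isoLeft.hom.f = P.p ≫ X.isoLeft.hom :=
  Karoubi.eqToHom_f (X.karoubi e he hends).left.symm

lemma karoubi_isoRight_hom_f :
    (X.karoubi e he hends).isoRight.hom.f = e.f (n + 1) ≫ X.isoRight.hom :=
  Karoubi.eqToHom_f (X.karoubi e he hends).right

lemma idem_f {K : CochainComplex C ℕ} {e : K ⟶ K} (he : e ≫ e = e) (i : ℕ) :
    e.f i ≫ e.f i = e.f i := by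
  rw [← HomologicalComplex.comp_f, he]

lemma karoubi_dFirst_f : (X.karoubi e he hends).dFirst.f = P.p ≫ X.dFirst := by
  have h : (P.p ≫ X.isoLeft.hom) ≫ e.f 0 ≫ X.K.d 0 1 = P.p ≫ X.dFirst := by
    rw [hends.f_zero, dFirst_eq]
    simp
  rw [dFirst_eq, Karoubi.comp_f, karoubi_isoLeft_hom_f]
  exact h

lemma karoubi_dLast_f : (X.karoubi e he hends).dLast.f = e.f n ≫ X.dLast := by
  have h : (e.f n ≫ X.K.d n (n + 1)) ≫ e.f (n + 1) ≫ X.isoRight.hom = e.f n ≫ X.dLast := by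
    rw [Category.assoc, ← e.comm_assoc, reassoc_of% idem_f he, dLast_eq]
  rw [dLast_eq, Karoubi.comp_f, karoubi_isoRight_hom_f]
  exact h

lemma karoubi_dLast_f' : (X.karoubi e he hends).dLast.f = X.dLast ≫ Q.p := by
  rw [karoubi_dLast_f, hends.dLast]

/-- The morphism of complexes in the idempotent completion induced by a morphism of complexes. -/
def karoubiMap (f : X.K ⟶ Y.K) : (X.karoubi e he hends).K ⟶ (Y.karoubi e' he' hends').K where
  f i :=
    { f := e.f i ≫ f.f i ≫ e'.f i
      comm := by
        have h : e.f i ≫ (e.f i ≫ f.f i ≫ e'.f i) ≫ e'.f i = e.f i ≫ f.f i ≫ e'.f i := by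
          simp only [Category.assoc, idem_f he', reassoc_of% idem_f he]
        exact h }
  comm' i j hij := by
    have h : (e.f i ≫ f.f i ≫ e'.f i) ≫ e'.f i ≫ Y.K.d i j =
        (e.f i ≫ X.K.d i j) ≫ e.f j ≫ f.f j ≫ e'.f j := by
      rw [Category.assoc, Category.assoc, Category.assoc, reassoc_of% idem_f he', ← e.comm_assoc,
        reassoc_of% idem_f he, e'.comm, f.comm_assoc]
    ext
    exact h

lemma hasEnds_karoubiMap {f : X.K ⟶ Y.K} {a' : P.X ⟶ P'.X} {b' : Q.X ⟶ Q'.X}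
    (hf : HasEnds f a' b') {a : P ⟶ P'} {b : Q ⟶ Q'} (ha : P.p ≫ a' ≫ P'.p = a.f)
    (hb : Q.p ≫ b' ≫ Q'.p = b.f) :
    HasEnds (X := X.karoubi e he hends) (Y := Y.karoubi e' he' hends')
      (karoubiMap f) a b := by
  have h₁ : (e.f 0 ≫ f.f 0 ≫ e'.f 0) = X.isoLeft.inv ≫ a.f ≫ Y.isoLeft.hom := by
    rw [← ha, hends.f_zero, hf.f_zero, hends'.f_zero]
    simp
  have h₂ : (e.f (n + 1) ≫ f.f (n + 1) ≫ e'.f (n + 1)) =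
      X.isoRight.hom ≫ b.f ≫ Y.isoRight.inv := by
    rw [← hb, hends.f_last, hf.f_last, hends'.f_last]
    simp
  have h₃ : (P.p ≫ X.isoLeft.hom) ≫ e.f 0 ≫ f.f 0 ≫ e'.f 0 = a.f ≫ P'.p ≫ Y.isoLeft.hom := by
    rw [h₁]
    simp
  have h₄ : (e.f (n + 1) ≫ f.f (n + 1) ≫ e'.f (n + 1)) ≫ e'.f (n + 1) ≫ Y.isoRight.hom =
      (e.f (n + 1) ≫ X.isoRight.hom) ≫ b.f := by
    rw [h₂, hends.f_last, hends'.f_last]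
    simp
  rw [hasEnds_iff]
  constructor
  · ext
    rw [Karoubi.comp_f, Karoubi.comp_f, karoubi_isoLeft_hom_f, karoubi_isoLeft_hom_f]
    exact h₃
  · ext
    rw [Karoubi.comp_f, Karoubi.comp_f, karoubi_isoRight_hom_f, karoubi_isoRight_hom_f]
    exact h₄

/-- A direct summand of an exact sequence is exact: each factorisation found in `C` is compressed by
the idempotents of its source and target. -/
lemma isNExangle_karoubi {δ : Ext (karoubiExt E) Q P} (hX : IsNExangle E X (underlying E δ)) :
    IsNExangle (karoubiExt E) (X.karoubi e he hends) δ := by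
  have hd : ∀ i, X.K.d i (i + 1) ≫ e.f (i + 1) = e.f i ≫ X.K.d i (i + 1) := fun i => by simp
  refine IsNExangle.of_exists ?_ ?_ ?_ ?_ ?_ ?_
  · apply underlying_injective
    have h : push E (P.p ≫ X.dFirst) (underlying E δ) = 0 := by
      rw [push_comp, push_p_underlying, hX.push_dFirst]
    rw [underlying_push, karoubi_dFirst_f]
    exact h
  · apply underlying_injective
    have h : pull E (e.f n ≫ X.dLast) (underlying E δ) = 0 := by
      rw [pull_comp, hX.pull_dLast, map_zero]
    rw [underlying_pull, karoubi_dLast_f]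
    exact h
  · rintro W i hi ⟨(g : W.X ⟶ X.K.X (i + 1)), (hg₁ : W.p ≫ g ≫ e.f (i + 1) = g)⟩ hg
    replace hg : g ≫ e.f (i + 1) ≫ X.K.d (i + 1) (i + 1 + 1) = 0 := congrArg Karoubi.Hom.f hg
    obtain ⟨g', hg'⟩ := hX.isExactMid W.X i hi (g ≫ e.f (i + 1)) (by rwa [Category.assoc])
    have h₁ : W.p ≫ (W.p ≫ g' ≫ e.f i) ≫ e.f i = W.p ≫ g' ≫ e.f i := by
      simp [idem_f he]
    have h₂ : (W.p ≫ g' ≫ e.f i) ≫ e.f i ≫ X.K.d i (i + 1) = g := by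
      rw [Category.assoc, Category.assoc, reassoc_of% idem_f he, ← hd, reassoc_of% hg', idem_f he,
        hg₁]
    exact ⟨⟨W.p ≫ g' ≫ e.f i, h₁⟩, Karoubi.Hom.ext h₂⟩
  · rintro W i hi ⟨(g : X.K.X (i + 1) ⟶ W.X), (hg₁ : e.f (i + 1) ≫ g ≫ W.p = g)⟩ hg
    replace hg : (e.f i ≫ X.K.d i (i + 1)) ≫ g = 0 := congrArg Karoubi.Hom.f hg
    obtain ⟨g', hg'⟩ := hX.isCoexactMid W.X i hi (e.f (i + 1) ≫ g) (by
      rw [← hg, reassoc_of% hd, Category.assoc])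
    have h₁ : e.f (i + 1 + 1) ≫ (e.f (i + 1 + 1) ≫ g' ≫ W.p) ≫ W.p =
        e.f (i + 1 + 1) ≫ g' ≫ W.p := by
      simp [reassoc_of% idem_f he]
    have h₂ : (e.f (i + 1) ≫ X.K.d (i + 1) (i + 1 + 1)) ≫ e.f (i + 1 + 1) ≫ g' ≫ W.p = g := by
      rw [Category.assoc, reassoc_of% hd, reassoc_of% idem_f he, reassoc_of% hg',
        reassoc_of% idem_f he, hg₁]
    exact ⟨⟨e.f (i + 1 + 1) ≫ g' ≫ W.p, h₁⟩, Karoubi.Hom.ext h₂⟩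
  · intro W g hg
    obtain ⟨g', hg'⟩ := hX.exists_lift_dLast g.f (congrArg (underlying E) hg)
    have h₁ : W.p ≫ (W.p ≫ g' ≫ e.f n) ≫ e.f n = W.p ≫ g' ≫ e.f n := by
      simp [idem_f he]
    have h₂ : (W.p ≫ g' ≫ e.f n) ≫ e.f n ≫ X.dLast = g.f := by
      rw [Category.assoc, Category.assoc, reassoc_of% idem_f he,
        hends.dLast, reassoc_of% hg', Karoubi.comp_p, Karoubi.p_comp]
    refine ⟨⟨W.p ≫ g' ≫ e.f n, h₁⟩, ?_⟩
    ext
    rw [Karoubi.comp_f, karoubi_dLast_f]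
    exact h₂
  · intro W g hg
    obtain ⟨g', hg'⟩ := hX.exists_desc_dFirst g.f (congrArg (underlying E) hg)
    have h₁ : e.f 1 ≫ (e.f 1 ≫ g' ≫ W.p) ≫ W.p = e.f 1 ≫ g' ≫ W.p := by
      simp [reassoc_of% idem_f he]
    have h₂ : (P.p ≫ X.dFirst) ≫ e.f 1 ≫ g' ≫ W.p = g.f := by
      rw [Category.assoc, reassoc_of% hends.dFirst, reassoc_of% hg', Karoubi.comp_p,
        Karoubi.p_comp, Karoubi.p_comp]
    refine ⟨⟨e.f 1 ≫ g' ≫ W.p, h₁⟩, ?_⟩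
    ext
    rw [Karoubi.comp_f, karoubi_dFirst_f]
    exact h₂

end ComplexBetween

section Realisation

variable [HasFiniteBiproducts C] {n : ℕ} [NeZero n] {s : Assignment n E} {P Q : Karoubi C}

omit [HasFiniteBiproducts C] in
-- As `δ` is fixed by both idempotents, their complements annihilate it and therefore factor through
-- the end differentials, as `idempotentLift` requires.
lemma exists_idempotentLift (hE : IsBiadditive E) (δ : Ext (karoubiExt E) Q P)
    {X : ComplexBetween n P.X Q.X} (hX : IsNExangle E X (underlying E δ)) :
    ∃ e : X.K ⟶ X.K, e ≫ e = e ∧ HasEnds e P.p Q.p := by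
  obtain ⟨k, hk⟩ := hX.exists_desc_dFirst (𝟙 P.X - P.p) (by
    rw [hE.push_sub, push_id, push_p_underlying, sub_self])
  obtain ⟨l, hl⟩ := hX.exists_lift_dLast (𝟙 Q.X - Q.p) (by
    rw [hE.pull_sub, pull_id, pull_p_underlying, sub_self])
  exact ⟨_, idempotentLift_comp_self P.idem Q.idem hk hl,
    hasEnds_idempotentLift P.idem Q.idem hk hl⟩

omit [HasFiniteBiproducts C] [NeZero n] in
lemma karoubi_mem {δ : Ext (karoubiExt E) Q P} {X : ComplexBetween n P.X Q.X}
    (hX : X ∈ s (underlying E δ)) (e : X.K ⟶ X.K) (he : e ≫ e = e) (hends : HasEnds e P.p Q.p) :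
    X.karoubi e he hends ∈ karoubiAssignment s δ :=
  ⟨X, hX, e, he, hends, HomotopyEquivalent.refl _⟩

/-- No compatibility of `f` and `g` with `e` and `e'` is needed: after compression they are still
the identity on the ends, and rigidity of exangles does the rest. -/
lemma homotopyEquivalent_karoubi (hs : IsExactRealisation s) {δ : Ext (karoubiExt E) Q P}
    {X Y : ComplexBetween n P.X Q.X} (hX : X ∈ s (underlying E δ)) (hY : Y ∈ s (underlying E δ))
    (e : X.K ⟶ X.K) (he : e ≫ e = e) (hends : HasEnds e P.p Q.p)
    (e' : Y.K ⟶ Y.K) (he' : e' ≫ e' = e') (hends' : HasEnds e' P.p Q.p) :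
    HomotopyEquivalent (X.karoubi e he hends) (Y.karoubi e' he' hends') := by
  obtain ⟨f, g, hf, hg, -, -⟩ := (hs.mem_iff hX).1 hY
  exact homotopyEquivalent_of_hasEnds
    (isNExangle_karoubi (hs.isNExangle _ X hX)).isCoexactMid.hasNilpotentDefect
    (isNExangle_karoubi (hs.isNExangle _ Y hY)).isCoexactMid.hasNilpotentDefect
    (karoubiMap f) (hasEnds_karoubiMap hf (by simp) (by simp))
    (karoubiMap g) (hasEnds_karoubiMap hg (by simp) (by simp))

lemma IsExactRealisation.karoubi (hs : IsExactRealisation s) (hE : IsBiadditive E) :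
    IsExactRealisation (karoubiAssignment s) := by
  have hne : ∀ {P Q : Karoubi C} (δ : Ext (karoubiExt E) Q P),
      ∃ X : ComplexBetween n P Q, karoubiAssignment s δ = X.homotopyClass := by
    intro P Q δ
    obtain ⟨X, hX⟩ := hs.nonempty (underlying E δ)
    obtain ⟨e, he, hends⟩ := exists_idempotentLift hE δ (hs.isNExangle _ X hX)
    refine ⟨X.karoubi e he hends, Set.ext fun Z => ⟨?_, fun hZ => ⟨X, hX, e, he, hends, hZ⟩⟩⟩
    rintro ⟨Y, hY, e', he', hends', hZ⟩
    exact (homotopyEquivalent_karoubi hs hX hY e he hends e' he' hends').trans hZ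
  have hex : ∀ {P Q : Karoubi C} (δ : Ext (karoubiExt E) Q P), ∀ Z ∈ karoubiAssignment s δ,
      IsNExangle (karoubiExt E) Z δ := by
    rintro P Q δ Z ⟨X, hX, e, he, hends, hZ⟩
    exact (isNExangle_karoubi (hs.isNExangle _ X hX)).of_homotopyEquivalent hZ
  refine ⟨hne, ?_, hex, ?_, ?_⟩
  · rintro P Q P' Q' δ ρ a b h Z ⟨X, hX, e, he, hends, hZ⟩ Z' ⟨X', hX', e', he', hends', hZ'⟩
    obtain ⟨f, hf⟩ := hs.exists_lift (underlying E δ) (underlying E ρ) a.f b.f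
      (congrArg (underlying E) h) X hX X' hX'
    obtain ⟨-, g, -, hg, -, -⟩ := hZ
    obtain ⟨g', -, hg', -, -, -⟩ := hZ'
    have hf' := hasEnds_karoubiMap (he := he) (hends := hends) (he' := he') (hends' := hends')
      hf (a := a) (b := b) (by simp) (by simp)
    exact ⟨_, ((hg.comp hf').comp hg').congr (by simp) (by simp)⟩
  · intro P
    obtain ⟨Z, hZ⟩ := hne (0 : Ext (karoubiExt E) (0 : Karoubi C) P)
    rw [hZ, homotopyClass_eq_iff]
    -- Every exangle over the zero extension with a zero end is equivalent to the trivial complex,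
    -- so (R2) follows from (R1).
    exact homotopyEquivalent_trivFirst (hex _ _ (hZ ▸ HomotopyEquivalent.refl Z))
  · intro P
    obtain ⟨Z, hZ⟩ := hne (0 : Ext (karoubiExt E) P (0 : Karoubi C))
    rw [hZ, homotopyClass_eq_iff]
    exact homotopyEquivalent_trivLast (hex _ _ (hZ ▸ HomotopyEquivalent.refl Z))

end Realisation

end Karoubi

end NExangulated

/-! ### Recognition of mapping cones and cocones from biproduct data -/

namespace NExangulated

open ComplexBetween Idempotents

section Recognition

variable {D : Type u} [Category.{v} D] [Preadditive D] {n : ℕ}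

namespace ComplexBetween

lemma homotopyEquivalent_of_isIso {A B : D} {X Y : ComplexBetween n A B} (φ : X.K ⟶ Y.K)
    (hφ : HasEnds φ (𝟙 A) (𝟙 B)) (h : ∀ i, IsIso (φ.f i)) : HomotopyEquivalent X Y := by
  have := HomologicalComplex.Hom.isIso_of_components φ
  refine ⟨φ, inv φ, hφ, ?_, ⟨.ofEq (by simp)⟩, ⟨.ofEq (by simp)⟩⟩
  have h₁ : ∀ i, φ.f i ≫ (inv φ).f i = 𝟙 _ := fun i => by
    rw [← HomologicalComplex.comp_f, IsIso.hom_inv_id, HomologicalComplex.id_f]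
  apply hasEnds_of_eq
  · rw [← cancel_epi (φ.f 0), h₁, hφ.f_zero]
    simp
  · rw [← cancel_epi (φ.f (n + 1)), h₁, hφ.f_last]
    simp

end ComplexBetween

lemma isIso_of_isZero {P Q : D} (f : P ⟶ Q) (hP : IsZero P) (hQ : IsZero Q) : IsIso f :=
  ⟨0, hP.eq_of_src _ _, hQ.eq_of_src _ _⟩

variable [HasFiniteBiproducts D] {A B A' B' : D} {X : ComplexBetween n A B}
  {Y : ComplexBetween n A' B'}

attribute [local instance] hasBinaryBiproducts_of_finite_biproducts

namespace ComplexBetween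

/-- Recognition of mapping cocones. -/
lemma homotopyEquivalent_cocone (f : X.K ⟶ Y.K) {V : ComplexBetween n A (Y.K.X n)}
    (ι₁ : ∀ i, X.K.X i ⟶ V.K.X i) (ι₂ : ∀ i, Y.K.X i ⟶ V.K.X (i + 1))
    (π₁ : ∀ i, V.K.X i ⟶ X.K.X i) (π₂ : ∀ i, V.K.X (i + 1) ⟶ Y.K.X i)
    (h₁₁ : ∀ i ≤ n, ι₁ i ≫ π₁ i = 𝟙 _) (h₂₂ : ∀ i ≤ n, ι₂ i ≫ π₂ i = 𝟙 _)
    (h₁₂ : ∀ i, ι₁ (i + 1) ≫ π₂ i = 0) (h₂₁ : ∀ i, ι₂ i ≫ π₁ (i + 1) = 0)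
    (ht₀ : π₁ 0 ≫ ι₁ 0 = 𝟙 _)
    (ht : ∀ i, π₁ (i + 1) ≫ ι₁ (i + 1) + π₂ i ≫ ι₂ i = 𝟙 _)
    (h₀ : ι₁ (n + 1) = 0)
    (hd₁ : ∀ i, ι₁ i ≫ V.K.d i (i + 1) = X.K.d i (i + 1) ≫ ι₁ (i + 1) + f.f i ≫ ι₂ i)
    (hd₂ : ∀ i, ι₂ i ≫ V.K.d (i + 1) (i + 1 + 1) = -(Y.K.d i (i + 1) ≫ ι₂ (i + 1)))
    (hl : V.isoLeft.hom = X.isoLeft.hom ≫ ι₁ 0) (hr : V.isoRight.hom = π₂ n) :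
    HomotopyEquivalent (cocone f) V := by
  -- The biproduct data give an isomorphism of complexes. This is needed because the chosen
  -- biproducts of the idempotent completion are only isomorphic to biproducts of `C` equipped with
  -- an idempotent.
  let φ : ∀ i, (cocone f).K.X i ⟶ V.K.X i
    | 0 => coconeFst f 0 ≫ ι₁ 0
    | i + 1 => coconeFst f (i + 1) ≫ ι₁ (i + 1) + coconeSnd f i ≫ ι₂ i
  have hφ₀ : φ 0 = coconeFst f 0 ≫ ι₁ 0 := rfl
  have hφ : ∀ i, φ (i + 1) = coconeFst f (i + 1) ≫ ι₁ (i + 1) + coconeSnd f i ≫ ι₂ i :=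
    fun i => rfl
  have hi₀ : IsIso (coconeInl f 0) := ⟨_, coconeInl_fst_zero f, coconeFst_inl_zero f⟩
  have hi₀' : IsIso (ι₁ 0) := ⟨_, h₁₁ 0 (Nat.zero_le n), ht₀⟩
  have hi₀'' : IsIso (coconeFst f 0) := ⟨_, coconeFst_inl_zero f, coconeInl_fst_zero f⟩
  have e₀ : coconeInl f 0 ≫ φ 0 = ι₁ 0 := by
    rw [hφ₀, reassoc_of% (coconeInl_fst_zero f)]
  have e₁ : ∀ i, coconeInl f (i + 1) ≫ φ (i + 1) = ι₁ (i + 1) := by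
    intro i
    by_cases hi : i = n
    · subst hi
      rw [coconeInl_last, zero_comp, h₀]
    · rw [hφ, Preadditive.comp_add, reassoc_of% (coconeInl_fst f (show i + 1 ≠ n + 1 by omega)),
        reassoc_of% coconeInl_snd, zero_comp, add_zero]
  have e₂ : ∀ i, coconeInr f i ≫ φ (i + 1) = ι₂ i := by
    intro i
    by_cases hi : i ≤ n
    · rw [hφ, Preadditive.comp_add, reassoc_of% (coconeInr_snd f hi), reassoc_of% coconeInr_fst,
        zero_comp, zero_add]
    · exact (V.isZero (i + 1) (by omega)).eq_of_tgt _ _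
  refine homotopyEquivalent_of_isIso ⟨φ, ?_⟩ ?_ ?_
  · rintro i j rfl
    cases i with
    | zero =>
      rw [← cancel_epi (coconeInl f 0), reassoc_of% e₀, hd₁, reassoc_of% coconeInl_d,
        Preadditive.add_comp, Category.assoc, Category.assoc, e₁, e₂]
    | succ i =>
      apply cocone_hom_ext
      · rw [reassoc_of% e₁, hd₁, reassoc_of% coconeInl_d, Preadditive.add_comp, Category.assoc,
          Category.assoc, e₁, e₂]
      · rw [reassoc_of% e₂, hd₂, reassoc_of% coconeInr_d, Preadditive.neg_comp, Category.assoc, e₂]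
  · rw [hasEnds_iff]
    constructor
    · rw [cocone_isoLeft_hom, Category.assoc, Category.id_comp, hl]
      exact congrArg (X.isoLeft.hom ≫ ·) e₀
    · rw [cocone_isoRight_hom, hr, Category.comp_id]
      refine (congrArg (· ≫ π₂ n) (hφ n)).trans ?_
      rw [coconeFst_last, zero_comp, zero_add, Category.assoc, h₂₂ n le_rfl, Category.comp_id]
  · intro i
    cases i with
    | zero => exact inferInstanceAs (IsIso (coconeFst f 0 ≫ ι₁ 0))
    | succ i =>
      by_cases hi : i ≤ n
      · refine ⟨π₁ (i + 1) ≫ coconeInl f (i + 1) + π₂ i ≫ coconeInr f i, ?_, ?_⟩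
        · apply cocone_hom_ext
          · refine (reassoc_of% (e₁ i)) _ |>.trans ?_
            rw [Preadditive.comp_add, reassoc_of% h₁₂, zero_comp, add_zero, Category.comp_id]
            by_cases hi' : i = n
            · subst hi'
              rw [coconeInl_last, comp_zero, comp_zero]
            · rw [reassoc_of% (h₁₁ (i + 1) (by omega))]
          · refine (reassoc_of% (e₂ i)) _ |>.trans ?_
            rw [Preadditive.comp_add, reassoc_of% h₂₁, zero_comp, zero_add, Category.comp_id,
              reassoc_of% (h₂₂ i hi)]
        · change _ ≫ φ (i + 1) = _
          rw [Preadditive.add_comp, Category.assoc, Category.assoc, e₁, e₂, ht]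
      · exact isIso_of_isZero _ ((cocone f).isZero _ (by omega)) (V.isZero _ (by omega))

/-- Recognition of mapping cones. -/
lemma homotopyEquivalent_cone (f : X.K ⟶ Y.K) {V : ComplexBetween n (X.K.X 1) B'}
    (ι₁ : ∀ i, X.K.X (i + 1) ⟶ V.K.X i) (ι₂ : ∀ i, Y.K.X i ⟶ V.K.X i)
    (π₁ : ∀ i, V.K.X i ⟶ X.K.X (i + 1)) (π₂ : ∀ i, V.K.X i ⟶ Y.K.X i)
    (h₁₁ : ∀ i ≤ n, ι₁ i ≫ π₁ i = 𝟙 _) (h₂₂ : ∀ i, ι₂ (i + 1) ≫ π₂ (i + 1) = 𝟙 _)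
    (h₁₂ : ∀ i, ι₁ i ≫ π₂ i = 0) (h₂₁ : ∀ i, ι₂ i ≫ π₁ i = 0)
    (ht : ∀ i, π₁ i ≫ ι₁ i + π₂ i ≫ ι₂ i = 𝟙 _) (h₀ : ι₂ 0 = 0)
    (hn : ∀ i, n ≤ i → ι₁ (i + 1) = 0)
    (hd₁ : ∀ i, ι₁ i ≫ V.K.d i (i + 1) =
      -(X.K.d (i + 1) (i + 1 + 1) ≫ ι₁ (i + 1)) + f.f (i + 1) ≫ ι₂ (i + 1))
    (hd₂ : ∀ i, ι₂ (i + 1) ≫ V.K.d (i + 1) (i + 1 + 1) =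
      Y.K.d (i + 1) (i + 1 + 1) ≫ ι₂ (i + 1 + 1))
    (hl : V.isoLeft.hom = ι₁ 0) (hr : V.isoRight.hom = π₂ (n + 1) ≫ Y.isoRight.hom) :
    HomotopyEquivalent (cone f) V := by
  let φ : ∀ i, (cone f).K.X i ⟶ V.K.X i := fun i => coneFst f i ≫ ι₁ i + coneSnd f i ≫ ι₂ i
  have hφ : ∀ i, φ i = coneFst f i ≫ ι₁ i + coneSnd f i ≫ ι₂ i := fun i => rfl
  have e₁ : ∀ i, coneInl f i ≫ φ i = ι₁ i := by
    intro i
    by_cases hi : i ≤ n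
    · rw [hφ, Preadditive.comp_add, reassoc_of% (coneInl_fst f hi),
        reassoc_of% coneInl_snd, zero_comp, add_zero]
    · obtain ⟨i, rfl⟩ : ∃ j, i = j + 1 := ⟨i - 1, by omega⟩
      rw [coneInl_last f (by omega), hn i (by omega), zero_comp]
  have e₂ : ∀ i, coneInr f i ≫ φ i = ι₂ i := by
    intro i
    cases i with
    | zero => rw [coneInr_zero, h₀, zero_comp]
    | succ i =>
      rw [hφ, Preadditive.comp_add, reassoc_of% (coneInr_snd f i), reassoc_of% coneInr_fst,
        zero_comp, zero_add]
  refine homotopyEquivalent_of_isIso ⟨φ, ?_⟩ ?_ ?_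
  · rintro i j rfl
    apply cone_hom_ext
    · rw [reassoc_of% e₁, hd₁, reassoc_of% coneInl_d, Preadditive.add_comp, Preadditive.neg_comp,
        Category.assoc, Category.assoc, e₁, e₂]
    · cases i with
      | zero => rw [coneInr_zero, zero_comp, zero_comp]
      | succ i => rw [reassoc_of% e₂, hd₂, reassoc_of% coneInr_d, e₂]
  · rw [hasEnds_iff]
    constructor
    · rw [cone_isoLeft_hom, Category.id_comp, hl]
      exact e₁ 0
    · rw [cone_isoRight_hom, hr, Category.comp_id]
      refine (congrArg (· ≫ π₂ (n + 1) ≫ Y.isoRight.hom) (hφ (n + 1))).trans ?_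
      rw [coneFst_last f le_rfl, zero_comp, zero_add, Category.assoc, reassoc_of% h₂₂]
  · intro i
    by_cases hi : i ≤ n + 1
    · refine ⟨π₁ i ≫ coneInl f i + π₂ i ≫ coneInr f i, ?_, ?_⟩
      · apply cone_hom_ext
        · refine (reassoc_of% (e₁ i)) _ |>.trans ?_
          rw [Preadditive.comp_add, reassoc_of% h₁₂, zero_comp, add_zero, Category.comp_id]
          by_cases hi' : i = n + 1
          · subst hi'
            rw [coneInl_last f le_rfl, comp_zero, comp_zero]
          · rw [reassoc_of% (h₁₁ i (by omega))]
        · refine (reassoc_of% (e₂ i)) _ |>.trans ?_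
          rw [Preadditive.comp_add, reassoc_of% h₂₁, zero_comp, zero_add, Category.comp_id]
          cases i with
          | zero => rw [coneInr_zero, comp_zero, comp_zero]
          | succ i => rw [reassoc_of% h₂₂]
      · change _ ≫ φ i = _
        rw [Preadditive.add_comp, Category.assoc, Category.assoc, e₁, e₂, ht]
    · exact isIso_of_isZero _ ((cone f).isZero _ (by omega)) (V.isZero _ (by omega))

end ComplexBetween

end Recognition

end NExangulated

/-! ### Mapping cones in the idempotent completion as summands of mapping cones -/

namespace NExangulated

open ComplexBetween Idempotents

section DirectSum

variable {C : Type u} [Category.{v} C] [Preadditive C] [HasFiniteBiproducts C] {n : ℕ} [NeZero n]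

attribute [local instance] hasBinaryBiproducts_of_finite_biproducts

namespace ComplexBetween

variable {A B A' B' : C} {X : ComplexBetween n A B} {Y : ComplexBetween n A' B'}

/-- Compatible endomorphisms of `X` and `Y` induce an endomorphism of the mapping cocone. -/
lemma exists_cocone_directSum {f : X.K ⟶ Y.K} {e : X.K ⟶ X.K} {e' : Y.K ⟶ Y.K}
    (h : e ≫ f = f ≫ e') {p : A ⟶ A} {q : B ⟶ B} (he : HasEnds e p q) :
    ∃ ε : (cocone f).K ⟶ (cocone f).K, (∀ i, coconeInl f i ≫ ε.f i = e.f i ≫ coconeInl f i) ∧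
      (∀ i, coconeInr f i ≫ ε.f (i + 1) = e'.f i ≫ coconeInr f i) ∧
      (∀ i, ε.f i ≫ coconeFst f i = coconeFst f i ≫ e.f i) ∧
      (∀ i, ε.f (i + 1) ≫ coconeSnd f i = coconeSnd f i ≫ e'.f i) ∧
      HasEnds ε p (e'.f n) := by
  have h' : ∀ i, e.f i ≫ f.f i = f.f i ≫ e'.f i := fun i => by
    rw [← HomologicalComplex.comp_f, h, HomologicalComplex.comp_f]
  obtain ⟨ε, hε, hends⟩ := exists_coconeMap (f := f) (f' := f) e (fun i => e'.f i) (fun _ => 0) rfl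
    (by simp [h']) (by simp [h']) (by simp) he
  have hε₀ : ε.f 0 = coconeFst f 0 ≫ e.f 0 ≫ coconeInl f 0 := hε 0
  have hε₁ : ∀ i, ε.f (i + 1) = coconeFst f (i + 1) ≫ e.f (i + 1) ≫ coconeInl f (i + 1) +
      coconeSnd f i ≫ e'.f i ≫ coconeInr f i := fun i => by
    rw [hε, coconeMapF, zero_comp, add_zero]
  refine ⟨ε, ?_, ?_, ?_, ?_, hends⟩
  · intro i
    cases i with
    | zero => rw [hε₀, reassoc_of% (coconeInl_fst_zero f)]
    | succ i =>
      by_cases hi : i = n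
      · subst hi
        rw [coconeInl_last, zero_comp, comp_zero]
      · rw [hε₁, Preadditive.comp_add, reassoc_of% (coconeInl_fst f (show i + 1 ≠ n + 1 by omega)),
          reassoc_of% coconeInl_snd, zero_comp, add_zero]
  · intro i
    by_cases hi : i ≤ n
    · rw [hε₁, Preadditive.comp_add, reassoc_of% (coconeInr_snd f hi), reassoc_of% coconeInr_fst,
        zero_comp, zero_add]
    · exact ((cocone f).isZero (i + 1) (by omega)).eq_of_tgt _ _
  · intro i
    cases i with
    | zero => rw [hε₀, Category.assoc, Category.assoc, coconeInl_fst_zero, Category.comp_id]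
    | succ i =>
      by_cases hi : i = n
      · subst hi
        rw [coconeFst_last, zero_comp, comp_zero]
      · rw [hε₁, Preadditive.add_comp, Category.assoc, Category.assoc, Category.assoc,
          Category.assoc, coconeInl_fst f (show i + 1 ≠ n + 1 by omega), coconeInr_fst]
        simp
  · intro i
    by_cases hi : i ≤ n
    · rw [hε₁, Preadditive.add_comp, Category.assoc, Category.assoc, Category.assoc,
        Category.assoc, coconeInl_snd, coconeInr_snd f hi]
      simp
    · exact ((cocone f).isZero (i + 1) (by omega)).eq_of_src _ _

/-- Compatible endomorphisms of `X` and `Y` induce an endomorphism of the mapping cone. -/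
lemma exists_cone_directSum {f : X.K ⟶ Y.K} {e : X.K ⟶ X.K} {e' : Y.K ⟶ Y.K}
    (h : e ≫ f = f ≫ e') {p : A' ⟶ A'} {q : B' ⟶ B'} (he' : HasEnds e' p q) :
    ∃ ε : (cone f).K ⟶ (cone f).K,
      (∀ i, coneInl f i ≫ ε.f i = e.f (i + 1) ≫ coneInl f i) ∧
      (∀ i, coneInr f i ≫ ε.f i = e'.f i ≫ coneInr f i) ∧
      (∀ i, ε.f i ≫ coneFst f i = coneFst f i ≫ e.f (i + 1)) ∧
      (∀ i, ε.f i ≫ coneSnd f i = coneSnd f i ≫ e'.f i) ∧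
      HasEnds ε (e.f 1) q := by
  have h' : ∀ i, e.f i ≫ f.f i = f.f i ≫ e'.f i := fun i => by
    rw [← HomologicalComplex.comp_f, h, HomologicalComplex.comp_f]
  obtain ⟨ε, hε, hends⟩ := exists_coneMap (f := f) (f' := f) (fun i => e.f (i + 1)) e'
    (fun _ => 0) rfl (by simp) (by simp [h']) he'
  have hε₁ : ∀ i, ε.f i = coneFst f i ≫ e.f (i + 1) ≫ coneInl f i +
      coneSnd f i ≫ e'.f i ≫ coneInr f i := fun i => by
    rw [hε, coneMapF, zero_comp, add_zero]
  refine ⟨ε, ?_, ?_, ?_, ?_, hends⟩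
  · intro i
    by_cases hi : i ≤ n
    · rw [hε₁, Preadditive.comp_add, reassoc_of% (coneInl_fst f hi),
        reassoc_of% coneInl_snd, zero_comp, add_zero]
    · obtain ⟨i, rfl⟩ : ∃ j, i = j + 1 := ⟨i - 1, by omega⟩
      rw [coneInl_last f (by omega), zero_comp, comp_zero]
  · intro i
    cases i with
    | zero => rw [coneInr_zero, zero_comp, comp_zero]
    | succ i =>
      rw [hε₁, Preadditive.comp_add, reassoc_of% (coneInr_snd f i), reassoc_of% coneInr_fst,
        zero_comp, zero_add]
  · intro i
    by_cases hi : i ≤ n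
    · rw [hε₁, Preadditive.add_comp, Category.assoc, Category.assoc, Category.assoc,
        Category.assoc, coneInl_fst f hi, coneInr_fst]
      simp
    · obtain ⟨i, rfl⟩ : ∃ j, i = j + 1 := ⟨i - 1, by omega⟩
      rw [coneFst_last f (by omega), zero_comp, comp_zero]
  · intro i
    cases i with
    | zero =>
      have hz : coneSnd f 0 = 0 := rfl
      rw [hz, zero_comp, comp_zero]
    | succ i =>
      rw [hε₁, Preadditive.add_comp, Category.assoc, Category.assoc, Category.assoc,
        Category.assoc, coneInl_snd, coneInr_snd]
      simp

end ComplexBetween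

end DirectSum

section KaroubiCone

variable {C : Type u} [Category.{v} C] [Preadditive C] [HasFiniteBiproducts C] {n : ℕ} [NeZero n]
  {P Q P' Q' : Karoubi C} {X : ComplexBetween n P.X Q.X} {e : X.K ⟶ X.K}
  {he : e ≫ e = e} {hends : HasEnds e P.p Q.p} {Y : ComplexBetween n P'.X Q'.X} {e' : Y.K ⟶ Y.K}
  {he' : e' ≫ e' = e'} {hends' : HasEnds e' P'.p Q'.p} {f : X.K ⟶ Y.K}

attribute [local instance] hasBinaryBiproducts_of_finite_biproducts

namespace ComplexBetween

/-- The mapping cocone in the idempotent completion is a direct summand of the mapping cocone. -/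
lemma exists_karoubi_cocone (h : e ≫ f = f ≫ e') :
    ∃ (ε : (cocone f).K ⟶ (cocone f).K) (hε : ε ≫ ε = ε) (hεe : HasEnds ε P.p (e'.f n)),
      HomotopyEquivalent (cocone (karoubiMap f : (X.karoubi e he hends).K ⟶
        (Y.karoubi e' he' hends').K))
        (ComplexBetween.karoubi (Q := (Y.karoubi e' he' hends').K.X n) (cocone f) ε hε hεe) := by
  obtain ⟨ε, hl, hr, hp₁, hp₂, hεe⟩ := exists_cocone_directSum h hends
  have hε₀ : ε.f 0 = coconeFst f 0 ≫ e.f 0 ≫ coconeInl f 0 := by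
    rw [← hl, reassoc_of% (coconeFst_inl_zero f)]
  have hε : ε ≫ ε = ε := by
    ext i
    rw [HomologicalComplex.comp_f]
    cases i with
    | zero =>
      have : IsIso (coconeInl f 0) := ⟨_, coconeInl_fst_zero f, coconeFst_inl_zero f⟩
      rw [← cancel_epi (coconeInl f 0), reassoc_of% hl, hl, reassoc_of% idem_f he]
    | succ i =>
      apply cocone_hom_ext
      · rw [reassoc_of% hl, hl, reassoc_of% idem_f he]
      · rw [reassoc_of% hr, hr, reassoc_of% idem_f he']
  have hf : ∀ i, e.f i ≫ f.f i = f.f i ≫ e'.f i := fun i => by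
    rw [← HomologicalComplex.comp_f, h, HomologicalComplex.comp_f]
  refine ⟨ε, hε, hεe, ?_⟩
  have a₁ : ∀ i, e.f i ≫ (e.f i ≫ coconeInl f i) ≫ ε.f i = e.f i ≫ coconeInl f i := fun i => by
    rw [Category.assoc, hl, reassoc_of% idem_f he, reassoc_of% idem_f he]
  have a₂ : ∀ i, e'.f i ≫ (e'.f i ≫ coconeInr f i) ≫ ε.f (i + 1) = e'.f i ≫ coconeInr f i :=
    fun i => by rw [Category.assoc, hr, reassoc_of% idem_f he', reassoc_of% idem_f he']
  have a₃ : ∀ i, ε.f i ≫ (coconeFst f i ≫ e.f i) ≫ e.f i = coconeFst f i ≫ e.f i := fun i => by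
    rw [Category.assoc, reassoc_of% hp₁, idem_f he, idem_f he]
  have a₄ : ∀ i, ε.f (i + 1) ≫ (coconeSnd f i ≫ e'.f i) ≫ e'.f i = coconeSnd f i ≫ e'.f i :=
    fun i => by rw [Category.assoc, reassoc_of% hp₂, idem_f he', idem_f he']
  have b₁ : ∀ i ≤ n, (e.f i ≫ coconeInl f i) ≫ coconeFst f i ≫ e.f i = e.f i := fun i hi => by
    rw [Category.assoc, reassoc_of% (coconeInl_fst f (show i ≠ n + 1 by omega)), idem_f he]
  have b₂ : ∀ i ≤ n, (e'.f i ≫ coconeInr f i) ≫ coconeSnd f i ≫ e'.f i = e'.f i := fun i hi => by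
    rw [Category.assoc, reassoc_of% (coconeInr_snd f hi), idem_f he']
  have b₃ : ∀ i, (e.f (i + 1) ≫ coconeInl f (i + 1)) ≫ coconeSnd f i ≫ e'.f i = 0 := fun i => by
    rw [Category.assoc, reassoc_of% coconeInl_snd, zero_comp, comp_zero]
  have b₄ : ∀ i, (e'.f i ≫ coconeInr f i) ≫ coconeFst f (i + 1) ≫ e.f (i + 1) = 0 := fun i => by
    rw [Category.assoc, reassoc_of% coconeInr_fst, zero_comp, comp_zero]
  have b₅ : (coconeFst f 0 ≫ e.f 0) ≫ e.f 0 ≫ coconeInl f 0 = ε.f 0 := by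
    rw [Category.assoc, reassoc_of% idem_f he, hε₀]
  have b₆ : ∀ i, (coconeFst f (i + 1) ≫ e.f (i + 1)) ≫ e.f (i + 1) ≫ coconeInl f (i + 1) +
      (coconeSnd f i ≫ e'.f i) ≫ e'.f i ≫ coconeInr f i = ε.f (i + 1) := fun i => by
    rw [Category.assoc, Category.assoc, reassoc_of% idem_f he, reassoc_of% idem_f he', ← hl, ← hr,
      ← Category.assoc, ← Category.assoc, ← Preadditive.add_comp, cocone_total, Category.id_comp]
  have b₇ : e.f (n + 1) ≫ coconeInl f (n + 1) = 0 := by rw [coconeInl_last, comp_zero]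
  have b₈ : ∀ i, (e.f i ≫ coconeInl f i) ≫ ε.f i ≫ (cocone f).K.d i (i + 1) =
      (e.f i ≫ X.K.d i (i + 1)) ≫ e.f (i + 1) ≫ coconeInl f (i + 1) +
      (e.f i ≫ f.f i ≫ e'.f i) ≫ e'.f i ≫ coconeInr f i := fun i => by
    rw [Category.assoc, reassoc_of% hl, coconeInl_d, reassoc_of% idem_f he, Preadditive.comp_add,
      Category.assoc, Category.assoc, Category.assoc, reassoc_of% idem_f he', ← e.comm_assoc,
      reassoc_of% idem_f he, reassoc_of% hf, reassoc_of% hf, reassoc_of% idem_f he']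
  have b₉ : ∀ i, (e'.f i ≫ coconeInr f i) ≫ ε.f (i + 1) ≫ (cocone f).K.d (i + 1) (i + 1 + 1) =
      -((e'.f i ≫ Y.K.d i (i + 1)) ≫ e'.f (i + 1) ≫ coconeInr f (i + 1)) := fun i => by
    rw [Category.assoc, reassoc_of% hr, coconeInr_d, reassoc_of% idem_f he', Preadditive.comp_neg,
      Category.assoc, ← e'.comm_assoc, reassoc_of% idem_f he']
  have b₁₀ : P.p ≫ (cocone f).isoLeft.hom = (P.p ≫ X.isoLeft.hom) ≫ e.f 0 ≫ coconeInl f 0 := by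
    rw [cocone_isoLeft_hom, hends.f_zero]
    simp
  have b₁₁ : ε.f (n + 1) ≫ (cocone f).isoRight.hom = coconeSnd f n ≫ e'.f n := by
    rw [cocone_isoRight_hom, hp₂]
  -- Inclusions and projections are those of the cocone in `C`, compressed by `e` and `e'`; all
  -- required identities hold already for the underlying morphisms.
  exact homotopyEquivalent_cocone _
    (fun i => ⟨e.f i ≫ coconeInl f i, a₁ i⟩) (fun i => ⟨e'.f i ≫ coconeInr f i, a₂ i⟩)
    (fun i => ⟨coconeFst f i ≫ e.f i, a₃ i⟩) (fun i => ⟨coconeSnd f i ≫ e'.f i, a₄ i⟩)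
    (fun i hi => Karoubi.Hom.ext (b₁ i hi)) (fun i hi => Karoubi.Hom.ext (b₂ i hi))
    (fun i => Karoubi.Hom.ext (b₃ i)) (fun i => Karoubi.Hom.ext (b₄ i))
    (Karoubi.Hom.ext b₅) (fun i => Karoubi.Hom.ext (b₆ i)) (Karoubi.Hom.ext b₇)
    (fun i => Karoubi.Hom.ext (b₈ i)) (fun i => Karoubi.Hom.ext (b₉ i))
    (Karoubi.Hom.ext (by
      rw [Karoubi.comp_f, karoubi_isoLeft_hom_f]
      exact (karoubi_isoLeft_hom_f (Q := (Y.karoubi e' he' hends').K.X n) (X := cocone f)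
        (e := ε) (he := hε) (hends := hεe)).trans b₁₀))
    (Karoubi.Hom.ext ((karoubi_isoRight_hom_f (Q := (Y.karoubi e' he' hends').K.X n)
      (X := cocone f) (e := ε) (he := hε) (hends := hεe)).trans b₁₁))

/-- The mapping cone in the idempotent completion is a direct summand of the mapping cone. -/
lemma exists_karoubi_cone (h : e ≫ f = f ≫ e') :
    ∃ (ε : (cone f).K ⟶ (cone f).K) (hε : ε ≫ ε = ε) (hεe : HasEnds ε (e.f 1) Q'.p),
      HomotopyEquivalent (cone (karoubiMap f : (X.karoubi e he hends).K ⟶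
        (Y.karoubi e' he' hends').K))
        (ComplexBetween.karoubi (P := (X.karoubi e he hends).K.X 1) (cone f) ε hε hεe) := by
  obtain ⟨ε, hl, hr, hp₁, hp₂, hεe⟩ := exists_cone_directSum h hends'
  have hε : ε ≫ ε = ε := by
    ext i
    rw [HomologicalComplex.comp_f]
    apply cone_hom_ext
    · rw [reassoc_of% hl, hl, reassoc_of% idem_f he]
    · rw [reassoc_of% hr, hr, reassoc_of% idem_f he']
  have hf : ∀ i, e.f i ≫ f.f i = f.f i ≫ e'.f i := fun i => by
    rw [← HomologicalComplex.comp_f, h, HomologicalComplex.comp_f]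
  refine ⟨ε, hε, hεe, ?_⟩
  have a₁ : ∀ i, e.f (i + 1) ≫ (e.f (i + 1) ≫ coneInl f i) ≫ ε.f i =
      e.f (i + 1) ≫ coneInl f i := fun i => by
    rw [Category.assoc, hl, reassoc_of% idem_f he, reassoc_of% idem_f he]
  have a₂ : ∀ i, e'.f i ≫ (e'.f i ≫ coneInr f i) ≫ ε.f i = e'.f i ≫ coneInr f i :=
    fun i => by rw [Category.assoc, hr, reassoc_of% idem_f he', reassoc_of% idem_f he']
  have a₃ : ∀ i, ε.f i ≫ (coneFst f i ≫ e.f (i + 1)) ≫ e.f (i + 1) =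
      coneFst f i ≫ e.f (i + 1) := fun i => by
    rw [Category.assoc, reassoc_of% hp₁, idem_f he, idem_f he]
  have a₄ : ∀ i, ε.f i ≫ (coneSnd f i ≫ e'.f i) ≫ e'.f i = coneSnd f i ≫ e'.f i :=
    fun i => by rw [Category.assoc, reassoc_of% hp₂, idem_f he', idem_f he']
  have b₁ : ∀ i ≤ n, (e.f (i + 1) ≫ coneInl f i) ≫ coneFst f i ≫ e.f (i + 1) = e.f (i + 1) :=
    fun i hi => by
      rw [Category.assoc, reassoc_of% (coneInl_fst f hi), idem_f he]
  have b₂ : ∀ i, (e'.f (i + 1) ≫ coneInr f (i + 1)) ≫ coneSnd f (i + 1) ≫ e'.f (i + 1) =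
      e'.f (i + 1) := fun i => by
    rw [Category.assoc, reassoc_of% (coneInr_snd f i), idem_f he']
  have b₃ : ∀ i, (e.f (i + 1) ≫ coneInl f i) ≫ coneSnd f i ≫ e'.f i = 0 := fun i => by
    rw [Category.assoc, reassoc_of% coneInl_snd, zero_comp, comp_zero]
  have b₄ : ∀ i, (e'.f i ≫ coneInr f i) ≫ coneFst f i ≫ e.f (i + 1) = 0 := fun i => by
    rw [Category.assoc, reassoc_of% coneInr_fst, zero_comp, comp_zero]
  have b₅ : ∀ i, (coneFst f i ≫ e.f (i + 1)) ≫ e.f (i + 1) ≫ coneInl f i +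
      (coneSnd f i ≫ e'.f i) ≫ e'.f i ≫ coneInr f i = ε.f i := fun i => by
    rw [Category.assoc, Category.assoc, reassoc_of% idem_f he, reassoc_of% idem_f he', ← hl, ← hr,
      ← Category.assoc, ← Category.assoc, ← Preadditive.add_comp, cone_total, Category.id_comp]
  have b₆ : e'.f 0 ≫ coneInr f 0 = 0 := by rw [coneInr_zero, comp_zero]
  have b₇ : ∀ i, n ≤ i → e.f (i + 1 + 1) ≫ coneInl f (i + 1) = 0 := fun i hi => by
    rw [coneInl_last f hi, comp_zero]
  have b₈ : ∀ i, (e.f (i + 1) ≫ coneInl f i) ≫ ε.f i ≫ (cone f).K.d i (i + 1) =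
      -((e.f (i + 1) ≫ X.K.d (i + 1) (i + 1 + 1)) ≫ e.f (i + 1 + 1) ≫ coneInl f (i + 1)) +
      (e.f (i + 1) ≫ f.f (i + 1) ≫ e'.f (i + 1)) ≫ e'.f (i + 1) ≫ coneInr f (i + 1) :=
    fun i => by
      rw [Category.assoc, reassoc_of% hl, coneInl_d, reassoc_of% idem_f he, Preadditive.comp_add,
        Preadditive.comp_neg, Category.assoc, Category.assoc, Category.assoc,
        reassoc_of% idem_f he', ← e.comm_assoc, reassoc_of% idem_f he, reassoc_of% hf,
        reassoc_of% hf, reassoc_of% idem_f he']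
  have b₉ : ∀ i, (e'.f (i + 1) ≫ coneInr f (i + 1)) ≫ ε.f (i + 1) ≫
      (cone f).K.d (i + 1) (i + 1 + 1) =
      (e'.f (i + 1) ≫ Y.K.d (i + 1) (i + 1 + 1)) ≫ e'.f (i + 1 + 1) ≫ coneInr f (i + 1 + 1) :=
    fun i => by
      rw [Category.assoc, reassoc_of% hr, coneInr_d, reassoc_of% idem_f he',
        Category.assoc, ← e'.comm_assoc, reassoc_of% idem_f he']
  have b₁₀ : e.f 1 ≫ (cone f).isoLeft.hom = e.f 1 ≫ coneInl f 0 := by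
    rw [cone_isoLeft_hom]
  have b₁₁ : ε.f (n + 1) ≫ (cone f).isoRight.hom =
      (coneSnd f (n + 1) ≫ e'.f (n + 1)) ≫ e'.f (n + 1) ≫ Y.isoRight.hom := by
    rw [cone_isoRight_hom, reassoc_of% hp₂, Category.assoc, reassoc_of% idem_f he']
  exact homotopyEquivalent_cone _
    (fun i => ⟨e.f (i + 1) ≫ coneInl f i, a₁ i⟩) (fun i => ⟨e'.f i ≫ coneInr f i, a₂ i⟩)
    (fun i => ⟨coneFst f i ≫ e.f (i + 1), a₃ i⟩) (fun i => ⟨coneSnd f i ≫ e'.f i, a₄ i⟩)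
    (fun i hi => Karoubi.Hom.ext (b₁ i hi)) (fun i => Karoubi.Hom.ext (b₂ i))
    (fun i => Karoubi.Hom.ext (b₃ i)) (fun i => Karoubi.Hom.ext (b₄ i))
    (fun i => Karoubi.Hom.ext (b₅ i)) (Karoubi.Hom.ext b₆) (fun i hi => Karoubi.Hom.ext (b₇ i hi))
    (fun i => Karoubi.Hom.ext (b₈ i)) (fun i => Karoubi.Hom.ext (b₉ i))
    (Karoubi.Hom.ext ((karoubi_isoLeft_hom_f (P := (X.karoubi e he hends).K.X 1) (X := cone f)
      (e := ε) (he := hε) (hends := hεe)).trans b₁₀))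
    (Karoubi.Hom.ext (by
      rw [Karoubi.comp_f, karoubi_isoRight_hom_f]
      exact (karoubi_isoRight_hom_f (P := (X.karoubi e he hends).K.X 1) (X := cone f)
        (e := ε) (he := hε) (hends := hεe)).trans b₁₁))

end ComplexBetween

end KaroubiCone

end NExangulated

/-! ### Good lifts in the idempotent completion -/

namespace NExangulated

open ComplexBetween Idempotents

section GoodLift

variable {D : Type u} [Category.{v} D] [Preadditive D]

/-- Used to make a lift commute with two `idempotentLift`s: the right corrections correspond under
`f`, while the left ones are killed by `f` on either side. -/
lemma sub_comp_sub_comp_of_left_zero {X Y : D} {f : X ⟶ Y} {r l : X ⟶ X} {r' l' : Y ⟶ Y}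
    (hr : r ≫ f = f ≫ r') (hl : l ≫ f = 0) (hl' : f ≫ l' = 0) :
    ((𝟙 X - r) ≫ (𝟙 X - l)) ≫ f = f ≫ (𝟙 Y - r') ≫ (𝟙 Y - l') := by
  have h : f ≫ r' ≫ l' = 0 := by rw [← reassoc_of% hr, hl', comp_zero]
  simp [Preadditive.comp_sub, Preadditive.sub_comp, hl, hl', h, hr]

lemma sub_comp_sub_comp_of_right_zero {X Y : D} {f : X ⟶ Y} {r l : X ⟶ X} {r' l' : Y ⟶ Y}
    (hl : l ≫ f = f ≫ l') (hr : r ≫ f = 0) (hr' : f ≫ r' = 0) :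
    ((𝟙 X - r) ≫ (𝟙 X - l)) ≫ f = f ≫ (𝟙 Y - r') ≫ (𝟙 Y - l') := by
  have h : r ≫ f ≫ l' = 0 := by rw [reassoc_of% hr, zero_comp]
  have h' : f ≫ r' ≫ l' = 0 := by rw [reassoc_of% hr', zero_comp]
  simp [Preadditive.comp_sub, Preadditive.sub_comp, hl, hr, hr', h, h']

variable {C : Type u} [Category.{v} C] [Preadditive C] [HasFiniteBiproducts C] {n : ℕ} [NeZero n]
  {E : Cᵒᵖ ⥤ C ⥤ AddCommGrpCat.{w}} {s : Assignment n E} {P P' Q Q' : Karoubi C}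

attribute [local instance] hasBinaryBiproducts_of_finite_biproducts

/-- A good lift in `C` is normalised to intertwine idempotents on `X` and `Y`; its cocone in the
completion is then a summand of a realisation in `C`. The result is finally moved to the given
representatives. -/
lemma exists_good_lift_op_karoubi (hC : IsNExangulated n E s) (δ : Ext (karoubiExt E) Q P)
    (a : P ⟶ P') {Z : ComplexBetween n P Q} {Z' : ComplexBetween n P' Q}
    (hZ : Z ∈ karoubiAssignment s δ)
    (hZ' : Z' ∈ karoubiAssignment s (push (karoubiExt E) a δ)) :
    ∃ f : Z.K ⟶ Z'.K, HasEnds f a (𝟙 Q) ∧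
      karoubiAssignment s (pull (karoubiExt E) Z'.dLast δ) = (cocone f).homotopyClass := by
  have hE := hC.isBiadditive
  have hs := hC.isExactRealisation
  obtain ⟨X, hX⟩ := hs.nonempty (underlying E δ)
  obtain ⟨Y, hY⟩ := hs.nonempty (push E a.f (underlying E δ))
  have hXe := hs.isNExangle _ X hX
  have hYe := hs.isNExangle _ Y hY
  obtain ⟨f₀, hf₀, hg₀⟩ := hC.exists_good_lift_op _ _ X hX Y hY
  replace hg₀ : cocone f₀ ∈ s (pull E Y.dLast (underlying E δ)) :=
    hg₀ ▸ HomotopyEquivalent.refl _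
  obtain ⟨k, hk⟩ := hXe.exists_desc_dFirst (𝟙 P.X - P.p) (by
    rw [hE.push_sub, push_id, push_p_underlying, sub_self])
  obtain ⟨k', hk'⟩ := hYe.exists_desc_dFirst (𝟙 P'.X - P'.p) (by
    rw [hE.push_sub, push_id, ← push_comp, Karoubi.comp_p, sub_self])
  obtain ⟨l, hl⟩ := hXe.exists_lift_dLast (𝟙 Q.X - Q.p) (by
    rw [hE.pull_sub, pull_id, pull_p_underlying, sub_self])
  -- Composing with the complement of the left correction of `Y` makes `f ≫ leftNull` vanish. The
  -- end `a` is unchanged since `a` is already fixed by the idempotent of its target, and the map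
  -- changes only by a null-homotopic one.
  obtain ⟨f, hfd⟩ : ∃ f : X.K ⟶ Y.K, f = f₀ ≫ (𝟙 _ - leftNull Y P'.p k') := ⟨_, rfl⟩
  have hf : HasEnds f a.f (𝟙 Q.X) := by
    rw [hfd]
    exact hf₀.comp' (HasEnds.id.sub (hasEnds_leftNull P'.idem hk')) (by simp) (by simp)
  have hh : Homotopy f₀ f := Homotopy.equivSubZero.symm ((Homotopy.ofEq (by
    rw [hfd, Preadditive.comp_sub, Category.comp_id, sub_sub_cancel, leftNull,
      comp_singleNull])).trans (homotopySingleNull _ _))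
  have hg : cocone f ∈ s (pull E Y.dLast (underlying E δ)) :=
    hs.cocone_mem_of_homotopy hE hX hY hf₀ hg₀ hf HasEnds.id HasEnds.id HasEnds.id HasEnds.id
      ((Homotopy.ofEq (by simp)).trans (hh.symm.trans (.ofEq (by simp))))
      ((Homotopy.ofEq (by simp)).trans (hh.trans (.ofEq (by simp))))
  -- The factorisation for `Y` is taken as the image of the one for `X`, so that the right
  -- corrections correspond under `f`.
  have hl' : (l ≫ f.f n) ≫ Y.dLast = 𝟙 Q.X - Q.p := by
    rw [Category.assoc, hf.dLast, Category.comp_id, hl]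
  have hcomm : idempotentLift X P.p Q.p k l ≫ f =
      f ≫ idempotentLift Y P'.p Q.p k' (l ≫ f.f n) := by
    refine sub_comp_sub_comp_of_left_zero ?_ ?_ ?_
    · rw [rightNull, singleNull_comp, rightNull, comp_singleNull, hf.f_last]
      simp
    · rw [leftNull, singleNull_comp, hf.f_zero]
      simp [singleNull_zero]
    · rw [hfd, Category.assoc, Preadditive.sub_comp, leftNull_comp_self P'.idem hk',
        Category.id_comp, sub_self, comp_zero]
  have he := idempotentLift_comp_self P.idem Q.idem hk hl
  have hends := hasEnds_idempotentLift P.idem Q.idem hk hl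
  have he' := idempotentLift_comp_self P'.idem Q.idem hk' hl'
  have hends' := hasEnds_idempotentLift P'.idem Q.idem hk' hl'
  obtain ⟨ε, hε, hεe, hh⟩ := exists_karoubi_cocone (he := he) (hends := hends) (he' := he')
    (hends' := hends') hcomm
  have hm₁ := karoubi_mem (δ := δ) hX _ he hends
  have hm₂ := karoubi_mem (δ := push (karoubiExt E) a δ) hY _ he' hends'
  -- Because `δ` is fixed by `Q.p`, pulling back along the compressed last differential gives the
  -- same extension as pulling back along `Y.dLast`, which the cocone of `f` realises.
  have hm₃ := karoubi_mem (s := s) (Q := (Y.karoubi _ he' hends').K.X n)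
    (δ := pull (karoubiExt E) (Y.karoubi _ he' hends').dLast δ) (X := cocone f) (by
      have h₁ : pull E (Y.dLast ≫ Q.p) (underlying E δ) = pull E Y.dLast (underlying E δ) := by
        rw [pull_comp, pull_p_underlying]
      rw [underlying_pull, karoubi_dLast_f']
      rw [← h₁] at hg
      exact hg) ε hε hεe
  exact (hs.karoubi hE).exists_good_lift_op_of_mem hE.karoubiExt hm₁ hZ hm₂ hZ'
    (hasEnds_karoubiMap hf (by simp) (by simp)) (((hs.karoubi hE).mem_iff hm₃).2 hh.symm)

/-- Dual normalisation: `f₀` is precomposed with the complement of the right correction of `X`, and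
the left factorisation for `X` is obtained from that for `Y` by composing with `f`. -/
lemma exists_good_lift_karoubi (hC : IsNExangulated n E s) (δ : Ext (karoubiExt E) Q P)
    (c : Q' ⟶ Q) {Z' : ComplexBetween n P Q'} {Z : ComplexBetween n P Q}
    (hZ' : Z' ∈ karoubiAssignment s (pull (karoubiExt E) c δ))
    (hZ : Z ∈ karoubiAssignment s δ) :
    ∃ f : Z'.K ⟶ Z.K, HasEnds f (𝟙 P) c ∧
      karoubiAssignment s (push (karoubiExt E) Z'.dFirst δ) = (cone f).homotopyClass := by
  have hE := hC.isBiadditive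
  have hs := hC.isExactRealisation
  obtain ⟨X, hX⟩ := hs.nonempty (pull E c.f (underlying E δ))
  obtain ⟨Y, hY⟩ := hs.nonempty (underlying E δ)
  have hXe := hs.isNExangle _ X hX
  have hYe := hs.isNExangle _ Y hY
  obtain ⟨f₀, hf₀, hg₀⟩ := hC.exists_good_lift _ _ X hX Y hY
  replace hg₀ : cone f₀ ∈ s (push E X.dFirst (underlying E δ)) :=
    hg₀ ▸ HomotopyEquivalent.refl _
  obtain ⟨k, hk⟩ := hYe.exists_desc_dFirst (𝟙 P.X - P.p) (by
    rw [hE.push_sub, push_id, push_p_underlying, sub_self])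
  obtain ⟨l, hl⟩ := hXe.exists_lift_dLast (𝟙 Q'.X - Q'.p) (by
    rw [hE.pull_sub, pull_id, ← pull_comp, Karoubi.p_comp, sub_self])
  obtain ⟨l', hl'⟩ := hYe.exists_lift_dLast (𝟙 Q.X - Q.p) (by
    rw [hE.pull_sub, pull_id, pull_p_underlying, sub_self])
  obtain ⟨f, hfd⟩ : ∃ f : X.K ⟶ Y.K, f = (𝟙 _ - rightNull X Q'.p l) ≫ f₀ := ⟨_, rfl⟩
  have hf : HasEnds f (𝟙 P.X) c.f := by
    rw [hfd]
    exact (HasEnds.id.sub (hasEnds_rightNull Q'.idem hl)).comp' hf₀ (by simp) (by simp)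
  have hh : Homotopy f₀ f := Homotopy.equivSubZero.symm ((Homotopy.ofEq (by
    rw [hfd, Preadditive.sub_comp, Category.id_comp, sub_sub_cancel, rightNull,
      singleNull_comp])).trans (homotopySingleNull _ _))
  have hg : cone f ∈ s (push E X.dFirst (underlying E δ)) :=
    hs.cone_mem_of_homotopy hE hX hY hf₀ hg₀ hf HasEnds.id HasEnds.id HasEnds.id HasEnds.id
      ((Homotopy.ofEq (by simp)).trans (hh.trans (.ofEq (by simp))))
      ((Homotopy.ofEq (by simp)).trans (hh.symm.trans (.ofEq (by simp))))
  have hk' : X.dFirst ≫ f.f 1 ≫ k = 𝟙 P.X - P.p := by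
    rw [reassoc_of% hf.dFirst, hk]
  have hcomm : idempotentLift X P.p Q'.p (f.f 1 ≫ k) l ≫ f =
      f ≫ idempotentLift Y P.p Q.p k l' := by
    refine sub_comp_sub_comp_of_right_zero ?_ ?_ ?_
    · rw [leftNull, singleNull_comp, leftNull, comp_singleNull, hf.f_zero]
      simp
    · rw [hfd, ← Category.assoc, Preadditive.comp_sub, rightNull_comp_self Q'.idem hl,
        Category.comp_id, sub_self, zero_comp]
    · rw [rightNull, comp_singleNull, hf.f_last]
      simp [singleNull_zero]
  have he := idempotentLift_comp_self P.idem Q'.idem hk' hl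
  have hends := hasEnds_idempotentLift P.idem Q'.idem hk' hl
  have he' := idempotentLift_comp_self P.idem Q.idem hk hl'
  have hends' := hasEnds_idempotentLift P.idem Q.idem hk hl'
  obtain ⟨ε, hε, hεe, hh⟩ := exists_karoubi_cone (he := he) (hends := hends) (he' := he')
    (hends' := hends') hcomm
  have hm₁ := karoubi_mem (δ := pull (karoubiExt E) c δ) hX _ he hends
  have hm₂ := karoubi_mem (δ := δ) hY _ he' hends'
  have hm₃ := karoubi_mem (s := s) (P := (X.karoubi _ he hends).K.X 1)
    (δ := push (karoubiExt E) (X.karoubi _ he hends).dFirst δ) (X := cone f) (by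
      have h₁ : push E (P.p ≫ X.dFirst) (underlying E δ) = push E X.dFirst (underlying E δ) := by
        rw [push_comp, push_p_underlying]
      rw [underlying_push, karoubi_dFirst_f]
      rw [← h₁] at hg
      exact hg) ε hε hεe
  exact (hs.karoubi hE).exists_good_lift_of_mem hE.karoubiExt hm₁ hZ' hm₂ hZ
    (hasEnds_karoubiMap hf (by simp) (by simp)) (((hs.karoubi hE).mem_iff hm₃).2 hh.symm)

end GoodLift

end NExangulated

/-! ### Splitting idempotent endomorphisms of realisations -/

namespace NExangulated

open ComplexBetween

section Splitting

variable {D : Type u} [Category.{v} D]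

/-- A splitting of an endomorphism, as a projection followed by an inclusion. -/
structure IdempotentSplitting {V : D} (e : V ⟶ V) where
  /-- the image -/
  obj : D
  /-- the projection to the image -/
  proj : V ⟶ obj
  /-- the inclusion of the image -/
  incl : obj ⟶ V
  incl_proj : incl ≫ proj = 𝟙 obj
  proj_incl : proj ≫ incl = e

namespace IdempotentSplitting

lemma nonempty [IsIdempotentComplete D] {V : D} (e : V ⟶ V) (he : e ≫ e = e) :
    Nonempty (IdempotentSplitting e) := by
  obtain ⟨S, j, r, h₁, h₂⟩ := IsIdempotentComplete.idempotents_split V e he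
  exact ⟨⟨S, r, j, h₁, h₂⟩⟩

/-- Inflations and end terms are specified by equalities of objects, so the image of a splitting has
to be controlled on the nose and not just up to isomorphism. -/
lemma exists_eqToHom {V : D} {e : V ⟶ V} {σ τ : IdempotentSplitting e} (h : σ = τ) :
    ∃ h' : σ.obj = τ.obj, σ.proj ≫ eqToHom h' = τ.proj ∧ eqToHom h'.symm ≫ σ.incl = τ.incl := by
  subst h
  exact ⟨rfl, by simp, by simp⟩

lemma incl_comp {V : D} {e : V ⟶ V} (σ : IdempotentSplitting e) : σ.incl ≫ e = σ.incl :=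
  (congrArg (σ.incl ≫ ·) σ.proj_incl.symm).trans ((reassoc_of% σ.incl_proj) _)

lemma comp_proj {V : D} {e : V ⟶ V} (σ : IdempotentSplitting e) : e ≫ σ.proj = σ.proj :=
  (congrArg (· ≫ σ.proj) σ.proj_incl.symm).trans (by simp [σ.incl_proj])

variable [Preadditive D] {n : ℕ} {A B : D} {V : ComplexBetween n A B} {ε : V.K ⟶ V.K}
  (σ : ∀ i, IdempotentSplitting (ε.f i))

/-- The image of an idempotent endomorphism of a complex. -/
def complex : CochainComplex D ℕ where
  X i := (σ i).obj
  d i j := (σ i).incl ≫ V.K.d i j ≫ (σ j).proj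
  shape i j hij := by rw [V.K.shape i j hij, zero_comp, comp_zero]
  d_comp_d' i j k hij hjk := by
    rw [Category.assoc, Category.assoc, reassoc_of% (σ j).proj_incl, ← ε.comm_assoc,
      reassoc_of% incl_comp, HomologicalComplex.d_comp_d_assoc, zero_comp, comp_zero]

/-- The projection to the image. -/
def projHom : V.K ⟶ complex σ where
  f i := (σ i).proj
  comm' i j hij := by
    change (σ i).proj ≫ (σ i).incl ≫ V.K.d i j ≫ (σ j).proj = V.K.d i j ≫ (σ j).proj
    rw [reassoc_of% (σ i).proj_incl, ε.comm_assoc, comp_proj]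

/-- The inclusion of the image. -/
def inclHom : complex σ ⟶ V.K where
  f i := (σ i).incl
  comm' i j hij := by
    change (σ i).incl ≫ V.K.d i j = ((σ i).incl ≫ V.K.d i j ≫ (σ j).proj) ≫ (σ j).incl
    rw [Category.assoc, Category.assoc, (σ j).proj_incl, ← ε.comm, reassoc_of% incl_comp]

/-- The image of an idempotent endomorphism of a complex with prescribed end terms. -/
def complexBetween {A' B' : D} (hA : (σ 0).obj = A') (hB : (σ (n + 1)).obj = B') :
    ComplexBetween n A' B' where
  K := complex σ
  isZero i hi := by
    rw [IsZero.iff_id_eq_zero]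
    refine (σ i).incl_proj.symm.trans ?_
    rw [(V.isZero i hi).eq_of_src (σ i).proj 0, comp_zero]
    rfl
  left := hA
  right := hB

variable {A' B' : D} (hA : (σ 0).obj = A') (hB : (σ (n + 1)).obj = B')

lemma complexBetween_isCoexactMid (hV : V.IsCoexactMid) :
    (complexBetween σ hA hB).IsCoexactMid := by
  intro W i hi (g : (σ (i + 1)).obj ⟶ W) hg
  replace hg : ((σ i).incl ≫ V.K.d i (i + 1) ≫ (σ (i + 1)).proj) ≫ g = 0 := hg
  have h : V.K.d i (i + 1) ≫ (σ (i + 1)).proj ≫ g = 0 := by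
    rw [← comp_proj, Category.assoc, ← ε.comm_assoc, ← (σ i).proj_incl, Category.assoc]
    rw [Category.assoc, Category.assoc] at hg
    rw [hg, comp_zero]
  obtain ⟨g', hg'⟩ := hV W i hi ((σ (i + 1)).proj ≫ g) h
  have h' : ((σ (i + 1)).incl ≫ V.K.d (i + 1) (i + 1 + 1) ≫ (σ (i + 1 + 1)).proj) ≫
      (σ (i + 1 + 1)).incl ≫ g' = g := by
    rw [Category.assoc, Category.assoc, reassoc_of% (σ (i + 1 + 1)).proj_incl, ← ε.comm_assoc,
      reassoc_of% incl_comp, hg', reassoc_of% (σ (i + 1)).incl_proj]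
  exact ⟨(σ (i + 1 + 1)).incl ≫ g', h'⟩

lemma complexBetween_isExactMid (hV : V.IsExactMid) :
    (complexBetween σ hA hB).IsExactMid := by
  intro W i hi (g : W ⟶ (σ (i + 1)).obj) hg
  replace hg : g ≫ (σ (i + 1)).incl ≫ V.K.d (i + 1) (i + 1 + 1) ≫ (σ (i + 1 + 1)).proj = 0 := hg
  have h : (g ≫ (σ (i + 1)).incl) ≫ V.K.d (i + 1) (i + 1 + 1) = 0 := by
    rw [← incl_comp, Category.assoc, Category.assoc, ε.comm, ← (σ (i + 1 + 1)).proj_incl,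
      reassoc_of% hg, zero_comp]
  obtain ⟨g', hg'⟩ := hV W i hi (g ≫ (σ (i + 1)).incl) h
  have h' : (g' ≫ (σ i).proj) ≫ (σ i).incl ≫ V.K.d i (i + 1) ≫ (σ (i + 1)).proj = g := by
    rw [Category.assoc, reassoc_of% (σ i).proj_incl, ε.comm_assoc, comp_proj, reassoc_of% hg',
      (σ (i + 1)).incl_proj, Category.comp_id]
  exact ⟨g' ≫ (σ i).proj, h'⟩

end IdempotentSplitting

open IdempotentSplitting

variable [Preadditive D] [HasZeroObject D] {n : ℕ} [NeZero n] {E : Dᵒᵖ ⥤ D ⥤ AddCommGrpCat.{w}}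
  {s : Assignment n E} {A B : D} {V : ComplexBetween n A B} {ε : V.K ⟶ V.K}

/-- Direct summands of realisations, with the same first term. -/
lemma IsExactRealisation.exists_mem_split_last (hs : IsExactRealisation s) (hE : IsBiadditive E)
    {ρ : Ext E B A} (hV : V ∈ s ρ) {b : B ⟶ B} (hε : HasEnds ε (𝟙 A) b) (hb : pull E b ρ = ρ)
    (σ : ∀ i, IdempotentSplitting (ε.f i)) (hA : (σ 0).obj = A)
    (hl : (σ 0).proj ≫ eqToHom hA = V.isoLeft.inv) :
    ∃ ρ' : Ext E (σ (n + 1)).obj A, complexBetween σ hA rfl ∈ s ρ' := by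
  have hp : (σ 0).proj ≫ eqToHom hA = V.isoLeft.inv ≫ 𝟙 A ∧ (σ (n + 1)).proj ≫ 𝟙 _ =
      V.isoRight.hom ≫ V.isoRight.inv ≫ (σ (n + 1)).proj := by simp [hl]
  replace hp : HasEnds (X := V) (Y := complexBetween σ hA rfl) (projHom σ) (𝟙 A)
    (V.isoRight.inv ≫ (σ (n + 1)).proj) := hp
  have hi : (σ 0).incl ≫ V.isoLeft.inv = eqToHom hA ≫ 𝟙 A ∧
      (σ (n + 1)).incl ≫ V.isoRight.hom = 𝟙 _ ≫ (σ (n + 1)).incl ≫ V.isoRight.hom := by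
    rw [← hl, reassoc_of% (σ 0).incl_proj]
    simp
  replace hi : HasEnds (X := complexBetween σ hA rfl) (Y := V) (inclHom σ) (𝟙 A)
    ((σ (n + 1)).incl ≫ V.isoRight.hom) := hi
  have hb' : b = (V.isoRight.inv ≫ (σ (n + 1)).proj) ≫ (σ (n + 1)).incl ≫ V.isoRight.hom := by
    rw [Category.assoc, reassoc_of% (σ (n + 1)).proj_incl, hε.f_last]
    simp
  -- The image realises the pullback of `ρ` along the inclusion of the last summand. Inclusion
  -- followed by projection is the identity, so the defect is zero and `0` serves as its
  -- factorisation.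
  refine ⟨pull E ((σ (n + 1)).incl ≫ V.isoRight.hom) ρ, hs.mem_of_hasEnds_last hE hV
    (complexBetween_isCoexactMid σ hA rfl
      (hs.isNExangle _ V hV).isCoexactMid).hasNilpotentDefect _ hp _ hi ?_ rfl 0 ?_⟩
  · rw [← pull_comp, ← hb', hb]
  · rw [zero_comp, Category.assoc, Iso.hom_inv_id_assoc, (σ (n + 1)).incl_proj, sub_self]

/-- Direct summands of realisations, with the same last term. -/
lemma IsExactRealisation.exists_mem_split_first (hs : IsExactRealisation s) (hE : IsBiadditive E)
    {ρ : Ext E B A} (hV : V ∈ s ρ) {a : A ⟶ A} (hε : HasEnds ε a (𝟙 B)) (ha : push E a ρ = ρ)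
    (σ : ∀ i, IdempotentSplitting (ε.f i)) (hB : (σ (n + 1)).obj = B)
    (hr : eqToHom hB.symm ≫ (σ (n + 1)).incl = V.isoRight.inv) :
    ∃ ρ' : Ext E B (σ 0).obj, complexBetween σ rfl hB ∈ s ρ' := by
  have hp : (σ 0).proj ≫ 𝟙 _ = V.isoLeft.inv ≫ V.isoLeft.hom ≫ (σ 0).proj ∧
      (σ (n + 1)).proj ≫ eqToHom hB = V.isoRight.hom ≫ 𝟙 B := by
    have h : V.isoRight.inv ≫ (σ (n + 1)).proj ≫ eqToHom hB = 𝟙 B := by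
      rw [← hr, Category.assoc, reassoc_of% (σ (n + 1)).incl_proj, eqToHom_trans, eqToHom_refl]
    rw [← cancel_epi V.isoRight.inv, h]
    simp
  replace hp : HasEnds (X := V) (Y := complexBetween σ rfl hB) (projHom σ)
    (V.isoLeft.hom ≫ (σ 0).proj) (𝟙 B) := hp
  have hi : (σ 0).incl ≫ V.isoLeft.inv = 𝟙 _ ≫ (σ 0).incl ≫ V.isoLeft.inv ∧
      (σ (n + 1)).incl ≫ V.isoRight.hom = eqToHom hB ≫ 𝟙 B := by
    rw [← cancel_epi (eqToHom hB.symm), reassoc_of% hr]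
    simp
  replace hi : HasEnds (X := complexBetween σ rfl hB) (Y := V) (inclHom σ)
    ((σ 0).incl ≫ V.isoLeft.inv) (𝟙 B) := hi
  have ha' : a = (V.isoLeft.hom ≫ (σ 0).proj) ≫ (σ 0).incl ≫ V.isoLeft.inv := by
    rw [Category.assoc, reassoc_of% (σ 0).proj_incl, hε.f_zero]
    simp
  refine ⟨push E (V.isoLeft.hom ≫ (σ 0).proj) ρ, hs.mem_of_hasEnds_first hE hV
    (complexBetween_isExactMid σ rfl hB
      (hs.isNExangle _ V hV).isExactMid).hasNilpotentDefect _ hp _ hi rfl ?_ 0 ?_⟩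
  · rw [← push_comp, ← ha', ha]
  · rw [comp_zero, Category.assoc, Iso.inv_hom_id_assoc, (σ 0).incl_proj, sub_self]

end Splitting

end NExangulated

/-! ### Cancellation for inflations and deflations in an idempotent complete category -/

namespace NExangulated

open ComplexBetween

section Retract

variable {D : Type u} [Category.{v} D] [Preadditive D] [HasFiniteBiproducts D]
  [IsIdempotentComplete D] {n : ℕ} [NeZero n] {E : Dᵒᵖ ⥤ D ⥤ AddCommGrpCat.{w}}
  {s : Assignment n E}

attribute [local instance] hasBinaryBiproducts_of_finite_biproducts

omit [HasFiniteBiproducts D] in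
/-- An idempotent endomorphism of a complex splits, with prescribed splittings in two degrees. -/
lemma exists_splitting {K : CochainComplex D ℕ} {ε : K ⟶ K} (hε : ε ≫ ε = ε) {i j : ℕ}
    (hij : i ≠ j) {S T : D} {p : K.X i ⟶ S} {ι : S ⟶ K.X i} (h₁ : ι ≫ p = 𝟙 S)
    (h₂ : p ≫ ι = ε.f i) {q : K.X j ⟶ T} {κ : T ⟶ K.X j} (h₃ : κ ≫ q = 𝟙 T)
    (h₄ : q ≫ κ = ε.f j) :
    ∃ (ψ : ∀ k, IdempotentSplitting (ε.f k)) (hS : (ψ i).obj = S) (hT : (ψ j).obj = T),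
      (ψ i).proj ≫ eqToHom hS = p ∧ eqToHom hS.symm ≫ (ψ i).incl = ι ∧
        (ψ j).proj ≫ eqToHom hT = q ∧ eqToHom hT.symm ≫ (ψ j).incl = κ := by
  have h : ∀ k, Nonempty (IdempotentSplitting (ε.f k)) := fun k =>
    IdempotentSplitting.nonempty _ (by rw [← HomologicalComplex.comp_f, hε])
  let σ : IdempotentSplitting (ε.f i) := ⟨S, p, ι, h₁, h₂⟩
  let τ : IdempotentSplitting (ε.f j) := ⟨T, q, κ, h₃, h₄⟩
  let ψ := Function.update (Function.update (fun k => (h k).some) i σ) j τ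
  have hi : ψ i = σ := (Function.update_of_ne hij _ _).trans (Function.update_self _ _ _)
  have hj : ψ j = τ := Function.update_self _ _ _
  obtain ⟨e₁, hp₁, hi₁⟩ := IdempotentSplitting.exists_eqToHom hi
  obtain ⟨e₂, hp₂, hi₂⟩ := IdempotentSplitting.exists_eqToHom hj
  exact ⟨ψ, e₁, e₂, hp₁, hi₁, hp₂, hi₂⟩

omit [IsIdempotentComplete D] [HasFiniteBiproducts D] [NeZero n] in
lemma one_sub_singleNull_comp_self {K : CochainComplex D ℕ} {j : ℕ} {h : K.X (j + 1) ⟶ K.X j}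
    (hh : h ≫ K.d j (j + 1) ≫ h = h) :
    (𝟙 K - singleNull K K j h) ≫ (𝟙 K - singleNull K K j h) = 𝟙 K - singleNull K K j h := by
  have hs : singleNull K K j h ≫ singleNull K K j h = singleNull K K j h := by
    rw [singleNull_comp, singleNull_f_self, hh]
  simp [Preadditive.comp_sub, Preadditive.sub_comp, hs]

/-- Splitting off a contractible summand at the beginning of a realisation. -/
lemma IsExactRealisation.isInflation_of_biproduct (hs : IsExactRealisation s)
    (hE : IsBiadditive E) {P Q S B : D} {ρ : Ext E B P} {V : ComplexBetween n P B} (hV : V ∈ s ρ)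
    (i₁ : S ⟶ V.K.X 1) (p₁ : V.K.X 1 ⟶ S) (i₂ : Q ⟶ V.K.X 1) (p₂ : V.K.X 1 ⟶ Q)
    (h₁₁ : i₁ ≫ p₁ = 𝟙 S) (h₂₂ : i₂ ≫ p₂ = 𝟙 Q) (h₁₂ : i₁ ≫ p₂ = 0)
    (ht : p₁ ≫ i₁ + p₂ ≫ i₂ = 𝟙 _) (y : Q ⟶ S) (hy : V.dFirst ≫ p₁ = V.dFirst ≫ p₂ ≫ y) :
    IsInflation s (V.dFirst ≫ p₂) := by
  have hn := NeZero.ne n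
  have hVe := hs.isNExangle _ _ hV
  -- The change of coordinates `p₁ - p₂ ≫ y` makes the component of `V.dFirst` in `S` zero. By
  -- coexactness it factors as `d ≫ l`, so `S` survives isomorphically into degree `2` and spans a
  -- contractible summand in degrees `1` and `2`.
  obtain ⟨m, hm⟩ : ∃ m, m = p₁ - p₂ ≫ y := ⟨_, rfl⟩
  have hdm : V.dFirst ≫ m = 0 := by rw [hm, Preadditive.comp_sub, hy, sub_self]
  obtain ⟨l, hl⟩ : ∃ l : V.K.X (1 + 1) ⟶ S, V.K.d 1 (1 + 1) ≫ l = m :=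
    hVe.isCoexactMid _ 0 (by omega) m (by
      rw [← cancel_epi V.isoLeft.hom, ← Category.assoc, ← dFirst_eq, hdm, comp_zero])
  have him : i₁ ≫ m = 𝟙 _ := by
    rw [hm, Preadditive.comp_sub, h₁₁, reassoc_of% h₁₂, zero_comp, sub_zero]
  obtain ⟨N, hN⟩ : ∃ N, N = singleNull V.K V.K 1 (l ≫ i₁) := ⟨_, rfl⟩
  have hε : (𝟙 _ - N) ≫ (𝟙 _ - N) = 𝟙 _ - N := by
    rw [hN]
    refine one_sub_singleNull_comp_self ?_
    rw [Category.assoc, reassoc_of% hl, reassoc_of% him]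
  -- For `n = 1` the contractible summand reaches the last term; the end `b` then factors through
  -- `V.dLast` and still annihilates `ρ`.
  obtain ⟨b, hb, hb'⟩ : ∃ b, HasEnds (X := V) (Y := V) N 0 b ∧ pull E b ρ = 0 := by
    by_cases h : n = 1
    · subst h
      refine ⟨_, hN ▸ hasEnds_singleNull_last _, ?_⟩
      rw [pull_comp, pull_comp, hVe.pull_dLast, map_zero, map_zero]
    · refine ⟨0, ?_, hE.pull_zero _⟩
      apply hasEnds_of_eq
      · rw [hN, singleNull_f_of_ne _ _ _ (by omega) (by omega)]; simp
      · rw [hN, singleNull_f_of_ne _ _ _ (by omega) (by omega)]; simp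
  have hN₀ : N.f 0 = 0 := by rw [hN, singleNull_f_of_ne _ _ _ (by omega) (by omega)]
  have hN₁ : N.f 1 = m ≫ i₁ := by rw [hN, singleNull_f_self, reassoc_of% hl]
  have hj : (i₂ + y ≫ i₁) ≫ p₂ = 𝟙 Q := by
    rw [Preadditive.add_comp, Category.assoc, h₁₂, comp_zero, add_zero, h₂₂]
  -- In degree `1` the complement of the contractible summand is `Q`, with the original projection
  -- `p₂` but a twisted inclusion. Keeping `p₂` is what makes the new first differential equal to
  -- `V.dFirst ≫ p₂`.
  have hj' : p₂ ≫ (i₂ + y ≫ i₁) = (𝟙 V.K - N).f 1 := by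
    rw [HomologicalComplex.sub_f_apply, HomologicalComplex.id_f, hN₁, hm, ← ht]
    simp
  have h₀ : 𝟙 _ ≫ 𝟙 _ = (𝟙 V.K - N).f 0 := by
    rw [HomologicalComplex.sub_f_apply, HomologicalComplex.id_f, hN₀, sub_zero, Category.comp_id]
  obtain ⟨ψ, e₀, e₁, hp₀, hi₀, hp₁, -⟩ := exists_splitting hε zero_ne_one (Category.comp_id _) h₀
    hj hj'
  have e₀' : eqToHom (e₀.trans V.left).symm = V.isoLeft.hom ≫ eqToHom e₀.symm :=
    (eqToHom_trans V.left.symm e₀.symm).symm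
  have e₀'' : eqToHom (e₀.trans V.left) = eqToHom e₀ ≫ V.isoLeft.inv :=
    (eqToHom_trans e₀ V.left).symm
  obtain ⟨ρ', hV'⟩ := hs.exists_mem_split_last hE hV
    ((HasEnds.id.sub hb).congr (sub_zero _) rfl)
    (by rw [hE.pull_sub, hb', pull_id, sub_zero]) ψ (e₀.trans V.left) (by
      rw [e₀'', reassoc_of% hp₀])
  refine ⟨_, ρ', _, hV', e₁, ?_⟩
  have h : (eqToHom (e₀.trans V.left).symm ≫ (ψ 0).incl ≫ V.K.d 0 1 ≫ (ψ 1).proj) ≫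
      eqToHom e₁ = V.dFirst ≫ p₂ := by
    rw [Category.assoc, Category.assoc, Category.assoc, hp₁, e₀', Category.assoc,
      reassoc_of% hi₀, dFirst_eq, Category.assoc]
  exact h

/-- Splitting off a contractible summand at the end of a realisation. -/
lemma IsExactRealisation.isDeflation_of_biproduct (hs : IsExactRealisation s)
    (hE : IsBiadditive E) {Q S A B : D} {ρ : Ext E B A} {V : ComplexBetween n A B} (hV : V ∈ s ρ)
    (i₁ : S ⟶ V.K.X n) (p₁ : V.K.X n ⟶ S) (i₂ : Q ⟶ V.K.X n) (p₂ : V.K.X n ⟶ Q)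
    (h₁₁ : i₁ ≫ p₁ = 𝟙 S) (h₂₂ : i₂ ≫ p₂ = 𝟙 Q) (h₂₁ : i₂ ≫ p₁ = 0)
    (ht : p₁ ≫ i₁ + p₂ ≫ i₂ = 𝟙 _) (y : S ⟶ Q) (hy : i₁ ≫ V.dLast = y ≫ i₂ ≫ V.dLast) :
    IsDeflation s (i₂ ≫ V.dLast) := by
  have hVe := hs.isNExangle _ _ hV
  obtain ⟨k, hk⟩ := Nat.exists_eq_succ_of_ne_zero (NeZero.ne n)
  -- Dually, the inclusion of `S` is twisted so that it is killed by `V.dLast`; exactness lifts it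
  -- to degree `n - 1`, and the contractible summand sits in degrees `n - 1` and `n`. For `n = 1` it
  -- reaches the first term.
  obtain ⟨m, hm⟩ : ∃ m, m = i₁ - y ≫ i₂ := ⟨_, rfl⟩
  have hdm : m ≫ V.dLast = 0 := by
    rw [hm, Preadditive.sub_comp, hy, Category.assoc, sub_self]
  have hmp : m ≫ p₁ = 𝟙 _ := by
    rw [hm, Preadditive.sub_comp, h₁₁, Category.assoc, h₂₁, comp_zero, sub_zero]
  have hj : i₂ ≫ (p₂ + p₁ ≫ y) = 𝟙 Q := by
    rw [Preadditive.comp_add, reassoc_of% h₂₁, zero_comp, add_zero, h₂₂]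
  have hj' : (p₂ + p₁ ≫ y) ≫ i₂ = 𝟙 _ - p₁ ≫ m := by
    rw [hm, ← ht]
    simp
  obtain ⟨N, hε, hNn, hNl, a, ha, ha'⟩ : ∃ N : V.K ⟶ V.K, (𝟙 _ - N) ≫ (𝟙 _ - N) = 𝟙 _ - N ∧
      N.f n = p₁ ≫ m ∧ N.f (n + 1) = 0 ∧ ∃ a, HasEnds (X := V) (Y := V) N a 0 ∧
        push E a ρ = 0 := by
    subst hk
    obtain ⟨l, hl⟩ := hVe.isExactMid _ k (by omega) m (by
      rw [← cancel_mono V.isoRight.hom, Category.assoc, ← dLast_eq, hdm, zero_comp])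
    refine ⟨singleNull V.K V.K k (p₁ ≫ l), one_sub_singleNull_comp_self ?_, ?_, ?_, ?_⟩
    · rw [Category.assoc, reassoc_of% hl, reassoc_of% hmp]
    · rw [singleNull_f_succ, Category.assoc, hl]
    · rw [singleNull_f_of_ne _ _ _ (by omega) (by omega)]
    · by_cases h : k = 0
      · subst h
        refine ⟨_, hasEnds_singleNull_first _, ?_⟩
        rw [push_comp, hVe.push_dFirst, map_zero]
      · refine ⟨0, ?_, hE.push_zero _⟩
        apply hasEnds_of_eq
        · rw [singleNull_f_of_ne _ _ _ (by omega) (by omega)]; simp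
        · rw [singleNull_f_of_ne _ _ _ (by omega) (by omega)]; simp
  have h₀ : 𝟙 _ ≫ 𝟙 _ = (𝟙 V.K - N).f (n + 1) := by
    rw [HomologicalComplex.sub_f_apply, HomologicalComplex.id_f, hNl, sub_zero, Category.comp_id]
  obtain ⟨ψ, e₀, e₁, hp₀, hi₀, -, hi₁⟩ := exists_splitting hε (Nat.succ_ne_self n)
    (Category.comp_id _) h₀ hj (by
      rw [HomologicalComplex.sub_f_apply, HomologicalComplex.id_f, hNn, hj'])
  have e₀' : eqToHom (e₀.trans V.right).symm = V.isoRight.inv ≫ eqToHom e₀.symm :=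
    (eqToHom_trans V.right.symm e₀.symm).symm
  have e₀'' : eqToHom (e₀.trans V.right) = eqToHom e₀ ≫ V.isoRight.hom :=
    (eqToHom_trans e₀ V.right).symm
  obtain ⟨ρ', hV'⟩ := hs.exists_mem_split_first hE hV
    ((HasEnds.id.sub ha).congr rfl (sub_zero _))
    (by rw [hE.push_sub, ha', push_id, sub_zero]) ψ (e₀.trans V.right) (by
      rw [e₀', Category.assoc, hi₀, Category.comp_id])
  refine ⟨_, ρ', _, hV', e₁.symm, ?_⟩
  have h : eqToHom e₁.symm ≫ ((ψ n).incl ≫ V.K.d n (n + 1) ≫ (ψ (n + 1)).proj) ≫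
      eqToHom (e₀.trans V.right) = i₂ ≫ V.dLast := by
    rw [Category.assoc, Category.assoc, e₀'', reassoc_of% hp₀, reassoc_of% hi₁, dLast_eq]
  exact h

omit [IsIdempotentComplete D] in
/-- The term of degree `1` of the mapping cocone of a lift of `(g, 1)`. -/
lemma cocone_biproduct {P Q B : D} {g : P ⟶ Q} {Z : ComplexBetween n P B}
    {W : ComplexBetween n Q B} {f : Z.K ⟶ W.K} (hf : HasEnds f g (𝟙 B)) :
    ∃ (i₁ : Z.K.X 1 ⟶ (cocone f).K.X 1) (p₁ : (cocone f).K.X 1 ⟶ Z.K.X 1)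
      (i₂ : Q ⟶ (cocone f).K.X 1) (p₂ : (cocone f).K.X 1 ⟶ Q), i₁ ≫ p₁ = 𝟙 _ ∧ i₂ ≫ p₂ = 𝟙 _ ∧
        i₁ ≫ p₂ = 0 ∧ p₁ ≫ i₁ + p₂ ≫ i₂ = 𝟙 _ ∧ (cocone f).dFirst ≫ p₁ = Z.dFirst ∧
        (cocone f).dFirst ≫ p₂ = g := by
  have h₁ := coconeInl_fst f (i := 0 + 1) (by have := NeZero.ne n; omega)
  have h₂ := coconeInr_snd f (Nat.zero_le n)
  have h₃ := coconeInl_snd f 0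
  have h₄ := coconeInr_fst f 0
  refine ⟨coconeInl f (0 + 1), coconeFst f (0 + 1), W.isoLeft.hom ≫ coconeInr f 0,
    coconeSnd f 0 ≫ W.isoLeft.inv, h₁, ?_, ?_, ?_, ?_, ?_⟩
  · rw [Category.assoc, reassoc_of% h₂, Iso.hom_inv_id]
  · rw [reassoc_of% h₃, zero_comp]
  · rw [Category.assoc, Iso.inv_hom_id_assoc]
    exact cocone_total f 0
  · refine (congrArg (· ≫ coconeFst f (0 + 1)) (cocone_dFirst f)).trans ?_
    refine (Preadditive.add_comp _ _ _ _ _ _).trans ?_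
    rw [Category.assoc, Category.assoc, Category.assoc, h₄]
    refine (congrArg (· + _) (congrArg (Z.dFirst ≫ ·) h₁)).trans ?_
    simp
  · refine (congrArg (· ≫ coconeSnd f 0 ≫ W.isoLeft.inv) (cocone_dFirst f)).trans ?_
    refine (Preadditive.add_comp _ _ _ _ _ _).trans ?_
    rw [Category.assoc, Category.assoc, Category.assoc, reassoc_of% h₂, hf.f_zero]
    refine (congrArg (· + _) (congrArg (Z.dFirst ≫ ·) ((reassoc_of% h₃) W.isoLeft.inv))).trans ?_
    simp

omit [IsIdempotentComplete D] in
/-- The term of degree `n` of the mapping cone of a lift of `(1, h)`. -/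
lemma cone_biproduct {A Q B : D} {h : Q ⟶ B} {W : ComplexBetween n A Q}
    {Z : ComplexBetween n A B} {f : W.K ⟶ Z.K} (hf : HasEnds f (𝟙 A) h) :
    ∃ (i₁ : Z.K.X n ⟶ (cone f).K.X n) (p₁ : (cone f).K.X n ⟶ Z.K.X n)
      (i₂ : Q ⟶ (cone f).K.X n) (p₂ : (cone f).K.X n ⟶ Q), i₁ ≫ p₁ = 𝟙 _ ∧ i₂ ≫ p₂ = 𝟙 _ ∧
        i₂ ≫ p₁ = 0 ∧ p₁ ≫ i₁ + p₂ ≫ i₂ = 𝟙 _ ∧ i₁ ≫ (cone f).dLast = Z.dLast ∧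
        i₂ ≫ (cone f).dLast = h := by
  have h₂₂ : coneInr f n ≫ coneSnd f n = 𝟙 _ := by
    obtain ⟨k, rfl⟩ := Nat.exists_eq_succ_of_ne_zero (NeZero.ne n)
    exact coneInr_snd f k
  refine ⟨coneInr f n, coneSnd f n, W.isoRight.inv ≫ coneInl f n, coneFst f n ≫ W.isoRight.hom,
    h₂₂, ?_, ?_, ?_, coneInr_dLast f, ?_⟩
  · rw [Category.assoc, reassoc_of% (coneInl_fst f le_rfl), Iso.inv_hom_id]
  · rw [Category.assoc, coneInl_snd, comp_zero]
  · rw [Category.assoc, Iso.hom_inv_id_assoc, add_comm]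
    exact cone_total f n
  · rw [Category.assoc, coneInl_dLast, hf.f_last]
    simp

/-- The cocone of a good lift along `g` has first differential with components `Z.dFirst` and `g`.
The first factors through the second by `y`, so `Z.K.X 1` can be split off as part of a contractible
summand, leaving `g`. -/
lemma IsExactRealisation.isInflation_of_comp_eq (hs : IsExactRealisation s) (hE : IsBiadditive E)
    {P Q B : D} (g : P ⟶ Q) {δ : Ext E B P} {Z : ComplexBetween n P B}
    (hgood : ∀ W ∈ s (push E g δ), ∃ f : Z.K ⟶ W.K, HasEnds f g (𝟙 B) ∧
      s (pull E W.dLast δ) = (cocone f).homotopyClass)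
    (y : Q ⟶ Z.K.X 1) (hy : g ≫ y = Z.dFirst) : IsInflation s g := by
  obtain ⟨W, hW⟩ := hs.nonempty (push E g δ)
  obtain ⟨f, hf, hV⟩ := hgood W hW
  replace hV : cocone f ∈ s (pull E W.dLast δ) := hV ▸ HomotopyEquivalent.refl _
  obtain ⟨i₁, p₁, i₂, p₂, h₁₁, h₂₂, h₁₂, ht, hd₁, hd₂⟩ := cocone_biproduct hf
  have := hs.isInflation_of_biproduct hE hV i₁ p₁ i₂ p₂ h₁₁ h₂₂ h₁₂ ht y (by
    rw [hd₁, reassoc_of% hd₂, hy])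
  rwa [hd₂] at this

lemma IsExactRealisation.isDeflation_of_comp_eq (hs : IsExactRealisation s) (hE : IsBiadditive E)
    {A Q B : D} (h : Q ⟶ B) {δ : Ext E B A} {Z : ComplexBetween n A B}
    (hgood : ∀ W ∈ s (pull E h δ), ∃ f : W.K ⟶ Z.K, HasEnds f (𝟙 A) h ∧
      s (push E W.dFirst δ) = (cone f).homotopyClass)
    (y : Z.K.X n ⟶ Q) (hy : y ≫ h = Z.dLast) : IsDeflation s h := by
  obtain ⟨W, hW⟩ := hs.nonempty (pull E h δ)
  obtain ⟨f, hf, hV⟩ := hgood W hW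
  replace hV : cone f ∈ s (push E W.dFirst δ) := hV ▸ HomotopyEquivalent.refl _
  obtain ⟨i₁, p₁, i₂, p₂, h₁₁, h₂₂, h₂₁, ht, hd₁, hd₂⟩ := cone_biproduct hf
  have := hs.isDeflation_of_biproduct hE hV i₁ p₁ i₂ p₂ h₁₁ h₂₂ h₂₁ ht y (by
    rw [hd₁, hd₂, hy])
  rwa [hd₂] at this

end Retract

end NExangulated

/-! ### Composition of inflations and deflations in the idempotent completion -/

namespace NExangulated

open ComplexBetween Idempotents

section KaroubiInflation

variable {C : Type u} [Category.{v} C] [Preadditive C] {n : ℕ}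
  {E : Cᵒᵖ ⥤ C ⥤ AddCommGrpCat.{w}} {s : Assignment n E} {P Q R : Karoubi C}

/-- The part of being an inflation that is retained: a comparison with the first differential of a
realisation in `C`, up to the idempotent of the source. -/
lemma exists_of_isInflation_karoubi {f : P ⟶ Q} (hf : IsInflation (karoubiAssignment s) f) :
    ∃ (B : Karoubi C) (δ : Ext (karoubiExt E) B P), ∃ X ∈ s (underlying E δ),
      ∃ y : Q.X ⟶ X.K.X 1, f.f ≫ y = P.p ≫ X.dFirst := by
  obtain ⟨B, δ, Z, ⟨X, hX, e, he, hends, -, g, -, hg, -⟩, rfl, rfl⟩ := hf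
  have h := congrArg Karoubi.Hom.f hg.dFirst
  rw [Category.id_comp, karoubi_dFirst_f] at h
  rw [eqToHom_refl, Category.comp_id]
  exact ⟨B, δ, X, hX, (g.f 1).f, h⟩

lemma exists_of_isDeflation_karoubi {f : Q ⟶ P} (hf : IsDeflation (karoubiAssignment s) f) :
    ∃ (A : Karoubi C) (δ : Ext (karoubiExt E) P A), ∃ X ∈ s (underlying E δ),
      ∃ y : X.K.X n ⟶ Q.X, y ≫ f.f = X.dLast ≫ P.p := by
  obtain ⟨A, δ, Z, ⟨X, hX, e, he, hends, g, -, hg, -⟩, rfl, rfl⟩ := hf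
  have h := congrArg Karoubi.Hom.f hg.dLast
  rw [Category.comp_id, karoubi_dLast_f'] at h
  rw [eqToHom_refl, Category.id_comp]
  exact ⟨A, δ, X, hX, (g.f n).f, h⟩

variable [NeZero n] [HasFiniteBiproducts C]

/-- If `f` is the first part of a factorisation of the first differential of a realisation, up to
idempotents, then `f` is an inflation in the idempotent completion. -/
lemma isInflation_karoubi_of_comp_eq (hC : IsNExangulated n E s) (f : P ⟶ Q) {B : C}
    {σ : Ext E B P.X} {S : ComplexBetween n P.X B} (hS : S ∈ s (push E P.p σ))
    (y : Q.X ⟶ S.K.X 1) (hy : f.f ≫ y = P.p ≫ S.dFirst) :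
    IsInflation (karoubiAssignment s) f := by
  have hE := hC.isBiadditive
  have hs := hC.isExactRealisation
  -- No idempotent is imposed on the last term: replacing `σ` by `push E P.p σ` already makes it an
  -- extension in the completion.
  let B' : Karoubi C := ⟨B, 𝟙 B, Category.comp_id _⟩
  let δ : Ext (karoubiExt E) B' P := karoubiExtMk (push E P.p σ)
    (by rw [← push_comp, P.idem]) (pull_id E _)
  obtain ⟨e, he, hends⟩ := exists_idempotentLift (P := P) (Q := B') hE δ (hs.isNExangle _ S hS)
  have h₁ : Q.p ≫ (Q.p ≫ y ≫ e.f 1) ≫ e.f 1 = Q.p ≫ y ≫ e.f 1 := by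
    simp [idem_f he]
  have h₂ : f.f ≫ Q.p ≫ y ≫ e.f 1 = P.p ≫ S.dFirst := by
    rw [reassoc_of% (Karoubi.comp_p f), reassoc_of% hy, hends.dFirst, P.idem_assoc]
  refine (hs.karoubi hE).isInflation_of_comp_eq hE.karoubiExt f (δ := δ)
    (Z := S.karoubi (Q := B') e he hends)
    (fun W hW => exists_good_lift_op_karoubi hC δ f (karoubi_mem (δ := δ) hS e he hends) hW)
    ⟨Q.p ≫ y ≫ e.f 1, h₁⟩ ?_
  ext
  rw [Karoubi.comp_f, karoubi_dFirst_f]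
  exact h₂

/-- If `f` is the last part of a factorisation of the last differential of a realisation, up to
idempotents, then `f` is a deflation in the idempotent completion. -/
lemma isDeflation_karoubi_of_comp_eq (hC : IsNExangulated n E s) (f : Q ⟶ P) {A : C}
    {σ : Ext E P.X A} {S : ComplexBetween n A P.X} (hS : S ∈ s (pull E P.p σ))
    (y : S.K.X n ⟶ Q.X) (hy : y ≫ f.f = S.dLast ≫ P.p) :
    IsDeflation (karoubiAssignment s) f := by
  have hE := hC.isBiadditive
  have hs := hC.isExactRealisation
  let A' : Karoubi C := ⟨A, 𝟙 A, Category.comp_id _⟩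
  let δ : Ext (karoubiExt E) P A' := karoubiExtMk (pull E P.p σ) (push_id E _)
    (by rw [← pull_comp, P.idem])
  obtain ⟨e, he, hends⟩ := exists_idempotentLift (P := A') (Q := P) hE δ (hs.isNExangle _ S hS)
  have h₁ : e.f n ≫ (e.f n ≫ y ≫ Q.p) ≫ Q.p = e.f n ≫ y ≫ Q.p := by
    simp [reassoc_of% idem_f he]
  have h₂ : (e.f n ≫ y ≫ Q.p) ≫ f.f = S.dLast ≫ P.p := by
    rw [Category.assoc, Category.assoc, Karoubi.p_comp, hy, reassoc_of% hends.dLast, P.idem]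
  refine (hs.karoubi hE).isDeflation_of_comp_eq hE.karoubiExt f (δ := δ)
    (Z := S.karoubi (P := A') e he hends)
    (fun W hW => exists_good_lift_karoubi hC δ f hW (karoubi_mem (δ := δ) hS e he hends))
    ⟨e.f n ≫ y ≫ Q.p, h₁⟩ ?_
  ext
  rw [Karoubi.comp_f, karoubi_dLast_f']
  exact h₂

/-- The two inflations cannot be composed in `C` directly, since their realisations need not have
matching middle terms. Pushing `δ'` out along `y` gives an inflation starting at `X.K.X 1`; the
composite in `C` then receives a factorisation through `f ≫ g`, which suffices by the cancellation
criterion. -/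
lemma isInflation_karoubi_comp (hC : IsNExangulated n E s) {f : P ⟶ Q} {g : Q ⟶ R}
    (hf : IsInflation (karoubiAssignment s) f) (hg : IsInflation (karoubiAssignment s) g) :
    IsInflation (karoubiAssignment s) (f ≫ g) := by
  have hs := hC.isExactRealisation
  obtain ⟨B, δ, X, hX, y, hy⟩ := exists_of_isInflation_karoubi hf
  obtain ⟨B', δ', Y', hY', y', hy'⟩ := exists_of_isInflation_karoubi hg
  obtain ⟨Y, hY⟩ := hs.nonempty (push E y (underlying E δ'))
  obtain ⟨θ, hθ⟩ := hs.exists_lift _ _ y (𝟙 _) (pull_id E _).symm Y' hY' Y hY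
  obtain ⟨D, σ, V, hV, hV₁, hV₂⟩ := hC.inflation_comp X.dFirst Y.dFirst
    ⟨_, _, X, hX, rfl, by simp⟩ ⟨_, _, Y, hY, rfl, by simp⟩
  -- The extension realised by the composite need not be fixed by `P.p`, so it is pushed forward
  -- along `P.p`.
  obtain ⟨S, hS⟩ := hs.nonempty (push E P.p σ)
  obtain ⟨κ, hκ⟩ := hs.exists_lift _ _ P.p (𝟙 _) (pull_id E _).symm V hV S hS
  refine isInflation_karoubi_of_comp_eq hC (f ≫ g) hS (y' ≫ θ.f 1 ≫ eqToHom hV₁.symm ≫ κ.f 1) ?_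
  rw [Karoubi.comp_f, Category.assoc, reassoc_of% hy', reassoc_of% (Karoubi.comp_p f),
    reassoc_of% hθ.dFirst, reassoc_of% hy, ← reassoc_of% hV₂, eqToHom_trans_assoc, eqToHom_refl,
    Category.id_comp, hκ.dFirst, P.idem_assoc]

lemma isDeflation_karoubi_comp (hC : IsNExangulated n E s) {f : R ⟶ Q} {g : Q ⟶ P}
    (hf : IsDeflation (karoubiAssignment s) f) (hg : IsDeflation (karoubiAssignment s) g) :
    IsDeflation (karoubiAssignment s) (f ≫ g) := by
  have hs := hC.isExactRealisation
  obtain ⟨A, δ, X, hX, y, hy⟩ := exists_of_isDeflation_karoubi hg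
  obtain ⟨A', δ', Y', hY', y', hy'⟩ := exists_of_isDeflation_karoubi hf
  obtain ⟨Y, hY⟩ := hs.nonempty (pull E y (underlying E δ'))
  obtain ⟨θ, hθ⟩ := hs.exists_lift _ _ (𝟙 _) y (push_id E _) Y hY Y' hY'
  obtain ⟨D, σ, V, hV, hV₁, hV₂⟩ := hC.deflation_comp Y.dLast X.dLast
    ⟨_, _, Y, hY, rfl, by simp⟩ ⟨_, _, X, hX, rfl, by simp⟩
  obtain ⟨S, hS⟩ := hs.nonempty (pull E P.p σ)
  obtain ⟨κ, hκ⟩ := hs.exists_lift _ _ (𝟙 _) P.p (push_id E _) S hS V hV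
  refine isDeflation_karoubi_of_comp_eq hC (f ≫ g) hS
    (κ.f n ≫ eqToHom hV₁.symm ≫ θ.f n ≫ y') ?_
  simp only [Category.assoc, Karoubi.comp_f]
  rw [reassoc_of% hy', Karoubi.p_comp, reassoc_of% hθ.dLast, hy, ← reassoc_of% hV₂,
    eqToHom_trans_assoc, eqToHom_refl, Category.id_comp, reassoc_of% hκ.dLast, P.idem]

lemma isNExangulated_karoubi (hC : IsNExangulated n E s) :
    IsNExangulated n (karoubiExt E) (karoubiAssignment s) where
  isBiadditive := hC.isBiadditive.karoubiExt
  isExactRealisation := hC.isExactRealisation.karoubi hC.isBiadditive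
  inflation_comp _ _ hf hg := isInflation_karoubi_comp hC hf hg
  deflation_comp _ _ hf hg := isDeflation_karoubi_comp hC hf hg
  exists_good_lift δ c _ hZ' _ hZ := exists_good_lift_karoubi hC δ c hZ' hZ
  exists_good_lift_op δ a _ hZ _ hZ' := exists_good_lift_op_karoubi hC δ a hZ hZ'

end KaroubiInflation

end NExangulated

/-! ### Idempotents in semi-perfect rings -/

namespace NExangulated

section Semiperfect

variable {R : Type*} [Ring R]

lemma isUnit_one_add_of_mem_jacobson {x : R} (hx : x ∈ Ring.jacobson R) : IsUnit (1 + x) := by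
  have key : ∀ y ∈ Ring.jacobson R, ∃ s, s * (1 + y) = 1 := fun y hy => by
    have hy' : y ∈ Ideal.jacobson (⊥ : Ideal R) := by rwa [Ideal.jacobson_bot]
    obtain ⟨s, hs⟩ := Ideal.exists_mul_add_sub_mem_of_mem_jacobson y hy'
    refine ⟨s, ?_⟩
    rw [Ideal.mem_bot, sub_eq_zero] at hs
    rw [add_comm, hs]
  obtain ⟨s, hs⟩ := key x hx
  -- The left inverse `s` again has the form `1` plus a radical element, so it has a left inverse
  -- itself; hence `s` is two-sided.
  have hs' : s = 1 + -(s * x) := by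
    rw [eq_add_neg_iff_add_eq, ← mul_one_add, hs]
  obtain ⟨t, ht⟩ := key (-(s * x)) (neg_mem (Ideal.mul_mem_left _ s hx))
  rw [← hs'] at ht
  have : t = 1 + x := by
    calc t = t * (s * (1 + x)) := by rw [hs, mul_one]
      _ = 1 + x := by rw [← mul_assoc, ht, one_mul]
  exact ⟨⟨1 + x, s, this ▸ ht, hs⟩, rfl⟩

lemma eq_zero_of_isIdempotentElem_of_mem_jacobson {f : R} (hf : IsIdempotentElem f)
    (hJ : f ∈ Ring.jacobson R) : f = 0 := by
  have hu : IsUnit (1 + -f) := isUnit_one_add_of_mem_jacobson (neg_mem hJ)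
  have h : f * (1 + -f) = 0 := by rw [mul_add, mul_one, mul_neg, hf.eq, add_neg_cancel]
  exact hu.mul_left_eq_zero.1 h

/-- An idempotent is *primitive* if it is non-zero and is not the sum of two non-zero orthogonal
idempotents. -/
structure IsPrimitiveIdempotent (e : R) : Prop where
  isIdempotentElem : IsIdempotentElem e
  ne_zero : e ≠ 0
  eq_zero_or_eq : ∀ f : R, IsIdempotentElem f → e * f = f → f * e = f → f = 0 ∨ f = e

/-- This is what makes decomposition terminate. Equality of the left ideals modulo the radical would
put the idempotent `e - f` into the radical, and the only idempotent there is `0`. -/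
lemma span_mk_lt_span_mk {e f : R} (he : IsIdempotentElem e) (hf : IsIdempotentElem f)
    (h₁ : e * f = f) (h₂ : f * e = f) (hne : f ≠ e) :
    Ideal.span {Ideal.Quotient.mk (Ring.jacobson R) f} <
      Ideal.span {Ideal.Quotient.mk (Ring.jacobson R) e} := by
  refine lt_of_le_of_ne ?_ fun h => hne ?_
  · rw [Ideal.span_singleton_le_iff_mem, Ideal.mem_span_singleton']
    exact ⟨Ideal.Quotient.mk _ f, by rw [← map_mul, h₂]⟩
  · have hmem : Ideal.Quotient.mk (Ring.jacobson R) e ∈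
        Ideal.span {Ideal.Quotient.mk (Ring.jacobson R) f} := by
      rw [h]
      exact Ideal.mem_span_singleton_self _
    obtain ⟨a, ha⟩ := Ideal.mem_span_singleton'.1 hmem
    have hef : Ideal.Quotient.mk (Ring.jacobson R) (e - f) = 0 := by
      have : a * Ideal.Quotient.mk _ f * Ideal.Quotient.mk _ f = a * Ideal.Quotient.mk _ f := by
        rw [mul_assoc, ← map_mul, hf.eq]
      rw [ha, ← map_mul, h₁] at this
      rw [map_sub, this, sub_self]
    have hid : IsIdempotentElem (e - f) := by
      rw [IsIdempotentElem, mul_sub, sub_mul, sub_mul, he.eq, hf.eq, h₁, h₂]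
      abel
    exact (sub_eq_zero.1 (eq_zero_of_isIdempotentElem_of_mem_jacobson hid
      (Ideal.Quotient.eq_zero_iff_mem.1 hef))).symm

lemma sum_mul_eq {ι : Type*} [Fintype ι] {f : ι → R} (hf : OrthogonalIdempotents f) (i : ι) :
    (∑ j, f j) * f i = f i := by
  classical
  simp [Finset.sum_mul, hf.mul_eq]

/-- In a semi-perfect ring, every idempotent is a sum of orthogonal primitive idempotents. -/
lemma IsSemiperfectRing.exists_primitive (hR : IsSemiperfectRing R) {e : R}
    (he : IsIdempotentElem e) : ∃ (ι : Type) (_ : Fintype ι) (f : ι → R),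
      OrthogonalIdempotents f ∧ ∑ i, f i = e ∧ ∀ i, IsPrimitiveIdempotent (f i) := by
  have := hR.isSemisimpleRing
  -- The induction is on left ideals of the semisimple quotient, where the strict order is
  -- well-founded.
  induction h : Ideal.span {Ideal.Quotient.mk (Ring.jacobson R) e} using
    WellFoundedLT.induction generalizing e with
  | ind I ih =>
    by_cases h₀ : e = 0
    · exact ⟨Empty, inferInstance, Empty.elim, ⟨fun i => i.elim, fun i => i.elim⟩, by simp [h₀],
        fun i => i.elim⟩
    by_cases h₁ : ∀ f : R, IsIdempotentElem f → e * f = f → f * e = f → f = 0 ∨ f = e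
    · exact ⟨Unit, inferInstance, fun _ => e, ⟨fun _ => he, fun i j hij => (hij rfl).elim⟩,
        by simp, fun _ => ⟨he, h₀, h₁⟩⟩
    push Not at h₁
    obtain ⟨f, hf, hef, hfe, hf₀, hf₁⟩ := h₁
    have hg : IsIdempotentElem (e - f) := by
      rw [IsIdempotentElem, mul_sub, sub_mul, sub_mul, he.eq, hf.eq, hef, hfe]
      abel
    obtain ⟨ι, _, a, ha, has, hap⟩ := ih _ (h ▸ span_mk_lt_span_mk he hf hef hfe hf₁) hf rfl
    obtain ⟨κ, _, b, hb, hbs, hbp⟩ := ih _ (h ▸ span_mk_lt_span_mk he hg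
      (by rw [mul_sub, he.eq, hef]) (by rw [sub_mul, he.eq, hfe]) (by simpa using hf₀)) hg rfl
    have hfg : f * (e - f) = 0 := by rw [mul_sub, hfe, hf.eq, sub_self]
    have hgf : (e - f) * f = 0 := by rw [sub_mul, hef, hf.eq, sub_self]
    have ha₁ := fun i => sum_mul_eq ha i
    have ha₂ := fun i => ha.mul_sum_of_mem (Finset.mem_univ i)
    have hb₁ := fun i => sum_mul_eq hb i
    have hb₂ := fun i => hb.mul_sum_of_mem (Finset.mem_univ i)
    rw [has] at ha₁ ha₂
    rw [hbs] at hb₁ hb₂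
    refine ⟨ι ⊕ κ, inferInstance, Sum.elim a b, ⟨?_, ?_⟩, ?_, ?_⟩
    · rintro (i | i)
      exacts [ha.idem i, hb.idem i]
    · rintro (i | i) (j | j) hij
      · exact ha.ortho fun h => hij (congrArg Sum.inl h)
      · change a i * b j = 0
        rw [← ha₂, ← hb₁, mul_assoc, ← mul_assoc f, hfg, zero_mul, mul_zero]
      · change b i * a j = 0
        rw [← hb₂, ← ha₁, mul_assoc, ← mul_assoc (e - f), hgf, zero_mul, mul_zero]
      · exact hb.ortho fun h => hij (congrArg Sum.inr h)
    · rw [Fintype.sum_sum_type]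
      change ∑ i, a i + ∑ i, b i = e
      rw [has, hbs, add_sub_cancel]
    · rintro (i | i)
      exacts [hap i, hbp i]

/-- With the unit `u = 1 + (x - e)` one has `e * u = x = u * e`, so `e` commutes with `u⁻¹` and `e *
u⁻¹` inverts `x` in the corner ring. -/
lemma exists_inv_of_sub_mem_jacobson {e x : R} (he : IsIdempotentElem e) (h₁ : e * x = x)
    (h₂ : x * e = x) (hJ : x - e ∈ Ring.jacobson R) :
    ∃ b, e * b = b ∧ b * e = b ∧ x * b = e ∧ b * x = e := by
  obtain ⟨u, hu⟩ := isUnit_one_add_of_mem_jacobson hJ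
  have hx₁ : e * u = x := by rw [hu, mul_add, mul_sub, h₁, he.eq]; simp
  have hx₂ : u * e = x := by rw [hu, add_mul, sub_mul, h₂, he.eq]; simp
  have hc : e * (↑u⁻¹ : R) = ↑u⁻¹ * e := by
    rw [Units.eq_inv_mul_iff_mul_eq, ← mul_assoc, hx₂, ← hx₁, mul_assoc, Units.mul_inv, mul_one]
  refine ⟨e * ↑u⁻¹, ?_, ?_, ?_, ?_⟩
  · rw [← mul_assoc, he.eq]
  · rw [mul_assoc, ← hc, ← mul_assoc, he.eq]
  · rw [← mul_assoc, h₂, ← hx₁, mul_assoc, Units.mul_inv, mul_one]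
  · rw [mul_assoc, ← hx₂, ← mul_assoc (↑u⁻¹ : R), Units.inv_mul, one_mul, he.eq]

/-- Semisimple rings are von Neumann regular: splitting `1 = x * a + l` along a complement `L` of
the left ideal of `a` puts `a * l` into both ideals, so it is zero. -/
lemma exists_mul_mul_eq_self {S : Type*} [Ring S] [IsSemisimpleRing S] (a : S) :
    ∃ x, a * x * a = a := by
  obtain ⟨L, hL⟩ := exists_isCompl (Ideal.span {a})
  obtain ⟨y, hy, l, hl, hyl⟩ := Submodule.mem_sup.1
    (show (1 : S) ∈ Ideal.span {a} ⊔ L by rw [hL.sup_eq_top]; trivial)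
  obtain ⟨x, rfl⟩ := Ideal.mem_span_singleton'.1 hy
  have h : a = a * x * a + a * l := by rw [mul_assoc, ← mul_add, hyl, mul_one]
  refine ⟨x, ?_⟩
  have h₁ : a * l ∈ Ideal.span {a} ⊓ L := by
    refine ⟨?_, Ideal.mul_mem_left _ _ hl⟩
    rw [show a * l = a - a * x * a from eq_sub_of_add_eq' h.symm]
    exact sub_mem (Ideal.mem_span_singleton_self a)
      (Ideal.mul_mem_left _ _ (Ideal.mem_span_singleton_self a))
  rw [hL.inf_eq_bot, Submodule.mem_bot] at h₁
  rw [h₁, add_zero] at h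
  exact h.symm

namespace IsPrimitiveIdempotent

variable {e : R}

/-- An idempotent below the class of `e` lifts to one below `e`, where primitivity applies. An
arbitrary idempotent lift `r` is first conjugated by a unit congruent to `1`, then multiplied by
`e`. -/
lemma mk_eq_zero_or_eq (he : IsPrimitiveIdempotent e) (hR : IsSemiperfectRing R)
    {x : R ⧸ Ring.jacobson R} (hx : IsIdempotentElem x) (h₁ : Ideal.Quotient.mk _ e * x = x)
    (h₂ : x * Ideal.Quotient.mk _ e = x) : x = 0 ∨ x = Ideal.Quotient.mk _ e := by
  obtain ⟨r, hr, rfl⟩ := hR.lift_idempotent x hx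
  have hee := he.isIdempotentElem
  -- The unit is `u = 1 - r * (1 - e)`. It satisfies `r * u = r * e`, so the conjugate `u⁻¹ * r * u`
  -- equals `u⁻¹ * r * e` and absorbs `e` on the right.
  have hJ : -(r * (1 - e)) ∈ Ring.jacobson R := by
    rw [← Ideal.Quotient.eq_zero_iff_mem, map_neg, map_mul, map_sub, map_one, mul_sub, mul_one, h₂,
      sub_self, neg_zero]
  obtain ⟨u, hu⟩ := isUnit_one_add_of_mem_jacobson hJ
  have hue : (u : R) * e = e := by
    rw [hu, add_mul, neg_mul, mul_assoc, sub_mul, hee.eq]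
    simp
  have hru : r * u = r * e := by
    rw [hu, mul_add, mul_neg, ← mul_assoc, hr.eq]
    simp [mul_sub]
  have hue' : (↑u⁻¹ : R) * e = e := by rw [Units.inv_mul_eq_iff_eq_mul, hue]
  have hmu : Ideal.Quotient.mk (Ring.jacobson R) (u : R) = 1 := by
    rw [hu, map_add, Ideal.Quotient.eq_zero_iff_mem.2 hJ, map_one, add_zero]
  have hmu' : Ideal.Quotient.mk (Ring.jacobson R) (↑u⁻¹ : R) = 1 := by
    calc Ideal.Quotient.mk (Ring.jacobson R) (↑u⁻¹ : R) = Ideal.Quotient.mk _ (↑u⁻¹ : R) *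
          Ideal.Quotient.mk _ (u : R) := by rw [hmu, mul_one]
      _ = 1 := by rw [← map_mul, Units.inv_mul, map_one]
  obtain ⟨r', hr'⟩ : ∃ r', r' = (↑u⁻¹ : R) * r * e := ⟨_, rfl⟩
  have hr₁ : r' * e = r' := by rw [hr', mul_assoc, hee.eq]
  have hr₂ : r' = (↑u⁻¹ : R) * r * u := by rw [hr', mul_assoc, mul_assoc, hru]
  have hr₃ : r' * r' = r' := by
    have : (↑u⁻¹ : R) * r * u * (↑u⁻¹ * r * u) = ↑u⁻¹ * r * (u * ↑u⁻¹) * r * u := by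
      simp only [mul_assoc]
    rw [hr₂, this, Units.mul_inv, mul_one, mul_assoc _ r r, hr.eq]
  have hmr : Ideal.Quotient.mk (Ring.jacobson R) (e * r') = Ideal.Quotient.mk _ r := by
    rw [hr', map_mul, map_mul, map_mul, hmu', one_mul, h₂, h₁]
  have hf : IsIdempotentElem (e * r') := by
    rw [IsIdempotentElem, mul_assoc, ← mul_assoc r', hr₁, hr₃]
  rw [← hmr]
  obtain h | h := he.eq_zero_or_eq (e * r') hf (by rw [← mul_assoc, hee.eq])
    (by rw [mul_assoc, hr₁])
  · left; rw [h, map_zero]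
  · right; rw [h]

/-- The corner ring of `e` is local. If `a` is in the radical, `e - a` is invertible. Otherwise
regularity modulo the radical gives `z` in the corner such that `a * z` and `z * a` are nonzero
idempotents below `e` modulo the radical, hence congruent to `e` and invertible in the corner. -/
lemma exists_inv (he : IsPrimitiveIdempotent e) (hR : IsSemiperfectRing R) {a : R}
    (h₁ : e * a = a) (h₂ : a * e = a) :
    (∃ b, e * b = b ∧ b * e = b ∧ a * b = e ∧ b * a = e) ∨
      ∃ b, e * b = b ∧ b * e = b ∧ (e - a) * b = e ∧ b * (e - a) = e := by
  have := hR.isSemisimpleRing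
  have hee := he.isIdempotentElem
  by_cases ha : Ideal.Quotient.mk (Ring.jacobson R) a = 0
  · right
    refine exists_inv_of_sub_mem_jacobson hee (by rw [mul_sub, h₁, hee.eq])
      (by rw [sub_mul, h₂, hee.eq]) ?_
    rw [sub_sub_cancel_left]
    exact neg_mem (Ideal.Quotient.eq_zero_iff_mem.1 ha)
  · left
    obtain ⟨x, hx⟩ := exists_mul_mul_eq_self (Ideal.Quotient.mk (Ring.jacobson R) a)
    obtain ⟨y, rfl⟩ := Ideal.Quotient.mk_surjective x
    simp only [← map_mul] at hx
    obtain ⟨z, hz⟩ : ∃ z, z = e * y * e := ⟨_, rfl⟩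
    have hz₁ : e * z = z := by rw [hz, ← mul_assoc, ← mul_assoc, hee.eq]
    have hz₂ : z * e = z := by rw [hz, mul_assoc, hee.eq]
    have haz : a * z * a = a * y * a := by
      rw [hz, ← mul_assoc, ← mul_assoc, h₂, mul_assoc, h₁]
    have haz' : Ideal.Quotient.mk (Ring.jacobson R) (a * z * a) = Ideal.Quotient.mk _ a := by
      rw [haz, hx]
    have key₁ : a * z - e ∈ Ring.jacobson R := by
      rw [← Ideal.Quotient.eq_zero_iff_mem, map_sub, sub_eq_zero]
      refine (he.mk_eq_zero_or_eq hR (x := Ideal.Quotient.mk _ (a * z)) ?_ ?_ ?_).resolve_left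
        fun h => ha ?_
      · rw [IsIdempotentElem, ← map_mul, ← mul_assoc, map_mul, haz', ← map_mul]
      · rw [← map_mul, ← mul_assoc, h₁]
      · rw [← map_mul, mul_assoc, hz₂]
      · rw [← haz', map_mul, h, zero_mul]
    have key₂ : z * a - e ∈ Ring.jacobson R := by
      rw [← Ideal.Quotient.eq_zero_iff_mem, map_sub, sub_eq_zero]
      refine (he.mk_eq_zero_or_eq hR (x := Ideal.Quotient.mk _ (z * a)) ?_ ?_ ?_).resolve_left
        fun h => ha ?_
      · rw [IsIdempotentElem, ← map_mul, mul_assoc, ← mul_assoc a, map_mul, haz', ← map_mul]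
      · rw [← map_mul, ← mul_assoc, hz₁]
      · rw [← map_mul, mul_assoc, h₂]
      · rw [← haz', mul_assoc, map_mul, h, mul_zero]
    obtain ⟨b, hb₁, hb₂, hb₃, -⟩ := exists_inv_of_sub_mem_jacobson hee
      (by rw [← mul_assoc, h₁]) (by rw [mul_assoc, hz₂]) key₁
    obtain ⟨c, hc₁, hc₂, -, hc₃⟩ := exists_inv_of_sub_mem_jacobson hee
      (by rw [← mul_assoc, hz₁]) (by rw [mul_assoc, h₂]) key₂
    -- The left inverse `c * z` and the right inverse `z * b` of `a` coincide.
    have hcb : c * z = z * b := by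
      calc c * z = c * z * (a * z * b) := by rw [hb₃, mul_assoc, hz₂]
        _ = c * (z * a) * (z * b) := by simp only [mul_assoc]
        _ = z * b := by rw [hc₃, ← mul_assoc, hz₁]
    refine ⟨z * b, by rw [← mul_assoc, hz₁], by rw [mul_assoc, hb₂], by rw [← mul_assoc, hb₃], ?_⟩
    rw [← hcb, mul_assoc, hc₃]

end IsPrimitiveIdempotent

end Semiperfect

/-! ### The Krull-Schmidt property of the idempotent completion -/

section KrullSchmidt

open Idempotents

variable {C : Type u} [Category.{v} C] [Preadditive C]

/-- The endomorphism ring of `P` is the corner of `End P.X` at `P.p`, so the dichotomy for primitive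
idempotents applies. -/
lemma isLocalRing_end_karoubi (hEnd : ∀ X : C, IsSemiperfectRing (End X)) (P : Karoubi C)
    (hP : IsPrimitiveIdempotent (R := End P.X) P.p) : IsLocalRing (End P) := by
  have hne : Nontrivial (End P) := by
    refine ⟨⟨𝟙 P, 0, fun h => hP.ne_zero ?_⟩⟩
    exact congrArg Karoubi.Hom.f h
  refine ⟨fun {a b} hab => ?_⟩
  have hb : b.f = P.p - a.f := eq_sub_of_add_eq' (congrArg Karoubi.Hom.f hab)
  have key : ∀ c : P ⟶ P, (∃ d : P.X ⟶ P.X, d ≫ P.p = d ∧ P.p ≫ d = d ∧ d ≫ c.f = P.p ∧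
      c.f ≫ d = P.p) → IsUnit (show End P from c) := by
    rintro c ⟨d, hd₁, hd₂, hd₃, hd₄⟩
    let d' : P ⟶ P := ⟨d, by rw [hd₁, hd₂]⟩
    exact ⟨⟨c, d', Karoubi.Hom.ext hd₃, Karoubi.Hom.ext hd₄⟩, rfl⟩
  obtain h | h := hP.exists_inv (hEnd P.X) (a := (a.f : P.X ⟶ P.X)) (Karoubi.comp_p a)
    (Karoubi.p_comp a)
  · exact Or.inl (key a h)
  · refine Or.inr (key b ?_)
    rw [hb]
    exact h

variable [HasFiniteBiproducts C]

/-- A decomposition of `P.p` into orthogonal primitive idempotents `f i` exhibits `P` as the direct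
sum of the objects `(P.X, f i)`. -/
lemma isKrullSchmidt_karoubi (hEnd : ∀ X : C, IsSemiperfectRing (End X)) :
    IsKrullSchmidt (Karoubi C) := by
  intro P
  obtain ⟨ι, _, f', hf', hs', hp'⟩ := (hEnd P.X).exists_primitive (e := P.p) P.idem
  let σ := (Fintype.equivFin ι).symm
  obtain ⟨m, f, hf, hs, hp⟩ : ∃ (m : ℕ) (f : Fin m → End P.X), OrthogonalIdempotents f ∧
      ∑ i, f i = P.p ∧ ∀ i, IsPrimitiveIdempotent (f i) :=
    ⟨_, f' ∘ σ, (OrthogonalIdempotents.equiv σ).2 hf', (σ.sum_comp f').trans hs', fun i => hp' _⟩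
  have h₁ : ∀ i, f i ≫ P.p = f i := fun i => hs ▸ sum_mul_eq hf i
  have h₂ : ∀ i, P.p ≫ f i = f i := fun i => hs ▸ hf.mul_sum_of_mem (Finset.mem_univ i)
  have h₃ : ∀ i, f i ≫ f i = f i := fun i => hf.idem i
  let Y : Fin m → Karoubi C := fun i => ⟨P.X, f i, h₃ i⟩
  let π : ∀ i, P ⟶ Y i := fun i => ⟨f i, by
    change P.p ≫ f i ≫ f i = f i
    rw [h₃, h₂]⟩
  let κ : ∀ i, Y i ⟶ P := fun i => ⟨f i, by
    change f i ≫ f i ≫ P.p = f i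
    rw [h₁, h₃]⟩
  refine ⟨m, Y, fun i => isLocalRing_end_karoubi hEnd (Y i) (hp i),
    ⟨⟨biproduct.lift π, biproduct.desc κ, ?_, ?_⟩⟩⟩
  · rw [biproduct.lift_desc]
    ext
    rw [Karoubi.sum_hom]
    refine Eq.trans (Finset.sum_congr rfl fun i _ => ?_) hs
    exact h₃ i
  · refine biproduct.hom_ext' _ _ fun i => biproduct.hom_ext _ _ fun j => ?_
    rw [biproduct.ι_desc_assoc, Category.assoc, biproduct.lift_π, Category.comp_id,
      biproduct.ι_π]
    split_ifs with h
    · subst h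
      exact Karoubi.Hom.ext (h₃ i)
    · exact Karoubi.Hom.ext (hf.ortho (Ne.symm h))

end KrullSchmidt

end NExangulated

end

theorem corollary4p18 {C : Type u} [Category.{v} C] [Preadditive C] [HasFiniteBiproducts C]
    (n : ℕ) [NeZero n] (E : Cᵒᵖ ⥤ C ⥤ AddCommGrpCat.{w})
    (s : NExangulated.Assignment n E) (hC : NExangulated.IsNExangulated n E s)
    (hEnd : ∀ X : C, NExangulated.IsSemiperfectRing (End X)) :
    NExangulated.IsNExangulated n (NExangulated.karoubiExt E) (NExangulated.karoubiAssignment s) ∧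
      NExangulated.IsKrullSchmidt (Idempotents.Karoubi C) :=
  ⟨NExangulated.isNExangulated_karoubi hC, NExangulated.isKrullSchmidt_karoubi hEnd⟩
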